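/- **Setting.** The Heisenberg group $\mathbb H^1$ is $\mathbb R^3$ with $(x,y,t)*(x',y',t')=(x+x',y+y',t+t'+x'y-xy')$, left-invariant fields $X=\partial_x+y\partial_t$, $Y=\partial_y-x\partial_t$ and horizontal planes $\mathrm{span}(X,Y)$; identify $\mathbb R^2=\mathbb C$, $fX+gY$ with $f+ig$, and let $J$ be multiplication by $i$. A convex body $K\subset\mathbb R^2$ is of class $C^\ell_+$ ($\ell\ge2$) if $\partial K$ is of class $C^\ell$ with positive geodesic curvature. Let $K$ be a convex body of class $C^2_+$ with $0\in\mathrm{int}(K)$; for $w\neq0$ let $\pi_K(w)$ be the unique point of $\partial K$ with outer normal $w/|w|$. The horizontal $K$-perimeter of a measurable set $E$ in an open set $\Omega$ is $$P_K(E,\Omega)=\sup\Big\{\int_E (Xf+Yg)\,dx\,dy\,dt:\ U=fX+gY \text{ of class } C^1 \text{ with compact support in } \Omega,\ \|U_p\|_K\le 1\ \ \forall p\Big\},$$ where $\|\cdot\|_K$ is the asymmetric norm (gauge) with unit ball $K$. With $B_R$ the open Euclidean ball of radius $R$ centred at $0$, a measurable set $E$ is *$K$-perimeter-minimizing* if $P_K(E,B_R)<\infty$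 for every $R$, and $P_K(E,B_R)\le P_K(F,B_R)$ whenever $r<R$ and $F$ is a measurable set that coincides with $E$ outside $B_r$. Let $v\in\mathbb R^2\setminus\{0\}$ and $L_v=\mathbb R v$. For $a\in(0,\pi)$ let $\beta_{K,v}(a)$ be the unique $b\in(\pi,2\pi)$ such that $\pi_K(J(ve^{ia}))-\pi_K(J(ve^{ib}))\in L_v$. Let $k\ge2$, let $\alpha:\mathbb R\to(0,\pi)$ be a non-increasing function of class $C^k$, and put $\beta(\lambda)=\beta_{K,v}(\alpha(\lambda))$. Let $r_\lambda^+$, $r_\lambda^-$ be the half-lines in $\mathbb R^2$ issuing from $\lambda v$ at angles $\alpha(\lambda)$, $\beta(\lambda)$ with $v$, let $R^\pm_\lambda$ be their horizontal lifts issuing from $(\lambda v,0)$, and $\Sigma_{v,\alpha}=\bigcup_{\lambda\in\mathbb R}(R^+_\lambda\cup R^-_\lambda)$. **Proposition.** If $1\le m\le k$ and $K$ is of class $C^{m+1}_+$, then $\beta\in C^m(\mathbb R)$. The surface $\Sigma_{v,\alpha}$ is the graph of a continuous function $u_\alpha:\mathbb R^2\to\mathbb R$, and: 1. $u_\alpha$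 is $C^k$ on the open side of $L_v$ containing the half-lines $r^+_\lambda$ minus their endpoints; for every $m\le k$, if $\beta\in C^m(\mathbb R)$ then $u_\alpha$ is $C^m$ on $\mathbb R^2\setminus L_v$. In particular $u_\alpha$ is $C^k$ on $\mathbb R^2\setminus L_v$ if $K$ is of class $C^{k+1}_+$. 2. $u_\alpha$ is $C^1$ on $\mathbb R^2$. If $\beta\in C^2(\mathbb R)$ (in particular, if $K$ is of class $C^3_+$), then every point of $L_v$ has a neighbourhood on which the differential of $u_\alpha$ is Lipschitz, so that $u_\alpha$ is $C^{1,1}$ near $L_v$. If $\beta(\lambda)\ne\alpha(\lambda)+\pi$, then $u_\alpha$ is not $C^2$ in any neighbourhood of $\lambda v$. 3. If $I\subseteq\mathbb R$ is open and $\beta=\alpha+\pi$ on $I$, then $\bigcup_{\lambda\in I}(r_\lambda^+\cup r_\lambda^-)$ is open and $u_\alpha$ is $C^\infty$ on it. 4. $\Sigma_{v,\alpha}$ is $K$-perimeter-minimizing: the region $\{t>u_\alpha(x,y)\}$, whose outer horizontal normal at the regular points of $R^\pm_\lambda$ is a positive multiple of $J(ve^{i\alpha(\lambda)})$, respectively $J(ve^{i\beta(\lambda)})$,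 is $K$-perimeter-minimizing. If $K=-K$, the region $\{t<u_\alpha(x,y)\}$ is $K$-perimeter-minimizing as well. 5. The set of singular points of $\Sigma_{v,\alpha}$, i.e. the points at which its tangent plane is the horizontal plane, projects onto $L_v$. -/

import Mathlib

open Real Set Topology MeasureTheory
open scoped ENNReal

noncomputable section

/-! The Heisenberg group is modelled on `ℂ × ℝ`, a point `(x, y, t)` being `(x + iy, t)`.
A horizontal vector `f X + g Y` is identified with the complex number `f + ig`;
then `J` is multiplication by `Complex.I`. -/

/-- The group law `(x,y,t) * (x',y',t') = (x+x', y+y', t+t'+x'y-xy')`. -/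
def heisMul (p q : ℂ × ℝ) : ℂ × ℝ :=
  (p.1 + q.1, p.2 + q.2 + q.1.re * p.1.im - p.1.re * q.1.im)

/-- The left invariant field `X = ∂x + y ∂t` at `p`. -/
def heisX (p : ℂ × ℝ) : ℂ × ℝ := (1, p.1.im)

/-- The left invariant field `Y = ∂y - x ∂t` at `p`. -/
def heisY (p : ℂ × ℝ) : ℂ × ℝ := (Complex.I, -p.1.re)

/-- The horizontal plane at `p`. -/
def horizontalPlane (p : ℂ × ℝ) : Submodule ℝ (ℂ × ℝ) :=
  Submodule.span ℝ {heisX p, heisY p}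

/-! ### Convex bodies, their Gauss map -/

/-- `K` is a convex body in the plane whose boundary is of class `C^ℓ` with positive geodesic
curvature: near each boundary point `p`, `K = {ρ ≤ 0}` for a `C^ℓ` function `ρ` with `dρ(p) ≠ 0`,
and the second derivative of `ρ` is positive on the tangent line of `∂K` (the curvature of
`∂K` at `p` is `D²ρ(τ,τ) / |∇ρ|`, where `τ` is a unit tangent vector). Meant for `ℓ ≥ 2`. -/
structure IsConvexBodyCPlus (ℓ : ℕ) (K : Set ℂ) : Prop where
  isCompact : IsCompact K
  convex : Convex ℝ K
  interior_nonempty : (interior K).Nonempty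
  boundary : ∀ p ∈ frontier K, ∃ ρ : ℂ → ℝ,
    ContDiffAt ℝ ℓ ρ p ∧ (∀ᶠ z in 𝓝 p, z ∈ K ↔ ρ z ≤ 0) ∧ fderiv ℝ ρ p ≠ 0 ∧
    ∀ w : ℂ, w ≠ 0 → fderiv ℝ ρ p w = 0 → 0 < fderiv ℝ (fderiv ℝ ρ) p w w

/-- `w` is an outer normal vector to `K` at the boundary point `p`. -/
def IsOuterNormalAt (K : Set ℂ) (w p : ℂ) : Prop :=
  p ∈ frontier K ∧ ∀ q ∈ K, inner ℝ w q ≤ inner ℝ w p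

/-- `π_K(w) = N_K⁻¹(w / |w|)`: the boundary point of `K` with outer normal direction `w ≠ 0`
(it is unique when the boundary has positive curvature). -/
def gaussInv (K : Set ℂ) (w : ℂ) : ℂ :=
  Classical.epsilon fun p => IsOuterNormalAt K w p

/-- The angle `β ∈ (π, 2π)` attached to `a ∈ (0, π)`: with `Z⁺ = v e^{ia}` and `Z⁻ = v e^{iβ}`, the
vector `π_K(J Z⁺) - π_K(J Z⁻)` lies on the line generated by `v`. -/
def conjAngle (K : Set ℂ) (v : ℂ) (a : ℝ) : ℝ :=
  Classical.epsilon fun b : ℝ => b ∈ Ioo π (2 * π) ∧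
    gaussInv K (Complex.I * (v * Complex.exp (a * Complex.I))) -
      gaussInv K (Complex.I * (v * Complex.exp (b * Complex.I))) ∈ Submodule.span ℝ {v}

/-! ### Herringbone surfaces -/

/-- The line `L_v`. -/
def lineThrough (v : ℂ) : Set ℂ := {z | ∃ l : ℝ, z = (l : ℂ) * v}

/-- The planar half-line issuing from `l v` and making the (oriented) angle `θ` with `v`. -/
def planarRay (v : ℂ) (l θ : ℝ) : Set ℂ :=
  {z | ∃ s : ℝ, 0 ≤ s ∧ z = (l : ℂ) * v + (s : ℂ) * (v * Complex.exp (θ * Complex.I))}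

/-- The horizontal half-line issuing from `(l v, 0)` that lifts `planarRay v l θ`: the left
translate by `(l v, 0)` of a half-line through the identity in the plane `t = 0`. -/
def horizontalRay (v : ℂ) (l θ : ℝ) : Set (ℂ × ℝ) :=
  {p | ∃ s : ℝ, 0 ≤ s ∧
    p = heisMul ((l : ℂ) * v, 0) ((s : ℂ) * (v * Complex.exp (θ * Complex.I)), 0)}

/-- The union of the planar half-lines with foot parameter in `A`. -/
def planarSweep (v : ℂ) (α β : ℝ → ℝ) (A : Set ℝ) : Set ℂ :=
  ⋃ l ∈ A, planarRay v l (α l) ∪ planarRay v l (β l)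

/-- The surface made of the horizontal half-lines of angles `α l` and `β l` issuing from the
points `(l v, 0)`. -/
def herringbone (v : ℂ) (α β : ℝ → ℝ) : Set (ℂ × ℝ) :=
  ⋃ l : ℝ, horizontalRay v l (α l) ∪ horizontalRay v l (β l)

/-- The tangent plane at `(z, u z)` of the graph of `u` (for `u` differentiable at `z`). -/
def graphTangentPlane (u : ℂ → ℝ) (z : ℂ) : Submodule ℝ (ℂ × ℝ) :=
  LinearMap.range ((LinearMap.id : ℂ →ₗ[ℝ] ℂ).prod (fderiv ℝ u z : ℂ →ₗ[ℝ] ℝ))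

/-- The singular set of the graph of `u`: the points at which the tangent plane is horizontal. -/
def graphSingularSet (u : ℂ → ℝ) : Set (ℂ × ℝ) :=
  {p | p.2 = u p.1 ∧ DifferentiableAt ℝ u p.1 ∧ graphTangentPlane u p.1 = horizontalPlane p}

/-! ### Perimeter -/

/-- The divergence `X f + Y g` of the horizontal field `U = f X + g Y`, `U = f + ig`. It is the
Riemannian divergence, as `X` and `Y` are divergence free. -/
def horizontalDiv (U : ℂ × ℝ → ℂ) (p : ℂ × ℝ) : ℝ :=
  fderiv ℝ (fun q => (U q).re) p (heisX p) + fderiv ℝ (fun q => (U q).im) p (heisY p)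

/-- `C^1` horizontal fields with compact support in `Ω` and `‖U‖_K ≤ 1` everywhere. -/
structure IsAdmissibleField (K : Set ℂ) (Ω : Set (ℂ × ℝ)) (U : ℂ × ℝ → ℂ) : Prop where
  contDiff : ContDiff ℝ 1 U
  hasCompactSupport : HasCompactSupport U
  tsupport_subset : tsupport U ⊆ Ω
  gauge_le : ∀ p, gauge K (U p) ≤ 1

/-- The horizontal `K`-perimeter of `E` in `Ω`. The Riemannian volume is Lebesgue measure. (The
field `U = 0` is admissible, so that `ENNReal.ofReal` does not change the supremum.) -/
def perimeterK (K : Set ℂ) (E Ω : Set (ℂ × ℝ)) : ℝ≥0∞ :=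
  ⨆ (U : ℂ × ℝ → ℂ) (_ : IsAdmissibleField K Ω U), ENNReal.ofReal (∫ p in E, horizontalDiv U p)

/-- The open Euclidean ball of radius `r` centred at the origin of `ℝ³`. -/
def euclideanBall (r : ℝ) : Set (ℂ × ℝ) := {p | √(‖p.1‖ ^ 2 + p.2 ^ 2) < r}

/-- `E` has locally finite `K`-perimeter, and this perimeter does not decrease under
perturbations of `E` with compact support. -/
structure IsPerimeterMinimizing (K : Set ℂ) (E : Set (ℂ × ℝ)) : Prop where
  measurableSet : MeasurableSet E
  locallyFinite : ∀ R : ℝ, perimeterK K E (euclideanBall R) < ⊤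
  minimal : ∀ F : Set (ℂ × ℝ), MeasurableSet F → ∀ r R : ℝ, r < R →
    (∀ p, p ∉ euclideanBall r → (p ∈ F ↔ p ∈ E)) →
    perimeterK K E (euclideanBall R) ≤ perimeterK K F (euclideanBall R)

end

/-! ### Gauss–Green formula on the epigraph of a `C^1` function. -/

noncomputable section

/-! Write `z = (x + iy) v`, `A = cot α`, `B = cot β`. The half-lines with foot `l` are `x = l + y
A(l)` for `y ≥ 0` and `x = l + y B(l)` for `y ≤ 0`. As `α` decreases, `A` increases; the height of
the Gauss curve over `L_v` is strictly monotone on `[0, π]` and on `[π, 2π]`, so `β` increases and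
`B` decreases. Hence every point of the plane has exactly one foot `Λ(z)` (`sweepFoot`). The height
along a horizontal lift is `-‖v‖² y l`, so the surface is the graph of `u = -‖v‖² y Λ`
(`sweepHeight`).

Regularity. The implicit function theorem solves `x = l + y A(l)`, also at boundary points `y = 0`
(`footParam_extension`); thus `u` is, on each side of `L_v`, the restriction of a function as
regular as `A` or `B`. Since `Λ = x` on `L_v`, both restrictions have differential `-‖v‖² x dy`
there, which gives `C^1`, and a locally Lipschitz differential when both pieces are `C^2`. The
one-sided second derivatives across `L_v` are `2‖v‖² A(l)` and `2‖v‖² B(l)`, so `C^2` forces `A(l) =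
B(l)`, i.e. `β = α + π`. Where `A = B` on an open set, this function is both monotone and antitone,
so locally constant, and `u` is locally quadratic. The regularity of `β` comes from that of the
Gauss curve (`contDiff_gaussCurve`) and the inverse function theorem.

Minimality is a calibration. Let `U(z)` be the point of `∂K` whose outer normal is `J` of the
direction of the half-line through `z`. The derivative of the Gauss curve is tangent to that
direction and `U` is constant along half-lines, so `U` is divergence free on each side; the
definition of `β` says precisely that the component of `U` normal to `L_v` does not jump, so `U` is
weakly divergence free on the plane (`isWeaklyDivFree_sweep`). The normal of the graph is a positive
multiple of `J` of the direction off `L_v` (`inner_graphNormal_sweepHeight`), so `U` maximises the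
pairing with it over `K`. Extended independently of `t`, mollified and cut off, `U` is a competitor
in the definition of perimeter, and `isPerimeterMinimizing_epigraph` concludes. The same formula for
the normal shows that it vanishes only on `L_v`. -/

theorem integral_fderiv_apply_eq_zero {E : Type*} [NormedAddCommGroup E] [NormedSpace ℝ E]
    [MeasurableSpace E] [BorelSpace E] [FiniteDimensional ℝ E] (μ : Measure E)
    [μ.IsAddHaarMeasure] {f : E → ℝ} (hf : ContDiff ℝ 1 f) (hc : HasCompactSupport f) (w : E) :
    ∫ x, fderiv ℝ f x w ∂μ = 0 := by
  have h1 : Continuous fun x => fderiv ℝ f x w :=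
    (hf.continuous_fderiv one_ne_zero).clm_apply continuous_const
  have h2 : HasCompactSupport fun x => fderiv ℝ f x w := hc.fderiv_apply ℝ w
  have := integral_mul_fderiv_eq_neg_fderiv_mul_of_integrable (μ := μ) (f := fun _ : E => (1 : ℝ))
    (g := f) (v := w) (by simp) (by simpa using h1.integrable_of_hasCompactSupport h2)
    (by simpa using hf.continuous.integrable_of_hasCompactSupport hc)
    (fun _ _ => differentiableAt_const _)
    (fun x _ => hf.differentiable one_ne_zero x)
  simpa using this

/-- The vertical shear by the graph of `u`. -/
def graphShear (u : ℂ → ℝ) (p : ℂ × ℝ) : ℂ × ℝ := (p.1, u p.1 + p.2)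

def graphShearHomeomorph (u : ℂ → ℝ) (hu : Continuous u) : ℂ × ℝ ≃ₜ ℂ × ℝ where
  toFun := graphShear u
  invFun := fun p => (p.1, p.2 - u p.1)
  left_inv p := by simp [graphShear]
  right_inv p := by simp [graphShear]
  continuous_toFun := by unfold graphShear; fun_prop
  continuous_invFun := by fun_prop

theorem measurePreserving_graphShear (u : ℂ → ℝ) (hu : Continuous u) :
    MeasurePreserving (graphShear u) := by
  refine (MeasurePreserving.id (volume : Measure ℂ)).skew_product (g := fun z t => u z + t)
    (by fun_prop) ?_
  exact Filter.Eventually.of_forall fun z => (measurePreserving_add_left volume (u z)).map_eq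

/-- The shear is a translation on each vertical line, hence preserves volume, and flattens the
epigraph to a half-space. -/
theorem setIntegral_epigraph_eq (u : ℂ → ℝ) (hu : Continuous u) (F : ℂ × ℝ → ℝ) :
    ∫ p in {p : ℂ × ℝ | u p.1 < p.2}, F p =
      ∫ p in (univ : Set ℂ) ×ˢ Ioi (0 : ℝ), F (graphShear u p) := by
  have h := (measurePreserving_graphShear u hu).setIntegral_preimage_emb
    (graphShearHomeomorph u hu).measurableEmbedding F {p : ℂ × ℝ | u p.1 < p.2}
  rw [← h]
  congr 2
  ext p
  simp [graphShear]

/-- Gauss-Green formula on the epigraph of `u` for the scalar function `f` and the field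
`p ↦ (e, a p.1)`. -/
theorem integral_epigraph_fderiv (u : ℂ → ℝ) (hu : ContDiff ℝ 1 u) (f : ℂ × ℝ → ℝ)
    (hf : ContDiff ℝ 1 f) (hc : HasCompactSupport f) (e : ℂ) (a : ℂ → ℝ) (ha : Continuous a) :
    ∫ p in {p : ℂ × ℝ | u p.1 < p.2}, fderiv ℝ f p (e, a p.1) =
      ∫ z, (fderiv ℝ u z e - a z) * f (z, u z) := by
  have huc := hu.continuous
  set g : ℂ × ℝ → ℝ := fun p => f (graphShear u p) with hg
  have hS : ContDiff ℝ 1 (graphShear u) := by unfold graphShear; fun_prop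
  have hgC : ContDiff ℝ 1 g := hf.comp hS
  have hgc : HasCompactSupport g := hc.comp_homeomorph (graphShearHomeomorph u huc)
  have hfd : ∀ p : ℂ × ℝ, ∀ w : ℂ × ℝ, fderiv ℝ g p w =
      fderiv ℝ f (graphShear u p) (w.1, fderiv ℝ u p.1 w.1 + w.2) := by
    intro p w
    have h1 : HasFDerivAt (graphShear u) ((ContinuousLinearMap.fst ℝ ℂ ℝ).prod
        ((fderiv ℝ u p.1).comp (ContinuousLinearMap.fst ℝ ℂ ℝ) +
          ContinuousLinearMap.snd ℝ ℂ ℝ)) p := by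
      refine hasFDerivAt_fst.prodMk (HasFDerivAt.add ?_ hasFDerivAt_snd)
      exact ((hu.differentiable one_ne_zero p.1).hasFDerivAt).comp p hasFDerivAt_fst
    have h2 := ((hf.differentiable one_ne_zero (graphShear u p)).hasFDerivAt).comp p h1
    rw [show g = f ∘ graphShear u from rfl, h2.fderiv]
    simp
  -- In the sheared coordinates the field splits into a part tangent to the slices `t = const`,
  -- which integrates to zero, and a vertical part with coefficient independent of `t`, which
  -- produces the boundary term.
  have key : ∀ p : ℂ × ℝ, fderiv ℝ f (graphShear u p) (e, a p.1) =
      fderiv ℝ g p (e, 0) + (a p.1 - fderiv ℝ u p.1 e) * fderiv ℝ g p (0, 1) := by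
    intro p
    rw [hfd, hfd, ← smul_eq_mul, ← map_smul, ← map_add]
    congr 1
    ext <;> simp
  have hcont : ∀ w, Continuous fun p => fderiv ℝ g p w := fun w =>
    (hgC.continuous_fderiv one_ne_zero).clm_apply continuous_const
  have hcs : ∀ w, HasCompactSupport fun p => fderiv ℝ g p w := fun w => hgc.fderiv_apply ℝ w
  have hdu : Continuous fun z => fderiv ℝ u z e :=
    (hu.continuous_fderiv one_ne_zero).clm_apply continuous_const
  have i1 : Integrable fun p => fderiv ℝ g p (e, 0) :=
    (hcont _).integrable_of_hasCompactSupport (hcs _)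
  have i2 : Integrable fun p : ℂ × ℝ =>
      (a p.1 - fderiv ℝ u p.1 e) * fderiv ℝ g p (0, 1) := by
    refine Continuous.integrable_of_hasCompactSupport ?_ ((hcs _).mul_left)
    exact ((ha.comp continuous_fst).sub (hdu.comp continuous_fst)).mul (hcont _)
  have slice1 : ∀ t : ℝ, ∫ z, fderiv ℝ g (z, t) (e, 0) = 0 := by
    intro t
    have hs : ContDiff ℝ 1 fun z : ℂ => g (z, t) := hgC.comp (by fun_prop)
    have hsc : HasCompactSupport fun z : ℂ => g (z, t) :=
      
      HasCompactSupport.intro (hgc.isCompact.image continuous_fst) fun z hz => by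
        by_contra h
        exact hz ⟨(z, t), subset_tsupport _ h, rfl⟩
    have h3 := integral_fderiv_apply_eq_zero volume hs hsc e
    refine Eq.trans (integral_congr_ae (Filter.Eventually.of_forall fun z => ?_)) h3
    have h4 : HasFDerivAt (fun z : ℂ => (z, t)) (ContinuousLinearMap.inl ℝ ℂ ℝ) z :=
      hasFDerivAt_prodMk_left z t
    have h5 := ((hgC.differentiable one_ne_zero (z, t)).hasFDerivAt).comp z h4
    change _ = fderiv ℝ (g ∘ fun z : ℂ => (z, t)) z e
    rw [h5.fderiv]
    simp
  have slice2 : ∀ z : ℂ, ∫ t in Ioi (0 : ℝ), fderiv ℝ g (z, t) (0, 1) = - f (z, u z) := by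
    intro z
    have hs : ContDiff ℝ 1 fun t : ℝ => g (z, t) := hgC.comp (by fun_prop)
    have hsc : HasCompactSupport fun t : ℝ => g (z, t) :=
      
      HasCompactSupport.intro (hgc.isCompact.image continuous_snd) fun t ht => by
        by_contra h
        exact ht ⟨(z, t), subset_tsupport _ h, rfl⟩
    have h3 := hsc.integral_Ioi_deriv_eq hs 0
    have h0 : g (z, 0) = f (z, u z) := by simp [hg, graphShear]
    rw [h0] at h3
    refine Eq.trans (integral_congr_ae (Filter.Eventually.of_forall fun t => ?_)) h3
    have h4 : HasFDerivAt (fun t : ℝ => (z, t)) (ContinuousLinearMap.inr ℝ ℂ ℝ) t :=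
      hasFDerivAt_prodMk_right z t
    have h5 := ((hgC.differentiable one_ne_zero (z, t)).hasFDerivAt).comp t h4
    have h6 := h5.hasDerivAt.deriv
    change _ = deriv (g ∘ fun t : ℝ => (z, t)) t
    rw [h6]
    simp
  rw [setIntegral_epigraph_eq u huc]
  have h7 : ∀ p, fderiv ℝ f (graphShear u p) (e, a (graphShear u p).1) =
      fderiv ℝ f (graphShear u p) (e, a p.1) := fun p => rfl
  simp only [h7, key]
  rw [integral_add i1.integrableOn i2.integrableOn]
  have e1 : ∫ p in (univ : Set ℂ) ×ˢ Ioi (0 : ℝ), fderiv ℝ g p (e, 0) = 0 := by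
    rw [Measure.volume_eq_prod, ← setIntegral_prod_swap, setIntegral_prod _
      (show IntegrableOn (fun q : ℝ × ℂ => fderiv ℝ g q.swap (e, 0)) _ _ from
        i1.swap.integrableOn)]
    simp [slice1]
  have e2 : ∫ p in (univ : Set ℂ) ×ˢ Ioi (0 : ℝ),
      (a p.1 - fderiv ℝ u p.1 e) * fderiv ℝ g p (0, 1) =
        ∫ z, (fderiv ℝ u z e - a z) * f (z, u z) := by
    rw [Measure.volume_eq_prod, setIntegral_prod _ i2.integrableOn]
    simp only [integral_const_mul, slice2, Measure.restrict_univ]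
    congr 1
    ext z
    ring
  rw [e1, e2, zero_add]

/-- The (unnormalised) horizontal normal to the graph of `u` at `(z, u z)`, outer for the
epigraph. -/
def graphNormal (u : ℂ → ℝ) (z : ℂ) : ℂ :=
  ⟨fderiv ℝ u z 1 - z.im, fderiv ℝ u z Complex.I + z.re⟩

/-- The horizontal lift of `w` at a point over `z` has vertical component `z.im * w.re - z.re *
w.im`; the pairing compares it with the slope of the graph in the direction `w`. -/
theorem inner_graphNormal (u : ℂ → ℝ) (z w : ℂ) :
    inner ℝ w (graphNormal u z) = fderiv ℝ u z w + (z.re * w.im - z.im * w.re) := by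
  have : w = w.re • (1 : ℂ) + w.im • Complex.I := by
    apply Complex.ext <;> simp
  rw [show fderiv ℝ u z w = w.re * fderiv ℝ u z 1 + w.im * fderiv ℝ u z Complex.I by
    conv_lhs => rw [this]
    simp only [map_add, map_smul, smul_eq_mul]]
  simp [graphNormal, Complex.inner]
  ring

theorem continuous_graphNormal {u : ℂ → ℝ} (hu : ContDiff ℝ 1 u) :
    Continuous (graphNormal u) := by
  have h1 : ∀ e : ℂ, Continuous fun z => fderiv ℝ u z e := fun e =>
    (hu.continuous_fderiv one_ne_zero).clm_apply continuous_const
  have : graphNormal u = fun z => ((fderiv ℝ u z 1 - z.im : ℝ) : ℂ) +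
      ((fderiv ℝ u z Complex.I + z.re : ℝ) : ℂ) * Complex.I := by
    ext z
    apply Complex.ext <;> simp [graphNormal]
  rw [this]
  have := h1 1
  have := h1 Complex.I
  fun_prop

theorem integral_epigraph_horizontalDiv {u : ℂ → ℝ} (hu : ContDiff ℝ 1 u) {W : ℂ × ℝ → ℂ}
    (hW : ContDiff ℝ 1 W) (hc : HasCompactSupport W) :
    ∫ p in {p : ℂ × ℝ | u p.1 < p.2}, horizontalDiv W p =
      ∫ z, inner ℝ (W (z, u z)) (graphNormal u z) := by
  have hre : ContDiff ℝ 1 fun p => (W p).re := Complex.reCLM.contDiff.comp hW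
  have him : ContDiff ℝ 1 fun p => (W p).im := Complex.imCLM.contDiff.comp hW
  have hrc : HasCompactSupport fun p => (W p).re := hc.comp_left (g := Complex.re) rfl
  have hic : HasCompactSupport fun p => (W p).im := hc.comp_left (g := Complex.im) rfl
  have h1 := integral_epigraph_fderiv u hu _ hre hrc 1 (fun z => z.im) (by fun_prop)
  have h2 := integral_epigraph_fderiv u hu _ him hic Complex.I (fun z => -z.re) (by fun_prop)
  have huc := hu.continuous
  have hdu : ∀ e : ℂ, Continuous fun z => fderiv ℝ u z e := fun e =>
    (hu.continuous_fderiv one_ne_zero).clm_apply continuous_const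
  have hint : ∀ (f : ℂ × ℝ → ℝ) (e : ℂ) (a : ℂ → ℝ), ContDiff ℝ 1 f → HasCompactSupport f →
      Continuous a → Integrable fun p : ℂ × ℝ => fderiv ℝ f p (e, a p.1) := by
    intro f e a hf hfc ha
    refine Continuous.integrable_of_hasCompactSupport ?_ ?_
    · exact (hf.continuous_fderiv one_ne_zero).clm_apply (by fun_prop)
    · refine (hfc.fderiv ℝ).mono fun p hp => ?_
      contrapose! hp
      simp only [Function.mem_support, not_not] at hp ⊢
      simp [hp]
  have hint2 : ∀ (f : ℂ × ℝ → ℝ) (e : ℂ) (a : ℂ → ℝ), ContDiff ℝ 1 f → HasCompactSupport f →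
      Continuous a → Integrable fun z : ℂ => (fderiv ℝ u z e - a z) * f (z, u z) := by
    intro f e a hf hfc ha
    have hfC := hf.continuous
    have := hdu e
    refine Continuous.integrable_of_hasCompactSupport (by fun_prop) ?_
    refine HasCompactSupport.mul_left ?_
    refine HasCompactSupport.intro (hfc.isCompact.image continuous_fst) fun z hz => ?_
    by_contra h
    exact hz ⟨(z, u z), subset_tsupport _ h, rfl⟩
  unfold horizontalDiv heisX heisY
  rw [integral_add (hint _ 1 _ hre hrc (by fun_prop : Continuous fun z : ℂ => z.im)).integrableOn
    (hint _ Complex.I _ him hic (by fun_prop : Continuous fun z : ℂ => -z.re)).integrableOn,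
    h1, h2, ← integral_add (hint2 _ _ _ hre hrc (by fun_prop))
      (hint2 _ _ _ him hic (by fun_prop))]
  congr 1
  ext z
  simp [graphNormal, Complex.inner]

/-! ### Mollification of weakly divergence-free fields, and cutoffs. -/

section Mollification

open scoped Convolution
open ContinuousLinearMap (lsmul)

/-- A planar field which is divergence free in the sense of distributions. -/
def IsWeaklyDivFree (U : ℂ → ℂ) : Prop :=
  ∀ ψ : ℂ → ℝ, ContDiff ℝ 1 ψ → HasCompactSupport ψ → ∫ z, fderiv ℝ ψ z (U z) = 0

/-- The value of the mollification is an average of values of `U` for a probability measure, and a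
closed convex set contains such averages. -/
theorem convolution_mem_of_convex {K : Set ℂ} (hK : IsCompact K) (hconv : Convex ℝ K)
    {U : ℂ → ℂ} (hU : Measurable U) (hUK : ∀ z, U z ∈ K) (φ : ContDiffBump (0 : ℂ)) (z : ℂ) :
    (φ.normed volume ⋆[lsmul ℝ ℝ, volume] U) z ∈ K := by
  set f : ℂ → ℝ := φ.normed volume with hf
  have hfc : Continuous f := φ.continuous_normed
  have hf0 : ∀ t, 0 ≤ f t := φ.nonneg_normed
  have hfi : Integrable f := φ.integrable_normed
  set μ : Measure ℂ := volume.withDensity fun t => ENNReal.ofReal (f t) with hμ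
  have hprob : IsProbabilityMeasure μ := by
    constructor
    rw [hμ, withDensity_apply _ MeasurableSet.univ, Measure.restrict_univ,
      ← ofReal_integral_eq_lintegral_ofReal hfi (Filter.Eventually.of_forall hf0),
      hf, φ.integral_normed, ENNReal.ofReal_one]
  have heq : (f ⋆[lsmul ℝ ℝ, volume] U) z = ∫ t, U (z - t) ∂μ := by
    rw [hμ, integral_withDensity_eq_integral_toReal_smul (by fun_prop) (by simp)]
    simp only [convolution_def, ContinuousLinearMap.lsmul_apply]
    congr 1
    ext1 t
    rw [ENNReal.toReal_ofReal (hf0 t)]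
  rw [heq]
  obtain ⟨M, hM⟩ := hK.isBounded.exists_norm_le
  refine hconv.integral_mem hK.isClosed (Filter.Eventually.of_forall fun t => hUK _) ?_
  exact Integrable.of_bound (hU.comp (measurable_const.sub measurable_id)).aestronglyMeasurable M
    (Filter.Eventually.of_forall fun t => hM _ (hUK _))

theorem locallyIntegrable_of_bounded {U : ℂ → ℂ} (hU : Measurable U) {M : ℝ}
    (hM : ∀ z, ‖U z‖ ≤ M) : LocallyIntegrable U := by
  intro z
  refine ⟨Metric.ball z 1, Metric.ball_mem_nhds z one_pos, ?_⟩
  refine Measure.integrableOn_of_bounded (M := M) measure_ball_lt_top.ne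
    hU.aestronglyMeasurable (Filter.Eventually.of_forall hM)

/-- All derivatives fall on the kernel, so the divergence at `z` is, up to sign, the weak equation
tested with `t ↦ f (z - t)`. -/
theorem IsWeaklyDivFree.div_convolution {U : ℂ → ℂ} (hdiv : IsWeaklyDivFree U)
    (hU : LocallyIntegrable U) {f : ℂ → ℝ} (hf : ContDiff ℝ 1 f) (hfc : HasCompactSupport f)
    (z : ℂ) :
    (fderiv ℝ (f ⋆[lsmul ℝ ℝ, volume] U) z 1).re +
      (fderiv ℝ (f ⋆[lsmul ℝ ℝ, volume] U) z Complex.I).im = 0 := by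
  rw [(hfc.hasFDerivAt_convolution_left (lsmul ℝ ℝ : ℝ →L[ℝ] ℂ →L[ℝ] ℂ) hf hU z).fderiv]
  -- The divergence as a continuous functional of the differential, so that it commutes with the
  -- integral.
  set T : (ℂ →L[ℝ] ℂ) →L[ℝ] ℝ :=
    Complex.reCLM.comp (ContinuousLinearMap.apply ℝ ℂ (1 : ℂ)) +
    Complex.imCLM.comp (ContinuousLinearMap.apply ℝ ℂ Complex.I) with hT
  have hT' : ∀ D : ℂ →L[ℝ] ℂ, (D 1).re + (D Complex.I).im = T D := fun D => by simp [hT]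
  rw [hT', convolution_def, ← ContinuousLinearMap.integral_comp_comm]
  · have hψ : ContDiff ℝ 1 fun t => f (z - t) := by fun_prop
    have hψc : HasCompactSupport fun t => f (z - t) :=
      hfc.comp_homeomorph (Homeomorph.subLeft z)
    have h0 := hdiv _ hψ hψc
    have h1 : ∀ t, fderiv ℝ (fun t => f (z - t)) t (U t) = - fderiv ℝ f (z - t) (U t) := by
      intro t
      have h2 : HasFDerivAt (fun t : ℂ => z - t) (-ContinuousLinearMap.id ℝ ℂ) t := by
        simpa using (hasFDerivAt_id t).const_sub z
      have h3 := ((hf.differentiable one_ne_zero (z - t)).hasFDerivAt).comp t h2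
      change fderiv ℝ (f ∘ fun t => z - t) t (U t) = _
      rw [h3.fderiv]
      simp
    simp only [h1, integral_neg, neg_eq_zero] at h0
    rw [← integral_sub_left_eq_self _ volume z]
    rw [← h0]
    congr 1
    ext1 t
    have : U t = (U t).re • (1 : ℂ) + (U t).im • Complex.I := by
      apply Complex.ext <;> simp
    conv_rhs => rw [this]
    rw [map_add, map_smul, map_smul]
    simp [hT, ContinuousLinearMap.precompL_apply, mul_comm]
  · exact (hfc.fderiv ℝ).convolutionExists_left
      (ContinuousLinearMap.precompL ℂ (lsmul ℝ ℝ : ℝ →L[ℝ] ℂ →L[ℝ] ℂ))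
      (hf.continuous_fderiv one_ne_zero) hU z

theorem IsWeaklyDivFree.exists_approx {K : Set ℂ} (hK : IsCompact K) (hconv : Convex ℝ K)
    {U : ℂ → ℂ} (hdiv : IsWeaklyDivFree U) (hU : Measurable U) (hUK : ∀ z, U z ∈ K) :
    ∃ V : ℕ → ℂ → ℂ, (∀ n, ContDiff ℝ 1 (V n)) ∧ (∀ n z, V n z ∈ K) ∧
      (∀ n z, (fderiv ℝ (V n) z 1).re + (fderiv ℝ (V n) z Complex.I).im = 0) ∧
      ∀ᵐ z, Filter.Tendsto (fun n => V n z) Filter.atTop (𝓝 (U z)) := by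
  obtain ⟨M, hM⟩ := hK.isBounded.exists_norm_le
  have hloc := locallyIntegrable_of_bounded hU fun z => hM _ (hUK z)
  -- The ratio of the radii stays equal to `2`: almost everywhere convergence at Lebesgue points
  -- requires it to be bounded.
  let φ : ℕ → ContDiffBump (0 : ℂ) := fun n =>
    { rIn := 1 / ((n : ℝ) + 1)
      rOut := 2 * (1 / ((n : ℝ) + 1))
      rIn_pos := by positivity
      rIn_lt_rOut := by
        have : 0 < 1 / ((n : ℝ) + 1) := by positivity
        linarith }
  have hφ : Filter.Tendsto (fun n => (φ n).rOut) Filter.atTop (𝓝 0) := by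
    have h := (tendsto_one_div_add_atTop_nhds_zero_nat (𝕜 := ℝ)).const_mul 2
    rwa [mul_zero] at h
  refine ⟨fun n => ((φ n).normed volume ⋆[lsmul ℝ ℝ, volume] U), fun n => ?_, fun n z => ?_,
    fun n z => ?_, ?_⟩
  · exact (φ n).hasCompactSupport_normed.contDiff_convolution_left _ (φ n).contDiff_normed hloc
  · exact convolution_mem_of_convex hK hconv hU hUK _ z
  · exact hdiv.div_convolution hloc (φ n).contDiff_normed (φ n).hasCompactSupport_normed z
  · exact ContDiffBump.ae_convolution_tendsto_right_of_locallyIntegrable (K := 2) hφ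
      (Filter.Eventually.of_forall fun n => le_rfl) hloc

/-- In the calibration argument the cutoff must be `1` both on the ball where the competitor set may
differ and on the support `C` of a competing field; a smooth step of the squared Euclidean norm does
both. -/
theorem exists_cutoff {C : Set (ℂ × ℝ)} {r R : ℝ} (hrR : r < R) (hR : 0 < R) (hC : IsCompact C)
    (hCR : C ⊆ euclideanBall R) :
    ∃ φ : ℂ × ℝ → ℝ, ContDiff ℝ 1 φ ∧ HasCompactSupport φ ∧ tsupport φ ⊆ euclideanBall R ∧
      (∀ p, 0 ≤ φ p) ∧ (∀ p, φ p ≤ 1) ∧ (∀ p ∈ C, φ p = 1) ∧ ∀ p ∈ euclideanBall r, φ p = 1 := by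
  set q : ℂ × ℝ → ℝ := fun p => ‖p.1‖ ^ 2 + p.2 ^ 2 with hq
  have hqc : ContDiff ℝ 1 q := by
    exact (contDiff_fst.norm_sq ℝ).add (contDiff_snd.pow 2)
  have hq0 : ∀ p, 0 ≤ q p := fun p => by positivity
  obtain ⟨s, hs0, hrs, hsR, hCs⟩ : ∃ s, 0 ≤ s ∧ r ≤ s ∧ s < R ∧ ∀ p ∈ C, √(q p) ≤ s := by
    rcases C.eq_empty_or_nonempty with rfl | hne
    · exact ⟨max r 0, le_max_right _ _, le_max_left _ _, max_lt hrR hR, by simp⟩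
    · obtain ⟨p, hp, hmax⟩ := hC.exists_isMaxOn hne hqc.continuous.sqrt.continuousOn
      exact ⟨max (max r 0) (√(q p)), by simp, by simp, max_lt (max_lt hrR hR) (hCR hp),
        fun p' hp' => le_max_of_le_right (hmax hp')⟩
  set s' := (s + R) / 2 with hs'
  have h1 : s < s' := by linarith
  have h2 : s' < R := by linarith
  have h3 : 0 < s' ^ 2 - s ^ 2 := by nlinarith
  set φ : ℂ × ℝ → ℝ := fun p => Real.smoothTransition ((s' ^ 2 - q p) / (s' ^ 2 - s ^ 2)) with hφ
  have hone : ∀ p, √(q p) ≤ s → φ p = 1 := by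
    intro p hp
    have : q p ≤ s ^ 2 := by
      rw [← Real.sq_sqrt (hq0 p)]
      exact pow_le_pow_left₀ (Real.sqrt_nonneg _) hp 2
    refine Real.smoothTransition.one_of_one_le ?_
    rw [le_div_iff₀ h3]
    linarith
  have hsub : Function.support φ ⊆ {p | q p ≤ s' ^ 2} := by
    intro p hp
    by_contra h
    refine hp (Real.smoothTransition.zero_of_nonpos ?_)
    simp only [mem_ofPred_eq, not_le] at h
    exact div_nonpos_of_nonpos_of_nonneg (by linarith) h3.le
  have hclosed : IsClosed {p | q p ≤ s' ^ 2} := isClosed_le hqc.continuous continuous_const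
  have htsub : tsupport φ ⊆ {p | q p ≤ s' ^ 2} := closure_minimal hsub hclosed
  have hs'0 : 0 ≤ s' := by linarith
  refine ⟨φ, ?_, ?_, ?_, fun p => Real.smoothTransition.nonneg _,
    fun p => Real.smoothTransition.le_one _, fun p hp => hone p (hCs p hp), fun p hp =>
      hone p (le_of_lt (lt_of_lt_of_le hp hrs))⟩
  · exact Real.smoothTransition.contDiff.comp ((contDiff_const.sub hqc).div_const _)
  · refine IsCompact.of_isClosed_subset (isCompact_closedBall (0 : ℂ × ℝ) s')
      (isClosed_tsupport _) fun p hp => ?_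
    have hp' : ‖p.1‖ ^ 2 + p.2 ^ 2 ≤ s' ^ 2 := htsub hp
    rw [mem_closedBall_zero_iff, Prod.norm_def, max_le_iff]
    constructor
    · exact abs_le_of_sq_le_sq' (by nlinarith [sq_nonneg p.2]) hs'0 |>.2
    · exact abs_le_of_sq_le_sq (by nlinarith [sq_nonneg ‖p.1‖]) hs'0
  · intro p hp
    exact lt_of_le_of_lt (Real.sqrt_le_sqrt (htsub hp)) (by rwa [Real.sqrt_sq hs'0])

end Mollification

/-! ### Horizontal divergence and the calibration criterion. -/

theorem horizontalDiv_comp_fst {V : ℂ → ℂ} (hV : ContDiff ℝ 1 V) (p : ℂ × ℝ) :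
    horizontalDiv (fun p => V p.1) p =
      (fderiv ℝ V p.1 1).re + (fderiv ℝ V p.1 Complex.I).im := by
  have h := (hV.differentiable one_ne_zero p.1).hasFDerivAt.comp p
    (hasFDerivAt_fst (𝕜 := ℝ) (E := ℂ) (F := ℝ))
  have h1 := Complex.reCLM.hasFDerivAt.comp p h
  have h2 := Complex.imCLM.hasFDerivAt.comp p h
  unfold horizontalDiv heisX heisY
  change fderiv ℝ (Complex.reCLM ∘ V ∘ Prod.fst) p _ +
    fderiv ℝ (Complex.imCLM ∘ V ∘ Prod.fst) p _ = _
  rw [h1.fderiv, h2.fderiv]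
  simp

theorem horizontalDiv_congr {V W : ℂ × ℝ → ℂ} {p : ℂ × ℝ} (h : V =ᶠ[𝓝 p] W) :
    horizontalDiv V p = horizontalDiv W p := by
  unfold horizontalDiv
  rw [Filter.EventuallyEq.fderiv_eq (h.mono fun q hq => by simp only [hq] :
      (fun q => (V q).re) =ᶠ[𝓝 p] fun q => (W q).re),
    Filter.EventuallyEq.fderiv_eq (h.mono fun q hq => by simp only [hq] :
      (fun q => (V q).im) =ᶠ[𝓝 p] fun q => (W q).im)]

theorem horizontalDiv_zero (p : ℂ × ℝ) : horizontalDiv (fun _ => 0) p = 0 := by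
  simp [horizontalDiv]

theorem horizontalDiv_neg (U : ℂ × ℝ → ℂ) (p : ℂ × ℝ) :
    horizontalDiv (fun q => -U q) p = -horizontalDiv U p := by
  simp only [horizontalDiv, Complex.neg_re, Complex.neg_im, fderiv_fun_neg,
    neg_apply]
  ring

theorem horizontalDiv_eq_zero_of_notMem_tsupport {U : ℂ × ℝ → ℂ} {p : ℂ × ℝ}
    (hp : p ∉ tsupport U) : horizontalDiv U p = 0 := by
  rw [horizontalDiv_congr (notMem_tsupport_iff_eventuallyEq.1 hp)]
  exact horizontalDiv_zero p

theorem isOpen_euclideanBall (R : ℝ) : IsOpen (euclideanBall R) :=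
  isOpen_lt (by fun_prop) continuous_const

theorem norm_fst_le_of_mem_euclideanBall {R : ℝ} {p : ℂ × ℝ} (hp : p ∈ euclideanBall R) :
    ‖p.1‖ ≤ R := by
  have hp' : √(‖p.1‖ ^ 2 + p.2 ^ 2) < R := hp
  refine le_trans ?_ hp'.le
  exact Real.le_sqrt_of_sq_le (by nlinarith [sq_nonneg p.2])

theorem IsAdmissibleField.mem {K : Set ℂ} (hK : IsClosed K) (hconv : Convex ℝ K)
    (hK0 : (0 : ℂ) ∈ interior K) {Ω : Set (ℂ × ℝ)} {U : ℂ × ℝ → ℂ}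
    (hU : IsAdmissibleField K Ω U) (p : ℂ × ℝ) : U p ∈ K := by
  have := (gauge_le_one_iff_mem_closure hconv (mem_interior_iff_mem_nhds.1 hK0)).1
    (hU.gauge_le p)
  rwa [hK.closure_eq] at this

theorem integral_le_perimeterK {K : Set ℂ} {E Ω : Set (ℂ × ℝ)} {U : ℂ × ℝ → ℂ}
    (hU : IsAdmissibleField K Ω U) :
    ENNReal.ofReal (∫ p in E, horizontalDiv U p) ≤ perimeterK K E Ω :=
  le_iSup₂ (f := fun (U : ℂ × ℝ → ℂ) (_ : IsAdmissibleField K Ω U) =>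
    ENNReal.ofReal (∫ p in E, horizontalDiv U p)) U hU

theorem measurableSet_epigraph {u : ℂ → ℝ} (hu : Continuous u) :
    MeasurableSet {p : ℂ × ℝ | u p.1 < p.2} :=
  (isOpen_lt (hu.comp continuous_fst) continuous_snd).measurableSet

/-- By Gauss–Green each admissible field contributes a flux through the part of the graph over a
disc, bounded because `K` and the normal are bounded there. -/
theorem perimeterK_epigraph_lt_top {K : Set ℂ} (hK : IsCompact K) (hconv : Convex ℝ K)
    (hK0 : (0 : ℂ) ∈ interior K) {u : ℂ → ℝ} (hu : ContDiff ℝ 1 u) (R : ℝ) :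
    perimeterK K {p : ℂ × ℝ | u p.1 < p.2} (euclideanBall R) < ⊤ := by
  obtain ⟨M, hM⟩ := hK.isBounded.exists_norm_le
  have hM0 : 0 ≤ M := (norm_nonneg _).trans (hM 0 (interior_subset hK0))
  refine lt_of_le_of_lt (b := ENNReal.ofReal
    (∫ z in Metric.closedBall (0 : ℂ) R, M * ‖graphNormal u z‖)) ?_ ENNReal.ofReal_lt_top
  refine iSup₂_le fun V hV => ENNReal.ofReal_le_ofReal ?_
  rw [integral_epigraph_horizontalDiv hu hV.contDiff hV.hasCompactSupport]
  have hN := continuous_graphNormal hu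
  have hVc := hV.contDiff.continuous
  have huc := hu.continuous
  have hzero : ∀ z, z ∉ Metric.closedBall (0 : ℂ) R →
      (inner ℝ (V (z, u z)) (graphNormal u z) : ℝ) = 0 := by
    intro z hz
    have : V (z, u z) = 0 := by
      by_contra h
      refine hz ?_
      rw [mem_closedBall_zero_iff]
      exact norm_fst_le_of_mem_euclideanBall (hV.tsupport_subset (subset_tsupport _ h))
    rw [this, inner_zero_left]
  rw [← setIntegral_eq_integral_of_forall_compl_eq_zero hzero]
  refine setIntegral_mono_on ?_ ?_ measurableSet_closedBall fun z _ => ?_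
  · exact Continuous.continuousOn (by fun_prop) |>.integrableOn_compact (isCompact_closedBall _ _)
  · exact Continuous.continuousOn (by fun_prop) |>.integrableOn_compact (isCompact_closedBall _ _)
  · refine (real_inner_le_norm _ _).trans ?_
    gcongr
    exact hM _ (hV.mem hK.isClosed hconv hK0 _)

/-- Calibration criterion for the epigraph of a `C^1` function. -/
theorem isPerimeterMinimizing_epigraph {K : Set ℂ} (hK : IsCompact K) (hconv : Convex ℝ K)
    (hK0 : (0 : ℂ) ∈ interior K) {u : ℂ → ℝ} (hu : ContDiff ℝ 1 u) {U : ℂ → ℂ}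
    (hdiv : IsWeaklyDivFree U) (hU : Measurable U) (hUK : ∀ z, U z ∈ K)
    (hcal : ∀ᵐ z, ∀ w ∈ K, inner ℝ w (graphNormal u z) ≤ (inner ℝ (U z) (graphNormal u z) : ℝ)) :
    IsPerimeterMinimizing K {p : ℂ × ℝ | u p.1 < p.2} := by
  refine ⟨measurableSet_epigraph hu.continuous,
    perimeterK_epigraph_lt_top hK hconv hK0 hu, fun F hF r R hrR hFE => ?_⟩
  set E := {p : ℂ × ℝ | u p.1 < p.2} with hE
  refine iSup₂_le fun W hW => ?_
  -- For `R ≤ 0` the ball is empty and only the zero field is admissible.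
  rcases le_or_gt R 0 with hR | hR
  · have : ∀ p, horizontalDiv W p = 0 := fun p => by
      refine horizontalDiv_eq_zero_of_notMem_tsupport fun hp => ?_
      have h1 : √(‖p.1‖ ^ 2 + p.2 ^ 2) < R := hW.tsupport_subset hp
      linarith [Real.sqrt_nonneg (‖p.1‖ ^ 2 + p.2 ^ 2)]
    simp [this]
  obtain ⟨φ, hφ, hφc, hφs, hφ0, hφ1, hφW, hφr⟩ :=
    exists_cutoff hrR hR hW.hasCompactSupport.isCompact hW.tsupport_subset
  obtain ⟨V, hV, hVK, hVdiv, hVlim⟩ := hdiv.exists_approx hK hconv hU hUK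
  obtain ⟨M, hM⟩ := hK.isBounded.exists_norm_le
  have hN := continuous_graphNormal hu
  have huc := hu.continuous
  have hφC := hφ.continuous
  have hadm : ∀ n, IsAdmissibleField K (euclideanBall R) fun p => φ p • V n p.1 := by
    intro n
    refine ⟨hφ.smul ((hV n).comp contDiff_fst), hφc.smul_right,
      (closure_mono (Function.support_smul_subset_left _ _)).trans hφs, fun p => ?_⟩
    exact gauge_le_one_of_mem
      (hconv.smul_mem_of_zero_mem (interior_subset hK0) (hVK n p.1) ⟨hφ0 p, hφ1 p⟩)
  -- The sets can differ only in the smaller ball, where `φ = 1` and the field reduces to the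
  -- divergence-free `V n`.
  have hFEn : ∀ n, ∫ p in F, horizontalDiv (fun p => φ p • V n p.1) p =
      ∫ p in E, horizontalDiv (fun p => φ p • V n p.1) p := by
    intro n
    rw [← integral_indicator hF, ← integral_indicator (measurableSet_epigraph huc)]
    congr 1
    ext p
    by_cases hp : p ∈ euclideanBall r
    · have h1 : (fun p => φ p • V n p.1) =ᶠ[𝓝 p] fun p => V n p.1 := by
        filter_upwards [(isOpen_euclideanBall r).mem_nhds hp] with q hq
        rw [hφr q hq, one_smul]
      have h2 : horizontalDiv (fun p => φ p • V n p.1) p = 0 := by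
        rw [horizontalDiv_congr h1, horizontalDiv_comp_fst (hV n), hVdiv]
      simp only [indicator, h2, ite_self]
    · simp only [indicator]
      congr 1
      exact propext (hFE p hp)
  have hle : ∀ n, ENNReal.ofReal (∫ z, inner ℝ (φ (z, u z) • V n z) (graphNormal u z)) ≤
      perimeterK K F (euclideanBall R) := by
    intro n
    have h1 := integral_le_perimeterK (E := F) (hadm n)
    rwa [hFEn, integral_epigraph_horizontalDiv hu (hadm n).contDiff
      (hadm n).hasCompactSupport] at h1
  have hbcs : HasCompactSupport fun z : ℂ => φ (z, u z) :=
    HasCompactSupport.intro (hφc.isCompact.image continuous_fst) fun z hz => by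
      by_contra h
      exact hz ⟨(z, u z), subset_tsupport _ h, rfl⟩
  have hbi : Integrable fun z : ℂ => φ (z, u z) * (M * ‖graphNormal u z‖) :=
    Continuous.integrable_of_hasCompactSupport (by fun_prop) hbcs.mul_right
  have hbound : ∀ w ∈ K, ∀ z, ‖(inner ℝ (φ (z, u z) • w) (graphNormal u z) : ℝ)‖ ≤
      φ (z, u z) * (M * ‖graphNormal u z‖) := by
    intro w hw z
    refine (norm_inner_le_norm _ _).trans ?_
    rw [norm_smul, Real.norm_of_nonneg (hφ0 _), mul_assoc]
    have := hM w hw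
    have := hφ0 (z, u z)
    gcongr
  have hmeas : Measurable fun z => (inner ℝ (φ (z, u z) • U z) (graphNormal u z) : ℝ) := by
    have h1 : Measurable fun z : ℂ => φ (z, u z) :=
      (hφC.comp (continuous_id.prodMk huc)).measurable
    exact (h1.smul hU).inner hN.measurable
  have hlim : Filter.Tendsto
      (fun n => ∫ z, (inner ℝ (φ (z, u z) • V n z) (graphNormal u z) : ℝ)) Filter.atTop
      (𝓝 (∫ z, inner ℝ (φ (z, u z) • U z) (graphNormal u z))) := by
    refine tendsto_integral_of_dominated_convergence _ (fun n => ?_) hbi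
      (fun n => Filter.Eventually.of_forall fun z => hbound _ (hVK n z) z) ?_
    · have := (hV n).continuous
      exact Continuous.aestronglyMeasurable (by fun_prop)
    · filter_upwards [hVlim] with z hz
      exact (hz.const_smul _).inner tendsto_const_nhds
  -- The flux of the cut-off calibration through the graph bounds the perimeter of `F` from below;
  -- it remains to see that it dominates the flux of `W`.
  have hL := le_of_tendsto' ((ENNReal.continuous_ofReal.tendsto _).comp hlim) hle
  refine (ENNReal.ofReal_le_ofReal ?_).trans hL
  rw [integral_epigraph_horizontalDiv hu hW.contDiff hW.hasCompactSupport]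
  have hWC := hW.contDiff.continuous
  refine integral_mono_ae ?_ (hbi.mono' hmeas.aestronglyMeasurable
    (Filter.Eventually.of_forall fun z => hbound _ (hUK z) z)) ?_
  · refine Continuous.integrable_of_hasCompactSupport (by fun_prop) ?_
    refine HasCompactSupport.intro
      (hW.hasCompactSupport.isCompact.image continuous_fst) fun z hz => ?_
    have : W (z, u z) = 0 := by
      by_contra h
      exact hz ⟨(z, u z), subset_tsupport _ h, rfl⟩
    rw [this, inner_zero_left]
  · filter_upwards [hcal] with z hz
    by_cases h : (z, u z) ∈ tsupport W
    · simp only [hφW _ h, one_smul]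
      exact hz _ (hW.mem hK.isClosed hconv hK0 _)
    -- Off the support of `W` it suffices that the calibration has nonnegative flux density: compare
    -- it with `0 ∈ K`.
    · rw [image_eq_zero_of_notMem_tsupport h, inner_zero_left, inner_smul_left]
      refine mul_nonneg (hφ0 _) ?_
      simpa using hz 0 (interior_subset hK0)

/-! ### Complements and hypographs for symmetric `K`. -/

theorem perimeterK_congr_ae {K : Set ℂ} {E E' Ω : Set (ℂ × ℝ)} (h : E =ᵐ[volume] E') :
    perimeterK K E Ω = perimeterK K E' Ω := by
  unfold perimeterK
  simp only [setIntegral_congr_set h]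

theorem continuous_horizontalDiv {V : ℂ × ℝ → ℂ} (hV : ContDiff ℝ 1 V) :
    Continuous (horizontalDiv V) := by
  have hre : ContDiff ℝ 1 fun p => (V p).re := Complex.reCLM.contDiff.comp hV
  have him : ContDiff ℝ 1 fun p => (V p).im := Complex.imCLM.contDiff.comp hV
  unfold horizontalDiv heisX heisY
  refine Continuous.add ?_ ?_
  · exact (hre.continuous_fderiv one_ne_zero).clm_apply (by fun_prop)
  · exact (him.continuous_fderiv one_ne_zero).clm_apply (by fun_prop)

theorem integrable_horizontalDiv {V : ℂ × ℝ → ℂ} (hV : ContDiff ℝ 1 V)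
    (hc : HasCompactSupport V) : Integrable (horizontalDiv V) :=
  (continuous_horizontalDiv hV).integrable_of_hasCompactSupport <|
    HasCompactSupport.intro hc.isCompact fun _ => horizontalDiv_eq_zero_of_notMem_tsupport

/-- Apply Gauss–Green above a constant graph lying below the support of `V`. -/
theorem integral_horizontalDiv {V : ℂ × ℝ → ℂ} (hV : ContDiff ℝ 1 V)
    (hc : HasCompactSupport V) : ∫ p, horizontalDiv V p = 0 := by
  obtain ⟨M, hM⟩ := hc.isCompact.isBounded.exists_norm_le
  have hout : ∀ z t, t ≤ -(|M| + 1) → (z, t) ∉ tsupport V := by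
    intro z t ht hp
    have h1 := hM _ hp
    have h2 : ‖t‖ ≤ M := (norm_snd_le (z, t)).trans h1
    rw [Real.norm_eq_abs] at h2
    linarith [neg_abs_le t, le_abs_self M]
  have h := integral_epigraph_horizontalDiv (u := fun _ => -(|M| + 1)) contDiff_const hV hc
  rw [setIntegral_eq_integral_of_forall_compl_eq_zero] at h
  · rw [h]
    simp only [image_eq_zero_of_notMem_tsupport (hout _ _ le_rfl), inner_zero_left, integral_zero]
  · rintro ⟨z, t⟩ hp
    exact horizontalDiv_eq_zero_of_notMem_tsupport (hout z t (by simpa using hp))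

/-- The total integral of the divergence vanishes, so `V` on the complement equals `-V` on `E`, and
`-V` is admissible by symmetry. -/
theorem perimeterK_compl_le {K : Set ℂ} (hsymm : ∀ x ∈ K, -x ∈ K) (hK : IsClosed K)
    (hconv : Convex ℝ K) (hK0 : (0 : ℂ) ∈ interior K) {E Ω : Set (ℂ × ℝ)}
    (hE : MeasurableSet E) : perimeterK K Eᶜ Ω ≤ perimeterK K E Ω := by
  refine iSup₂_le fun V hV => ?_
  have h1 : ∫ p in Eᶜ, horizontalDiv V p = ∫ p in E, horizontalDiv (fun q => -V q) p := by
    have h2 := integral_add_compl hE (integrable_horizontalDiv hV.contDiff hV.hasCompactSupport)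
    rw [integral_horizontalDiv hV.contDiff hV.hasCompactSupport] at h2
    simp only [horizontalDiv_neg, integral_neg]
    linarith
  rw [h1]
  refine integral_le_perimeterK ⟨hV.contDiff.neg, hV.hasCompactSupport.neg, ?_, fun p =>
    gauge_le_one_of_mem (hsymm _ (hV.mem hK hconv hK0 p))⟩
  have : tsupport (fun q => -V q) = tsupport V := by
    unfold tsupport
    congr 1
    ext p
    simp
  rw [this]
  exact hV.tsupport_subset

theorem volume_graph {u : ℂ → ℝ} (hu : Continuous u) :
    volume {p : ℂ × ℝ | p.2 = u p.1} = 0 := by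
  rw [Measure.volume_eq_prod, Measure.measure_prod_null]
  · refine Filter.Eventually.of_forall fun z => ?_
    have : Prod.mk z ⁻¹' {p : ℂ × ℝ | p.2 = u p.1} = {u z} := by
      ext t
      simp
    change volume (Prod.mk z ⁻¹' {p : ℂ × ℝ | p.2 = u p.1}) = 0
    rw [this]
    simp
  · exact (isClosed_eq continuous_snd (hu.comp continuous_fst)).measurableSet

theorem IsPerimeterMinimizing.hypograph {K : Set ℂ} (hsymm : ∀ x ∈ K, -x ∈ K) (hK : IsClosed K)
    (hconv : Convex ℝ K) (hK0 : (0 : ℂ) ∈ interior K) {u : ℂ → ℝ} (hu : Continuous u)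
    (h : IsPerimeterMinimizing K {p : ℂ × ℝ | u p.1 < p.2}) :
    IsPerimeterMinimizing K {p : ℂ × ℝ | p.2 < u p.1} := by
  set E := {p : ℂ × ℝ | u p.1 < p.2} with hE
  have hG : MeasurableSet {p : ℂ × ℝ | p.2 = u p.1} :=
    (isClosed_eq continuous_snd (hu.comp continuous_fst)).measurableSet
  have hae : ∀ᵐ p : ℂ × ℝ, p.2 ≠ u p.1 := by
    rw [ae_iff]
    simpa using volume_graph hu
  have hEc : ({p : ℂ × ℝ | p.2 < u p.1} : Set (ℂ × ℝ)) =ᵐ[volume] Eᶜ := by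
    filter_upwards [hae] with p hp
    refine propext (show p.2 < u p.1 ↔ ¬ u p.1 < p.2 from ?_)
    rw [not_lt]
    exact ⟨le_of_lt, fun h => lt_of_le_of_ne h hp⟩
  have hP : ∀ R, perimeterK K {p : ℂ × ℝ | p.2 < u p.1} (euclideanBall R) ≤
      perimeterK K E (euclideanBall R) := fun R => by
    rw [perimeterK_congr_ae hEc]
    exact perimeterK_compl_le hsymm hK hconv hK0 h.measurableSet
  refine ⟨(isOpen_lt continuous_snd (hu.comp continuous_fst)).measurableSet,
    fun R => (hP R).trans_lt (h.locallyFinite R), fun F hF r R hrR hFE => ?_⟩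
  refine (hP R).trans ?_
  -- The null graph is removed so that `F'` coincides exactly with the open epigraph outside the
  -- ball, as the definition of minimality requires.
  set F' := Fᶜ \ {p : ℂ × ℝ | p.2 = u p.1} with hF'
  have hmin := h.minimal F' (hF.compl.diff hG) r R hrR fun p hp => by
    have h1 := hFE p hp
    simp only [hF', hE, mem_sdiff, mem_compl_iff, mem_ofPred_eq] at h1 ⊢
    rw [h1, not_lt]
    exact ⟨fun h => lt_of_le_of_ne h.1 (Ne.symm h.2), fun h => ⟨h.le, h.ne'⟩⟩
  refine hmin.trans ?_
  have hae' : F' =ᵐ[volume] Fᶜ := by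
    filter_upwards [hae] with p hp
    refine propext (show p ∈ F' ↔ p ∈ Fᶜ from ?_)
    simp [hF', hp]
  rw [perimeterK_congr_ae hae']
  exact perimeterK_compl_le hsymm hK hconv hK0 hF

/-! ### Existence, uniqueness and continuity of the inverse Gauss map. -/

theorem mem_frontier_of_isMax {K : Set ℂ} {w p : ℂ} (hw : w ≠ 0) (hp : p ∈ K)
    (hmax : ∀ q ∈ K, (inner ℝ w q : ℝ) ≤ inner ℝ w p) : p ∈ frontier K := by
  refine ⟨subset_closure hp, fun hint => ?_⟩
  have h1 : Filter.Tendsto (fun s : ℝ => p + s • w) (𝓝[>] 0) (𝓝 p) := by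
    have h2 : Continuous fun s : ℝ => p + s • w := by fun_prop
    have h3 := h2.tendsto 0
    rw [zero_smul, add_zero] at h3
    exact h3.mono_left nhdsWithin_le_nhds
  obtain ⟨s, hs, hs0⟩ := ((h1.eventually (mem_interior_iff_mem_nhds.1 hint)).and
    self_mem_nhdsWithin).exists
  have h4 := hmax _ hs
  rw [inner_add_right, inner_smul_right, real_inner_self_eq_norm_sq] at h4
  have h5 : 0 < s * ‖w‖ ^ 2 := mul_pos hs0 (by positivity)
  linarith

theorem exists_isOuterNormalAt {K : Set ℂ} (hK : IsCompact K) (hne : K.Nonempty) {w : ℂ}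
    (hw : w ≠ 0) : ∃ p, IsOuterNormalAt K w p := by
  obtain ⟨p, hp, hmax⟩ := hK.exists_isMaxOn hne
    (f := fun q => (inner ℝ w q : ℝ)) (by fun_prop)
  exact ⟨p, mem_frontier_of_isMax hw hp hmax, hmax⟩

theorem definingFunction_eq_zero {K : Set ℂ} (hK : IsClosed K) {p : ℂ} (hp : p ∈ frontier K)
    {ρ : ℂ → ℝ} (hρ : ContinuousAt ρ p) (hiff : ∀ᶠ z in 𝓝 p, z ∈ K ↔ ρ z ≤ 0) : ρ p = 0 := by
  have h1 : ρ p ≤ 0 := hiff.self_of_nhds.1 (hK.frontier_subset hp)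
  refine le_antisymm h1 (not_lt.1 fun h => hp.2 ?_)
  rw [mem_interior_iff_mem_nhds]
  filter_upwards [hiff, hρ.eventually (gt_mem_nhds h)] with z hz hz'
  exact hz.2 (le_of_lt hz')

/-- A direction along which `ρ` decreases enters `K`, where the functional `inner w` cannot exceed
its value at `p`. -/
theorem IsOuterNormalAt.inner_nonpos {K : Set ℂ} {w p d : ℂ} (hp : IsOuterNormalAt K w p)
    {ρ : ℂ → ℝ} (hρ : DifferentiableAt ℝ ρ p) (hiff : ∀ᶠ z in 𝓝 p, z ∈ K ↔ ρ z ≤ 0)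
    (h0 : ρ p = 0) (hd : fderiv ℝ ρ p d < 0) : (inner ℝ w d : ℝ) ≤ 0 := by
  have hl : HasDerivAt (fun s : ℝ => p + s • d) d 0 := by
    simpa using ((hasDerivAt_id (0 : ℝ)).smul_const d).const_add p
  have hc : HasDerivAt (fun s : ℝ => ρ (p + s • d)) (fderiv ℝ ρ p d) 0 := by
    have h1 : HasFDerivAt ρ (fderiv ℝ ρ p) (p + (0 : ℝ) • d) := by
      simpa using hρ.hasFDerivAt
    exact h1.comp_hasDerivAt 0 hl
  have hneg : ∀ᶠ s in 𝓝[>] (0 : ℝ), ρ (p + s • d) < 0 := by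
    have h2 := hc.tendsto_slope.eventually (gt_mem_nhds hd)
    have h3 : ∀ᶠ s in 𝓝[>] (0 : ℝ), slope (fun s : ℝ => ρ (p + s • d)) 0 s < 0 :=
      h2.filter_mono (nhdsWithin_mono _ fun s hs => ne_of_gt hs)
    filter_upwards [h3, self_mem_nhdsWithin] with s hs hs0
    rw [slope_def_field, zero_smul, add_zero, h0, sub_zero, sub_zero] at hs
    exact (div_neg_iff.1 hs).elim (fun h => absurd h.2 (not_lt.2 (le_of_lt hs0))) fun h => h.1
  have ht : Filter.Tendsto (fun s : ℝ => p + s • d) (𝓝[>] 0) (𝓝 p) := by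
    have h3 := hl.continuousAt.tendsto
    rw [zero_smul, add_zero] at h3
    exact h3.mono_left nhdsWithin_le_nhds
  obtain ⟨s, ⟨hs1, hs2⟩, hs0⟩ :=
    ((hneg.and (ht.eventually hiff)).and self_mem_nhdsWithin).exists
  have h4 := hp.2 _ (hs2.2 hs1.le)
  rw [inner_add_right, inner_smul_right] at h4
  have hs0' : (0 : ℝ) < s := hs0
  by_contra h
  push Not at h
  nlinarith [mul_pos hs0' h]

/-- If `dρ` were negative on some `σ` orthogonal to `w`, a small tilt of `σ` towards `w` would still
enter `K` while increasing `inner w`. -/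
theorem IsOuterNormalAt.fderiv_eq_zero {K : Set ℂ} {w p : ℂ} (hw : w ≠ 0)
    (hp : IsOuterNormalAt K w p) {ρ : ℂ → ℝ} (hρ : DifferentiableAt ℝ ρ p)
    (hiff : ∀ᶠ z in 𝓝 p, z ∈ K ↔ ρ z ≤ 0) (h0 : ρ p = 0) {τ : ℂ} (hτ : (inner ℝ w τ : ℝ) = 0) :
    fderiv ℝ ρ p τ = 0 := by
  have key : ∀ σ : ℂ, (inner ℝ w σ : ℝ) = 0 → 0 ≤ fderiv ℝ ρ p σ := by
    intro σ hσ
    by_contra hneg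
    push Not at hneg
    set D := fderiv ℝ ρ p
    -- Chosen so that the tilt costs at most half of `-D σ`; the `+ 1` covers `D w = 0`.
    set ε := -D σ / (2 * (|D w| + 1)) with hε
    have h1 : 0 < |D w| + 1 := by positivity
    have hε0 : 0 < ε := div_pos (by linarith) (by linarith)
    have h2 : ε * (|D w| + 1) = -D σ / 2 := by
      rw [hε]
      field_simp
    have h3 : D (σ + ε • w) < 0 := by
      rw [map_add, map_smul, smul_eq_mul]
      nlinarith [le_abs_self (D w)]
    have h4 := hp.inner_nonpos hρ hiff h0 h3
    rw [inner_add_right, inner_smul_right, hσ, real_inner_self_eq_norm_sq] at h4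
    have : 0 < ε * ‖w‖ ^ 2 := by positivity
    linarith
  have h1 := key τ hτ
  have h2 := key (-τ) (by rw [inner_neg_right, hτ, neg_zero])
  rw [map_neg] at h2
  linarith

/-- Two points with the same normal would be joined by a segment of boundary points with that
normal. Then `dρ(d)` vanishes along the segment, hence `D²ρ(d, d) = 0`, against positive curvature.
-/
theorem IsOuterNormalAt.unique {K : Set ℂ} (hK : IsConvexBodyCPlus 2 K) {w p q : ℂ} (hw : w ≠ 0)
    (hp : IsOuterNormalAt K w p) (hq : IsOuterNormalAt K w q) : p = q := by
  by_contra hne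
  have hcl := hK.isCompact.isClosed
  have hpK := hcl.frontier_subset hp.1
  have hqK := hcl.frontier_subset hq.1
  set d := q - p with hd
  have hd0 : d ≠ 0 := sub_ne_zero.2 (Ne.symm hne)
  have hwd : (inner ℝ w d : ℝ) = 0 := by
    rw [hd, inner_sub_right]
    linarith [hp.2 q hqK, hq.2 p hpK]
  obtain ⟨ρ, hρ, hiff, -, hpos⟩ := hK.boundary p hp.1
  have hseg : ∀ s : ℝ, 0 ≤ s → s ≤ 1 → IsOuterNormalAt K w (p + s • d) := by
    intro s hs0 hs1
    have h1 : p + s • d ∈ K := by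
      have := hK.convex.add_smul_sub_mem hpK hqK ⟨hs0, hs1⟩
      exact this
    have h2 : ∀ r ∈ K, (inner ℝ w r : ℝ) ≤ inner ℝ w (p + s • d) := by
      intro r hr
      rw [inner_add_right, inner_smul_right, hwd, mul_zero, add_zero]
      exact hp.2 r hr
    exact ⟨mem_frontier_of_isMax hw h1 h2, h2⟩
  have hdiff : ∀ᶠ z in 𝓝 p, DifferentiableAt ℝ ρ z :=
    (hρ.eventually (by simp)).mono fun z hz => hz.differentiableAt (by simp)
  have hev : ∀ᶠ z in 𝓝 p, IsOuterNormalAt K w z → fderiv ℝ ρ z d = 0 := by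
    filter_upwards [hdiff, eventually_eventually_nhds.2 hiff] with z hz hz' hzn
    exact hzn.fderiv_eq_zero hw hz hz'
      (definingFunction_eq_zero hcl hzn.1 hz.continuousAt hz') hwd
  have hp0 : fderiv ℝ ρ p d = 0 := hev.self_of_nhds hp
  have hl : HasDerivAt (fun s : ℝ => p + s • d) d 0 := by
    simpa using ((hasDerivAt_id (0 : ℝ)).smul_const d).const_add p
  have h1 : HasFDerivAt (fderiv ℝ ρ) (fderiv ℝ (fderiv ℝ ρ) p) (p + (0 : ℝ) • d) := by
    have : ContDiffAt ℝ 1 (fderiv ℝ ρ) p := hρ.fderiv_right (by norm_num)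
    simpa using (this.differentiableAt one_ne_zero).hasFDerivAt
  have h2 : HasDerivAt (fun s : ℝ => fderiv ℝ ρ (p + s • d) d)
      (fderiv ℝ (fderiv ℝ ρ) p d d) 0 := by
    exact (ContinuousLinearMap.apply ℝ ℝ d).hasFDerivAt.comp_hasDerivAt 0
      (h1.comp_hasDerivAt 0 hl)
  have ht : Filter.Tendsto (fun s : ℝ => p + s • d) (𝓝[>] 0) (𝓝 p) := by
    have h3 := hl.continuousAt.tendsto
    rw [zero_smul, add_zero] at h3
    exact h3.mono_left nhdsWithin_le_nhds
  have h3 : (fun s : ℝ => fderiv ℝ ρ (p + s • d) d) =ᶠ[𝓝[>] 0] fun _ => (0 : ℝ) := by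
    filter_upwards [ht.eventually hev, Ioc_mem_nhdsGT one_pos] with s hs hs1
    exact hs (hseg s hs1.1.le hs1.2)
  -- The segment starts at `p`, so only the right derivative is known to vanish; it still determines
  -- the derivative.
  have h4 : HasDerivWithinAt (fun s : ℝ => fderiv ℝ ρ (p + s • d) d) 0 (Ioi 0) 0 :=
    (hasDerivWithinAt_const (0 : ℝ) (Ioi 0) (0 : ℝ)).congr_of_eventuallyEq h3
      (by simpa using hp0)
  have h5 := (uniqueDiffWithinAt_Ioi (0 : ℝ)).eq_deriv _ h2.hasDerivWithinAt h4
  exact (hpos d hd0 hp0).ne' h5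

theorem IsConvexBodyCPlus.mono {K : Set ℂ} {m n : ℕ} (hmn : m ≤ n) (hK : IsConvexBodyCPlus n K) :
    IsConvexBodyCPlus m K :=
  ⟨hK.isCompact, hK.convex, hK.interior_nonempty, fun p hp => by
    obtain ⟨ρ, h1, h2⟩ := hK.boundary p hp
    exact ⟨ρ, h1.of_le (by exact_mod_cast hmn), h2⟩⟩

theorem isOuterNormalAt_gaussInv {K : Set ℂ} (hK : IsCompact K) (hne : K.Nonempty) {w : ℂ}
    (hw : w ≠ 0) : IsOuterNormalAt K w (gaussInv K w) :=
  Classical.epsilon_spec (exists_isOuterNormalAt hK hne hw)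

theorem gaussInv_mem {K : Set ℂ} (hK : IsCompact K) (hne : K.Nonempty) {w : ℂ}
    (hw : w ≠ 0) : gaussInv K w ∈ K :=
  hK.isClosed.frontier_subset (isOuterNormalAt_gaussInv hK hne hw).1

/-- Cluster points of maximisers are maximisers for the limit functional; compactness of `K` and
uniqueness of the maximiser give convergence. -/
theorem continuous_gaussInv_comp {K : Set ℂ} (hK : IsConvexBodyCPlus 2 K) {w : ℝ → ℂ}
    (hw : Continuous w) (hw0 : ∀ θ, w θ ≠ 0) : Continuous fun θ => gaussInv K (w θ) := by
  have hne := hK.interior_nonempty.mono interior_subset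
  have hn := fun θ => isOuterNormalAt_gaussInv hK.isCompact hne (hw0 θ)
  rw [continuous_iff_continuousAt]
  intro θ
  refine hK.isCompact.tendsto_nhds_of_unique_mapClusterPt
    (Filter.Eventually.of_forall fun t => gaussInv_mem hK.isCompact hne (hw0 t)) ?_
  intro y hy hcl
  obtain ⟨U, hU, hUy⟩ := mapClusterPt_iff_ultrafilter.1 hcl
  have hmax : ∀ q ∈ K, (inner ℝ (w θ) q : ℝ) ≤ inner ℝ (w θ) y := by
    intro q hq
    have hwU : Filter.Tendsto w U (𝓝 (w θ)) := (hw.tendsto θ).mono_left hU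
    exact le_of_tendsto_of_tendsto' (hwU.inner tendsto_const_nhds) (hwU.inner hUy)
      fun t => (hn t).2 q hq
  exact IsOuterNormalAt.unique hK (hw0 θ) ⟨mem_frontier_of_isMax (hw0 θ) hy hmax, hmax⟩ (hn θ)

/-! ### Regularity and derivative of the Gauss curve. -/

/-- The vector `v e^{iθ}`. -/
def rotVec (v : ℂ) (θ : ℝ) : ℂ := v * Complex.exp (θ * Complex.I)

/-- The boundary point of `K` with outer normal `J (v e^{iθ})`. -/
def gaussCurve (K : Set ℂ) (v : ℂ) (θ : ℝ) : ℂ := gaussInv K (Complex.I * rotVec v θ)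

theorem rotVec_ne_zero {v : ℂ} (hv : v ≠ 0) (θ : ℝ) : rotVec v θ ≠ 0 :=
  mul_ne_zero hv (Complex.exp_ne_zero _)

theorem I_mul_rotVec_ne_zero {v : ℂ} (hv : v ≠ 0) (θ : ℝ) : Complex.I * rotVec v θ ≠ 0 :=
  mul_ne_zero Complex.I_ne_zero (rotVec_ne_zero hv θ)

theorem contDiff_rotVec (v : ℂ) {n : WithTop ℕ∞} : ContDiff ℝ n (rotVec v) := by
  unfold rotVec
  exact contDiff_const.mul ((Complex.ofRealCLM.contDiff.mul contDiff_const).cexp)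

theorem hasDerivAt_rotVec (v : ℂ) (θ : ℝ) :
    HasDerivAt (rotVec v) (Complex.I * rotVec v θ) θ := by
  have h := (((Complex.ofRealCLM.hasDerivAt (x := θ)).mul_const Complex.I).cexp).const_mul v
  have h1 : v * (Complex.exp ((θ : ℂ) * Complex.I) * (Complex.ofRealCLM 1 * Complex.I)) =
      Complex.I * rotVec v θ := by
    rw [rotVec, Complex.ofRealCLM_apply, Complex.ofReal_one]
    ring
  rw [← h1]
  exact h

theorem inner_I_mul_self (τ : ℂ) : (inner ℝ (Complex.I * τ) τ : ℝ) = 0 := by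
  simp [Complex.inner]
  ring

theorem eq_smul_add_smul_I_mul {τ : ℂ} (hτ : τ ≠ 0) (q : ℂ) :
    q = (q / τ).re • τ + (q / τ).im • (Complex.I * τ) := by
  rw [Complex.real_smul, Complex.real_smul, ← mul_assoc, ← add_mul, Complex.re_add_im,
    div_mul_cancel₀ q hτ]

theorem continuous_gaussCurve {K : Set ℂ} (hK : IsConvexBodyCPlus 2 K) {v : ℂ} (hv : v ≠ 0) :
    Continuous (gaussCurve K v) :=
  continuous_gaussInv_comp hK
    (continuous_const.mul (contDiff_rotVec v (n := 0)).continuous) (I_mul_rotVec_ne_zero hv)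

theorem isOuterNormalAt_gaussCurve {K : Set ℂ} {ℓ : ℕ} (hK : IsConvexBodyCPlus ℓ K) {v : ℂ}
    (hv : v ≠ 0) (θ : ℝ) : IsOuterNormalAt K (Complex.I * rotVec v θ) (gaussCurve K v θ) :=
  isOuterNormalAt_gaussInv hK.isCompact (hK.interior_nonempty.mono interior_subset)
    (I_mul_rotVec_ne_zero hv θ)

/-- Local description of the Gauss curve by a defining function of the boundary. -/
theorem exists_definingFunction_gaussCurve {K : Set ℂ} {m : ℕ} (hm : 1 ≤ m)
    (hK : IsConvexBodyCPlus (m + 1) K) {v : ℂ} (hv : v ≠ 0) (θ₀ : ℝ) :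
    ∃ ρ : ℂ → ℝ, ContDiffAt ℝ (m + 1) ρ (gaussCurve K v θ₀) ∧
      fderiv ℝ ρ (gaussCurve K v θ₀) (rotVec v θ₀) = 0 ∧
      0 < fderiv ℝ ρ (gaussCurve K v θ₀) (Complex.I * rotVec v θ₀) ∧
      0 < fderiv ℝ (fderiv ℝ ρ) (gaussCurve K v θ₀) (rotVec v θ₀) (rotVec v θ₀) ∧
      ∀ᶠ θ in 𝓝 θ₀, ρ (gaussCurve K v θ) = 0 ∧
        fderiv ℝ ρ (gaussCurve K v θ) (rotVec v θ) = 0 := by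
  have hK2 : IsConvexBodyCPlus 2 K := hK.mono (by omega)
  have hcl := hK.isCompact.isClosed
  have hn := isOuterNormalAt_gaussCurve hK hv
  obtain ⟨ρ, hρ, hiff, hne, hpos⟩ := hK.boundary _ (hn θ₀).1
  have hdiff : ∀ᶠ z in 𝓝 (gaussCurve K v θ₀), DifferentiableAt ℝ ρ z :=
    (hρ.eventually (by simp)).mono fun z hz => hz.differentiableAt (by simp)
  have hcont := (continuous_gaussCurve hK2 hv).tendsto θ₀
  have hev : ∀ᶠ θ in 𝓝 θ₀, ρ (gaussCurve K v θ) = 0 ∧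
        fderiv ℝ ρ (gaussCurve K v θ) (rotVec v θ) = 0 := by
    filter_upwards [hcont.eventually hdiff, hcont.eventually (eventually_eventually_nhds.2 hiff)]
      with θ h1 h2
    have h0 := definingFunction_eq_zero hcl (hn θ).1 h1.continuousAt h2
    exact ⟨h0, (hn θ).fderiv_eq_zero (I_mul_rotVec_ne_zero hv θ) h1 h2 h0 (inner_I_mul_self _)⟩
  have htan := hev.self_of_nhds.2
  have hIτ : fderiv ℝ ρ (gaussCurve K v θ₀) (Complex.I * rotVec v θ₀) ≠ 0 := by
    intro h
    refine hne (ContinuousLinearMap.ext fun q => ?_)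
    rw [eq_smul_add_smul_I_mul (rotVec_ne_zero hv θ₀) q, map_add, map_smul, map_smul, htan, h]
    simp
  refine ⟨ρ, by exact_mod_cast hρ, htan, lt_of_le_of_ne (not_lt.1 fun h => ?_) (Ne.symm hIτ),
    hpos _ (rotVec_ne_zero hv θ₀) htan, hev⟩
  -- Otherwise the outer normal itself would be a direction entering `K`.
  have h1 := (hn θ₀).inner_nonpos hdiff.self_of_nhds hiff hev.self_of_nhds.1 h
  rw [real_inner_self_eq_norm_sq] at h1
  have : 0 < ‖Complex.I * rotVec v θ₀‖ ^ 2 := by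
    have := I_mul_rotVec_ne_zero hv θ₀
    positivity
  linarith

/-- Implicit function theorem for the two equations `ρ(p) = 0` and `dρ_p(τ_θ) = 0`, with `τ_θ =
rotVec v θ`. In the basis `τ, Jτ` the partial differential in `p` is triangular with nonzero entries
`dρ(Jτ)` and `D²ρ(τ, τ)`. One derivative of `ρ` is lost in the second equation. -/
theorem contDiff_gaussCurve {K : Set ℂ} {m : ℕ} (hm : 1 ≤ m)
    (hK : IsConvexBodyCPlus (m + 1) K) {v : ℂ} (hv : v ≠ 0) :
    ContDiff ℝ m (gaussCurve K v) := by
  rw [contDiff_iff_contDiffAt]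
  intro θ₀
  obtain ⟨ρ, hρ, htan, hIτ, hpos, hev⟩ := exists_definingFunction_gaussCurve hm hK hv θ₀
  have hK2 : IsConvexBodyCPlus 2 K := hK.mono (by omega)
  set p₀ := gaussCurve K v θ₀ with hp₀
  set F : ℝ × ℂ → ℝ × ℝ := fun x => (ρ x.2, fderiv ℝ ρ x.2 (rotVec v x.1)) with hF
  have hdρ : ContDiffAt ℝ m (fderiv ℝ ρ) p₀ := hρ.fderiv_right le_rfl
  have hFC : ContDiffAt ℝ m F (θ₀, p₀) := by
    refine ContDiffAt.prodMk ?_ ?_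
    · exact (hρ.of_le (by norm_cast; omega)).comp (θ₀, p₀) contDiffAt_snd
    · refine ContDiffAt.clm_apply ?_ ?_
      · exact hdρ.comp (θ₀, p₀) contDiffAt_snd
      · exact (contDiff_rotVec v).contDiffAt.comp (θ₀, p₀) contDiffAt_fst
  have hm0 : (m : WithTop ℕ∞) ≠ 0 := by
    norm_cast
    omega
  have hpart : ∀ q, (fderiv ℝ F (θ₀, p₀) ∘L .inr ℝ ℝ ℂ) q =
      (fderiv ℝ ρ p₀ q, fderiv ℝ (fderiv ℝ ρ) p₀ q (rotVec v θ₀)) := by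
    intro q
    have h1 : HasFDerivAt (fun p : ℂ => (θ₀, p)) (ContinuousLinearMap.inr ℝ ℝ ℂ) p₀ :=
      hasFDerivAt_prodMk_right θ₀ p₀
    have h2 := (hFC.differentiableAt hm0).hasFDerivAt.comp p₀ h1
    have h3 : HasFDerivAt ρ (fderiv ℝ ρ p₀) p₀ :=
      (hρ.differentiableAt (by norm_cast)).hasFDerivAt
    have h4 : HasFDerivAt (fderiv ℝ ρ) (fderiv ℝ (fderiv ℝ ρ) p₀) p₀ :=
      (hdρ.differentiableAt hm0).hasFDerivAt
    have h5 := h3.prodMk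
      ((ContinuousLinearMap.apply ℝ ℝ (rotVec v θ₀)).hasFDerivAt.comp p₀ h4)
    have h6 := h2.unique h5
    rw [h6]
    rfl
  have hinj : Function.Injective (fderiv ℝ F (θ₀, p₀) ∘L .inr ℝ ℝ ℂ) := by
    rw [injective_iff_map_eq_zero]
    intro q hq
    rw [hpart, Prod.mk_eq_zero] at hq
    obtain ⟨h1, h2⟩ := hq
    have hq' := eq_smul_add_smul_I_mul (rotVec_ne_zero hv θ₀) q
    set a := (q / rotVec v θ₀).re
    set b := (q / rotVec v θ₀).im
    rw [hq', map_add, map_smul, map_smul, htan, smul_zero, zero_add, smul_eq_mul] at h1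
    have hb : b = 0 := (mul_eq_zero.1 h1).resolve_right hIτ.ne'
    rw [hb, zero_smul, add_zero] at hq'
    rw [hq', map_smul, smul_apply, smul_eq_mul] at h2
    have ha : a = 0 := (mul_eq_zero.1 h2).resolve_right hpos.ne'
    rw [hq', ha, zero_smul]
  have hinv : (fderiv ℝ F (θ₀, p₀) ∘L .inr ℝ ℝ ℂ).IsInvertible := by
    have hfin : Module.finrank ℝ ℂ = Module.finrank ℝ (ℝ × ℝ) := by
      simp [Complex.finrank_real_complex]
    exact ⟨(LinearMap.linearEquivOfInjective
      (fderiv ℝ F (θ₀, p₀) ∘L .inr ℝ ℝ ℂ : ℂ →ₗ[ℝ] ℝ × ℝ) hinj hfin).toContinuousLinearEquiv,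
      by ext <;> rfl⟩
  have h0 : F (θ₀, p₀) = 0 := Prod.ext hev.self_of_nhds.1 htan
  have hψ := hFC.contDiffAt_implicitFunction hm0 hinv
  refine hψ.congr_of_eventuallyEq ?_
  have ht : Filter.Tendsto (fun θ => (θ, gaussCurve K v θ)) (𝓝 θ₀) (𝓝 (θ₀, p₀)) :=
    Filter.Tendsto.prodMk_nhds Filter.tendsto_id ((continuous_gaussCurve hK2 hv).tendsto θ₀)
  filter_upwards [ht.eventually (hFC.eventually_apply_eq_iff_implicitFunction hm0 hinv), hev]
    with θ h1 h2
  refine (h1.1 ?_).symm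
  rw [h0]
  exact Prod.ext h2.1 h2.2

/-- Differentiating `ρ = 0` shows that the velocity is a multiple `a τ` of the tangent;
differentiating `dρ(τ) = 0` gives `a D²ρ(τ, τ) + dρ(Jτ) = 0`, so that `a < 0`. -/
theorem hasDerivAt_gaussCurve {K : Set ℂ} (hK : IsConvexBodyCPlus 2 K) {v : ℂ} (hv : v ≠ 0)
    (θ₀ : ℝ) : ∃ r : ℝ, 0 < r ∧ HasDerivAt (gaussCurve K v) (-r • rotVec v θ₀) θ₀ := by
  obtain ⟨ρ, hρ, htan, hIτ, hpos, hev⟩ :=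
    exists_definingFunction_gaussCurve (m := 1) le_rfl hK hv θ₀
  set p₀ := gaussCurve K v θ₀ with hp₀
  have hg := ((contDiff_gaussCurve (m := 1) le_rfl hK hv).differentiable
    (by simp) θ₀).hasDerivAt
  set g' := deriv (gaussCurve K v) θ₀ with hg'
  have h3 : HasFDerivAt ρ (fderiv ℝ ρ p₀) p₀ :=
    (hρ.differentiableAt (by norm_num)).hasFDerivAt
  have h4 : HasFDerivAt (fderiv ℝ ρ) (fderiv ℝ (fderiv ℝ ρ) p₀) p₀ :=
    ((hρ.fderiv_right (m := 1) (by norm_num)).differentiableAt one_ne_zero).hasFDerivAt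
  have h5 : fderiv ℝ ρ p₀ g' = 0 := by
    have h6 := h3.comp_hasDerivAt θ₀ hg
    refine h6.unique ((hasDerivAt_const θ₀ (0 : ℝ)).congr_of_eventuallyEq ?_)
    filter_upwards [hev] with θ h
    exact h.1
  have h7 : fderiv ℝ (fderiv ℝ ρ) p₀ g' (rotVec v θ₀) +
      fderiv ℝ ρ p₀ (Complex.I * rotVec v θ₀) = 0 := by
    have h8 := h4.comp_hasDerivAt θ₀ hg
    have h9 := h8.clm_apply (hasDerivAt_rotVec v θ₀)
    refine h9.unique ((hasDerivAt_const θ₀ (0 : ℝ)).congr_of_eventuallyEq ?_)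
    filter_upwards [hev] with θ h
    exact h.2
  have hq' := eq_smul_add_smul_I_mul (rotVec_ne_zero hv θ₀) g'
  set a := (g' / rotVec v θ₀).re
  set b := (g' / rotVec v θ₀).im
  rw [hq', map_add, map_smul, map_smul, htan, smul_zero, zero_add, smul_eq_mul] at h5
  have hb : b = 0 := (mul_eq_zero.1 h5).resolve_right hIτ.ne'
  rw [hb, zero_smul, add_zero] at hq'
  rw [hq', map_smul, smul_apply, smul_eq_mul] at h7
  refine ⟨-a, ?_, ?_⟩
  · by_contra h
    push Not at h
    nlinarith
  · rw [neg_neg, ← hq']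
    exact hg

/-! ### The height of the Gauss curve over `L_v` and the conjugate angle. -/

/-- The component of the Gauss curve which is normal to `v`. -/
def gaussHeight (K : Set ℂ) (v : ℂ) (θ : ℝ) : ℝ := (gaussCurve K v θ / v).im

theorem rotVec_div_im {v : ℂ} (hv : v ≠ 0) (θ : ℝ) : (rotVec v θ / v).im = sin θ := by
  rw [rotVec, mul_div_cancel_left₀ _ hv, Complex.exp_ofReal_mul_I_im]

theorem rotVec_div_re {v : ℂ} (hv : v ≠ 0) (θ : ℝ) : (rotVec v θ / v).re = cos θ := by
  rw [rotVec, mul_div_cancel_left₀ _ hv, Complex.exp_ofReal_mul_I_re]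

/-- The imaginary part of `z / v`, as a continuous linear functional of `z`. -/
def imDiv (v : ℂ) : ℂ →L[ℝ] ℝ :=
  Complex.imCLM.comp ((ContinuousLinearMap.mul ℝ ℂ).flip v⁻¹)

/-- The real part of `z / v`, as a continuous linear functional of `z`. -/
def reDiv (v : ℂ) : ℂ →L[ℝ] ℝ :=
  Complex.reCLM.comp ((ContinuousLinearMap.mul ℝ ℂ).flip v⁻¹)

theorem imDiv_apply (v z : ℂ) : imDiv v z = (z / v).im := by
  simp [imDiv, div_eq_mul_inv, mul_comm z]

theorem reDiv_apply (v z : ℂ) : reDiv v z = (z / v).re := by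
  simp [reDiv, div_eq_mul_inv, mul_comm z]

theorem gaussHeight_eq (K : Set ℂ) (v : ℂ) : gaussHeight K v = imDiv v ∘ gaussCurve K v := by
  ext θ
  simp [gaussHeight, imDiv_apply]

theorem hasDerivAt_gaussHeight {K : Set ℂ} (hK : IsConvexBodyCPlus 2 K) {v : ℂ} (hv : v ≠ 0)
    (θ : ℝ) : ∃ r : ℝ, 0 < r ∧ HasDerivAt (gaussHeight K v) (-(r * sin θ)) θ := by
  obtain ⟨r, hr, h⟩ := hasDerivAt_gaussCurve hK hv θ
  refine ⟨r, hr, ?_⟩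
  have h1 := (imDiv v).hasFDerivAt.comp_hasDerivAt θ h
  rw [gaussHeight_eq]
  rwa [map_smul, imDiv_apply, rotVec_div_im hv, smul_eq_mul, neg_mul] at h1

theorem contDiff_gaussHeight {K : Set ℂ} {m : ℕ} (hm : 1 ≤ m)
    (hK : IsConvexBodyCPlus (m + 1) K) {v : ℂ} (hv : v ≠ 0) :
    ContDiff ℝ m (gaussHeight K v) := by
  rw [gaussHeight_eq]
  exact (imDiv v).contDiff.comp (contDiff_gaussCurve hm hK hv)

theorem strictAntiOn_gaussHeight {K : Set ℂ} (hK : IsConvexBodyCPlus 2 K) {v : ℂ} (hv : v ≠ 0) :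
    StrictAntiOn (gaussHeight K v) (Icc 0 π) := by
  refine strictAntiOn_of_deriv_neg (convex_Icc 0 π)
    (contDiff_gaussHeight (m := 1) le_rfl hK hv).continuous.continuousOn fun θ hθ => ?_
  rw [interior_Icc] at hθ
  obtain ⟨r, hr, h⟩ := hasDerivAt_gaussHeight hK hv θ
  rw [h.deriv]
  have := mul_pos hr (sin_pos_of_mem_Ioo hθ)
  linarith

theorem sin_neg_of_mem {θ : ℝ} (h : θ ∈ Ioo π (2 * π)) : sin θ < 0 := by
  have h1 := sin_pos_of_mem_Ioo (x := θ - π) ⟨by linarith [h.1], by linarith [h.2]⟩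
  rw [sin_sub_pi] at h1
  linarith

theorem strictMonoOn_gaussHeight {K : Set ℂ} (hK : IsConvexBodyCPlus 2 K) {v : ℂ} (hv : v ≠ 0) :
    StrictMonoOn (gaussHeight K v) (Icc π (2 * π)) := by
  refine strictMonoOn_of_deriv_pos (convex_Icc π (2 * π))
    (contDiff_gaussHeight (m := 1) le_rfl hK hv).continuous.continuousOn fun θ hθ => ?_
  rw [interior_Icc] at hθ
  obtain ⟨r, hr, h⟩ := hasDerivAt_gaussHeight hK hv θ
  rw [h.deriv]
  have := mul_neg_of_pos_of_neg hr (sin_neg_of_mem hθ)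
  linarith

theorem gaussHeight_two_pi (K : Set ℂ) (v : ℂ) : gaussHeight K v (2 * π) = gaussHeight K v 0 := by
  simp [gaussHeight, gaussCurve, rotVec]

theorem sub_mem_span_iff {v : ℂ} (hv : v ≠ 0) (p q : ℂ) :
    p - q ∈ Submodule.span ℝ {v} ↔ (p / v).im = (q / v).im := by
  rw [Submodule.mem_span_singleton, ← sub_eq_zero (a := (p / v).im), ← Complex.sub_im, ← sub_div]
  constructor
  · rintro ⟨a, ha⟩
    rw [← ha, Complex.real_smul, mul_div_cancel_right₀ _ hv, Complex.ofReal_im]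
  · intro h
    refine ⟨((p - q) / v).re, ?_⟩
    have h1 : ((((p - q) / v).re : ℝ) : ℂ) = (p - q) / v := by
      apply Complex.ext <;> simp [h]
    rw [Complex.real_smul, h1, div_mul_cancel₀ _ hv]

/-- The height decreases strictly on `[0, π]` and takes the same value at `0` and `2π`, so its value
at `a` lies strictly between those at `π` and `2π`; the intermediate value theorem provides the
angle. -/
theorem conjAngle_spec {K : Set ℂ} (hK : IsConvexBodyCPlus 2 K) {v : ℂ} (hv : v ≠ 0) {a : ℝ}
    (ha : a ∈ Ioo 0 π) : conjAngle K v a ∈ Ioo π (2 * π) ∧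
      gaussHeight K v (conjAngle K v a) = gaussHeight K v a := by
  have hex : ∃ b : ℝ, b ∈ Ioo π (2 * π) ∧
    gaussInv K (Complex.I * (v * Complex.exp (a * Complex.I))) -
      gaussInv K (Complex.I * (v * Complex.exp (b * Complex.I))) ∈ Submodule.span ℝ {v} := by
    have hc := (contDiff_gaussHeight (m := 1) le_rfl hK hv).continuous
    have hpi := Real.pi_pos
    have hanti := strictAntiOn_gaussHeight hK hv
    have h1 : gaussHeight K v π < gaussHeight K v a :=
      hanti ⟨ha.1.le, ha.2.le⟩ ⟨hpi.le, le_rfl⟩ ha.2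
    have h2 : gaussHeight K v a < gaussHeight K v (2 * π) := by
      rw [gaussHeight_two_pi]
      exact hanti ⟨le_rfl, hpi.le⟩ ⟨ha.1.le, ha.2.le⟩ ha.1
    obtain ⟨b, hb, hba⟩ := intermediate_value_Ioo (by linarith : π ≤ 2 * π) hc.continuousOn
      (show gaussHeight K v a ∈ Ioo _ _ from ⟨h1, h2⟩)
    exact ⟨b, hb, (sub_mem_span_iff hv _ _).2 hba.symm⟩
  have h := Classical.epsilon_spec hex
  exact ⟨h.1, ((sub_mem_span_iff hv _ _).1 h.2).symm⟩

/-- The height is decreasing on `[0, π]` and increasing on `[π, 2π]`, so matching heights reverses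
the order. -/
theorem monotone_conjAngle_comp {K : Set ℂ} (hK : IsConvexBodyCPlus 2 K) {v : ℂ} (hv : v ≠ 0)
    {α : ℝ → ℝ} (hmono : Antitone α) (hrange : ∀ l, α l ∈ Ioo 0 π) :
    Monotone fun l => conjAngle K v (α l) := by
  intro l l' hl
  have h1 := conjAngle_spec hK hv (hrange l)
  have h2 := conjAngle_spec hK hv (hrange l')
  have h3 : gaussHeight K v (α l) ≤ gaussHeight K v (α l') :=
    (strictAntiOn_gaussHeight hK hv).antitoneOn (Ioo_subset_Icc_self (hrange l'))
      (Ioo_subset_Icc_self (hrange l)) (hmono hl)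
  rw [← h1.2, ← h2.2] at h3
  exact ((strictMonoOn_gaussHeight hK hv).le_iff_le (Ioo_subset_Icc_self h1.1)
    (Ioo_subset_Icc_self h2.1)).1 h3

/-- Inverse function theorem for the height, whose derivative at an angle `b` is a nonzero multiple
of `sin b`. -/
theorem contDiff_conjAngle_comp {K : Set ℂ} (hK : IsConvexBodyCPlus 2 K) {v : ℂ} (hv : v ≠ 0)
    {m : ℕ} (hm : 1 ≤ m) (hKm : IsConvexBodyCPlus (m + 1) K) {α : ℝ → ℝ} (hα : ContDiff ℝ m α)
    (hrange : ∀ l, α l ∈ Ioo 0 π) : ContDiff ℝ m fun l => conjAngle K v (α l) := by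
  have hspec := fun l => conjAngle_spec hK hv (hrange l)
  have hm0 : (m : WithTop ℕ∞) ≠ 0 := by
    norm_cast
    omega
  rw [contDiff_iff_contDiffAt]
  intro l₀
  set b₀ := conjAngle K v (α l₀) with hb₀
  have hH := contDiff_gaussHeight hm hKm hv
  obtain ⟨r, hr, hd⟩ := hasDerivAt_gaussHeight hK hv b₀
  have hne : -(r * sin b₀) ≠ 0 := by
    have := mul_neg_of_pos_of_neg hr (sin_neg_of_mem (hspec l₀).1)
    linarith
  have hd' : HasFDerivAt (gaussHeight K v)
      ((ContinuousLinearEquiv.unitsEquivAut ℝ (Units.mk0 _ hne) : ℝ ≃L[ℝ] ℝ) : ℝ →L[ℝ] ℝ) b₀ := by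
    have h1 : ((ContinuousLinearEquiv.unitsEquivAut ℝ (Units.mk0 _ hne) : ℝ ≃L[ℝ] ℝ) :
        ℝ →L[ℝ] ℝ) = ContinuousLinearMap.toSpanSingleton ℝ (-(r * sin b₀)) := by
      ext
      simp
    rw [h1]
    exact hd.hasFDerivAt
  have hinv := hH.contDiffAt.to_localInverse hd' hm0
  have hstrict := hH.contDiffAt.hasStrictFDerivAt' hd' hm0
  have hcomp : ContDiffAt ℝ m
      (fun l => hH.contDiffAt.localInverse hd' hm0 (gaussHeight K v (α l))) l₀ := by
    refine ContDiffAt.comp (f := fun l => gaussHeight K v (α l)) l₀ ?_ (hH.comp hα).contDiffAt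
    rw [← (hspec l₀).2]
    exact hinv
  refine hcomp.congr_of_eventuallyEq ?_
  have hb : gaussHeight K v (α l₀) = gaussHeight K v b₀ := (hspec l₀).2.symm
  have ht : Filter.Tendsto (fun l => gaussHeight K v (α l)) (𝓝 l₀) (𝓝 (gaussHeight K v b₀)) := by
    rw [← hb]
    exact (hH.continuous.comp hα.continuous).tendsto l₀
  have h1 := ht.eventually hstrict.eventually_right_inverse
  have h2 := ht.eventually (hstrict.localInverse_tendsto.eventually
    (Ioo_mem_nhds (hspec l₀).1.1 (hspec l₀).1.2))
  filter_upwards [h1, h2] with l h1 h2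
  -- The local inverse takes values in `(π, 2π)` near the base point, where the height is injective,
  -- so it is the conjugate angle.
  refine (strictMonoOn_gaussHeight hK hv).injOn (Ioo_subset_Icc_self (hspec l).1)
    (Ioo_subset_Icc_self h2) ?_
  rw [(hspec l).2]
  exact h1.symm

/-! ### The foot of the line through a point of a half-plane. -/

/-- The parameter `l` of the line `x = l + y * A l` which passes through the point `(x, y)`. -/
def footParam (A : ℝ → ℝ) (p : ℝ × ℝ) : ℝ := Classical.epsilon fun l => p.1 = l + p.2 * A l

theorem strictMono_add_mul {A : ℝ → ℝ} (hA : Monotone A) {y : ℝ} (hy : 0 ≤ y) :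
    StrictMono fun l => l + y * A l :=
  strictMono_id.add_monotone (hA.const_mul hy)

theorem footParam_spec {A : ℝ → ℝ} (hA : Monotone A) (hc : Continuous A) {p : ℝ × ℝ}
    (hp : 0 ≤ p.2) : p.1 = footParam A p + p.2 * A (footParam A p) := by
  refine Classical.epsilon_spec (p := fun l => p.1 = l + p.2 * A l) ?_
  have hsurj : Function.Surjective fun l => l + p.2 * A l := by
    refine Continuous.surjective (by fun_prop) ?_ ?_
    -- For `l ≥ 0` compare with `l + y * A 0`, by monotonicity; similarly at `-∞`.
    · refine Filter.tendsto_atTop_mono' _ ?_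
        (Filter.tendsto_atTop_add_const_right _ (p.2 * A 0) Filter.tendsto_id)
      filter_upwards [Filter.eventually_ge_atTop 0] with l hl
      exact add_le_add_right (mul_le_mul_of_nonneg_left (hA hl) hp) l
    · refine Filter.tendsto_atBot_mono' _ ?_
        (Filter.tendsto_atBot_add_const_right _ (p.2 * A 0) Filter.tendsto_id)
      filter_upwards [Filter.eventually_le_atBot 0] with l hl
      exact add_le_add_right (mul_le_mul_of_nonneg_left (hA hl) hp) l
  obtain ⟨l, hl⟩ := hsurj p.1
  exact ⟨l, hl.symm⟩

theorem eq_footParam {A : ℝ → ℝ} (hA : Monotone A) (hc : Continuous A) {p : ℝ × ℝ}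
    (hp : 0 ≤ p.2) {l : ℝ} (hl : p.1 = l + p.2 * A l) : footParam A p = l :=
  (strictMono_add_mul hA hp).injective ((footParam_spec hA hc hp).symm.trans hl)

/-- Implicit function theorem for `l + y A(l) = x`, with partial derivative `1 + y A'(l) > 0`. It
applies also when `y = 0`, and yields a function on a full neighbourhood; this is what makes
regularity up to the boundary usable for gluing. -/
theorem footParam_extension {A : ℝ → ℝ} (hA : Monotone A) {n : WithTop ℕ∞} (hn : n ≠ 0)
    (hAn : ContDiff ℝ n A) {p₀ : ℝ × ℝ} (hp₀ : 0 ≤ p₀.2) :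
    ∃ f : ℝ × ℝ → ℝ, ContDiffAt ℝ n f p₀ ∧ (∀ᶠ p in 𝓝 p₀, p.1 = f p + p.2 * A (f p)) ∧
      ∀ᶠ p in 𝓝 p₀, 0 ≤ p.2 → footParam A p = f p := by
  set l₀ := footParam A p₀ with hl₀
  have hspec := footParam_spec hA hAn.continuous hp₀
  set F : (ℝ × ℝ) × ℝ → ℝ := fun q => q.2 + q.1.2 * A q.2 - q.1.1 with hF
  have hFC : ContDiffAt ℝ n F (p₀, l₀) := by
    have : ContDiff ℝ n F := by
      rw [hF]
      fun_prop
    exact this.contDiffAt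
  have hF0 : F (p₀, l₀) = 0 := by
    rw [hF]
    linarith
  have hA' : 0 ≤ deriv A l₀ := hA.deriv_nonneg
  have hpart : ∀ w, (fderiv ℝ F (p₀, l₀) ∘L .inr ℝ (ℝ × ℝ) ℝ) w =
      (1 + p₀.2 * deriv A l₀) * w := by
    intro w
    have h1 : HasDerivAt (fun l : ℝ => (p₀, l)) (ContinuousLinearMap.inr ℝ (ℝ × ℝ) ℝ 1) l₀ :=
      (hasFDerivAt_prodMk_right p₀ l₀).hasDerivAt
    have h2 := (hFC.differentiableAt hn).hasFDerivAt.comp_hasDerivAt l₀ h1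
    have h3 : HasDerivAt (fun l : ℝ => l + p₀.2 * A l - p₀.1) (1 + p₀.2 * deriv A l₀) l₀ :=
      ((hasDerivAt_id l₀).add
        ((hAn.differentiable hn l₀).hasDerivAt.const_mul p₀.2)).sub_const p₀.1
    have h4 := h2.unique h3
    have h5 : w = w • (1 : ℝ) := by simp
    rw [ContinuousLinearMap.comp_apply, ← h4]
    conv_lhs => rw [h5]
    rw [map_smul, map_smul, smul_eq_mul, mul_comm]
  have hpos : 0 < 1 + p₀.2 * deriv A l₀ := by positivity
  have hinv : (fderiv ℝ F (p₀, l₀) ∘L .inr ℝ (ℝ × ℝ) ℝ).IsInvertible := by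
    refine ⟨ContinuousLinearEquiv.unitsEquivAut ℝ (Units.mk0 _ hpos.ne'), ?_⟩
    ext
    rw [hpart]
    simp
  refine ⟨hFC.implicitFunction hn hinv, hFC.contDiffAt_implicitFunction hn hinv, ?_, ?_⟩
  · filter_upwards [hFC.eventually_apply_implicitFunction hn hinv] with p hp
    rw [hF0] at hp
    simp only [hF] at hp
    linarith
  · filter_upwards [hFC.eventually_apply_implicitFunction hn hinv] with p hp hp0
    refine eq_footParam hA hAn.continuous hp0 ?_
    rw [hF0] at hp
    simp only [hF] at hp
    linarith

/-- Differentiating `x = l + y A(l)` gives `(1 + y A') dl = dx - A dy`. -/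
theorem hasFDerivAt_footParam {A : ℝ → ℝ} (hA : Monotone A) (hA1 : ContDiff ℝ 1 A) {p : ℝ × ℝ}
    (hp : 0 < p.2) : ∃ c : ℝ, 0 < c ∧ HasFDerivAt (footParam A)
      (c • (ContinuousLinearMap.fst ℝ ℝ ℝ -
        A (footParam A p) • ContinuousLinearMap.snd ℝ ℝ ℝ)) p := by
  obtain ⟨f, hf, -, hfeq⟩ := footParam_extension hA one_ne_zero hA1 hp.le
  have hev : ∀ᶠ q : ℝ × ℝ in 𝓝 p, 0 < q.2 := continuous_snd.tendsto p |>.eventually (lt_mem_nhds hp)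
  have h1 : DifferentiableAt ℝ (footParam A) p := by
    refine (hf.differentiableAt one_ne_zero).congr_of_eventuallyEq ?_
    filter_upwards [hfeq, hev] with q h1 h2
    exact h1 h2.le
  set D := fderiv ℝ (footParam A) p with hD
  set l := footParam A p with hl
  have hA' : 0 ≤ deriv A l := hA.deriv_nonneg
  have hpos : 0 < 1 + p.2 * deriv A l := by positivity
  refine ⟨(1 + p.2 * deriv A l)⁻¹, inv_pos.2 hpos, ?_⟩
  have h2 := (hA1.differentiable one_ne_zero l).hasDerivAt.comp_hasFDerivAt p h1.hasFDerivAt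
  have h3 := h1.hasFDerivAt.add ((hasFDerivAt_snd (𝕜 := ℝ) (E := ℝ) (F := ℝ) (p := p)).mul h2)
  have h4 := h3.unique ((hasFDerivAt_fst (𝕜 := ℝ) (E := ℝ) (F := ℝ) (p := p)).congr_of_eventuallyEq
    (by
      filter_upwards [hev] with q hq
      exact (footParam_spec hA hA1.continuous hq.le).symm))
  convert h1.hasFDerivAt using 1
  rw [inv_smul_eq_iff₀ hpos.ne', ← h4]
  ext <;> simp [← hl, ← hD] <;> ring

/-! ### The foot function on the whole plane. -/

/-- Parameter of the half-line through `z`: `x = l + y * A l` in the half-plane `y ≥ 0` and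
`x = l + y * B l` in the half-plane `y ≤ 0`, where `z = (x + i y) v`. -/
def sweepFoot (v : ℂ) (A B : ℝ → ℝ) (z : ℂ) : ℝ :=
  if 0 ≤ imDiv v z then footParam A (reDiv v z, imDiv v z)
  else footParam (fun l => -B l) (reDiv v z, -imDiv v z)

/-- The height of the ruled surface with feet `sweepFoot v A B`. -/
def sweepHeight (v : ℂ) (A B : ℝ → ℝ) (z : ℂ) : ℝ :=
  -(‖v‖ ^ 2 * (imDiv v z * sweepFoot v A B z))

section

variable {v : ℂ} {A B : ℝ → ℝ}

theorem sweepFoot_of_im_eq_zero (hA : Monotone A) (hAc : Continuous A) {z : ℂ}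
    (hz : imDiv v z = 0) : sweepFoot v A B z = reDiv v z := by
  rw [sweepFoot, if_pos hz.ge]
  exact eq_footParam hA hAc hz.ge (by simp [hz])

/-- On the line itself both branches return the abscissa, so the lower formula, obtained by the
reflection `y ↦ -y`, `B ↦ -B`, holds on the closed half-plane. -/
theorem sweepFoot_of_nonpos (hA : Monotone A) (hAc : Continuous A) (hB : Antitone B)
    (hBc : Continuous B) {z : ℂ} (hz : imDiv v z ≤ 0) :
    sweepFoot v A B z = footParam (fun l => -B l) (reDiv v z, -imDiv v z) := by
  rcases hz.lt_or_eq with h | h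
  · rw [sweepFoot, if_neg (not_le.2 h)]
  · rw [sweepFoot_of_im_eq_zero hA hAc h]
    exact (eq_footParam hB.neg hBc.neg (by simp [h]) (by simp [h])).symm

theorem sweepFoot_spec_upper (hA : Monotone A) (hAc : Continuous A) {z : ℂ}
    (hz : 0 ≤ imDiv v z) :
    reDiv v z = sweepFoot v A B z + imDiv v z * A (sweepFoot v A B z) := by
  rw [sweepFoot, if_pos hz]
  exact footParam_spec hA hAc (p := (reDiv v z, imDiv v z)) hz

theorem sweepFoot_spec_lower (hA : Monotone A) (hAc : Continuous A) (hB : Antitone B)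
    (hBc : Continuous B) {z : ℂ} (hz : imDiv v z ≤ 0) :
    reDiv v z = sweepFoot v A B z + imDiv v z * B (sweepFoot v A B z) := by
  rw [sweepFoot_of_nonpos hA hAc hB hBc hz]
  have := footParam_spec hB.neg hBc.neg (p := (reDiv v z, -imDiv v z)) (by simpa using hz)
  simp only at this
  linarith

theorem eq_sweepFoot_upper (hA : Monotone A) (hAc : Continuous A) {z : ℂ}
    (hz : 0 ≤ imDiv v z) {l : ℝ} (hl : reDiv v z = l + imDiv v z * A l) :
    sweepFoot v A B z = l := by
  rw [sweepFoot, if_pos hz]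
  exact eq_footParam hA hAc (p := (reDiv v z, imDiv v z)) hz hl

theorem eq_sweepFoot_lower (hA : Monotone A) (hAc : Continuous A) (hB : Antitone B)
    (hBc : Continuous B) {z : ℂ} (hz : imDiv v z ≤ 0) {l : ℝ}
    (hl : reDiv v z = l + imDiv v z * B l) : sweepFoot v A B z = l := by
  rw [sweepFoot_of_nonpos hA hAc hB hBc hz]
  exact eq_footParam hB.neg hBc.neg (p := (reDiv v z, -imDiv v z)) (by simpa using hz)
    (by simpa using hl)

theorem sweepFoot_extension_upper (hA : Monotone A) {n : WithTop ℕ∞} (hn : n ≠ 0)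
    (hAn : ContDiff ℝ n A) {z₀ : ℂ} (hz₀ : 0 ≤ imDiv v z₀) :
    ∃ f : ℂ → ℝ, ContDiffAt ℝ n f z₀ ∧
      (∀ᶠ z in 𝓝 z₀, reDiv v z = f z + imDiv v z * A (f z)) ∧
      ∀ᶠ z in 𝓝 z₀, 0 ≤ imDiv v z → sweepFoot v A B z = f z := by
  obtain ⟨f, hf, h1, h2⟩ := footParam_extension hA hn hAn (p₀ := (reDiv v z₀, imDiv v z₀)) hz₀
  have hc : ContDiff ℝ n fun z => (reDiv v z, imDiv v z) := by fun_prop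
  have ht := hc.continuous.tendsto z₀
  refine ⟨fun z => f (reDiv v z, imDiv v z), hf.comp z₀ hc.contDiffAt, ht.eventually h1, ?_⟩
  filter_upwards [ht.eventually h2] with z hz hz0
  rw [sweepFoot, if_pos hz0]
  exact hz hz0

theorem sweepFoot_extension_lower (hA : Monotone A) (hAc : Continuous A) (hB : Antitone B)
    {n : WithTop ℕ∞} (hn : n ≠ 0) (hBn : ContDiff ℝ n B) {z₀ : ℂ} (hz₀ : imDiv v z₀ ≤ 0) :
    ∃ f : ℂ → ℝ, ContDiffAt ℝ n f z₀ ∧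
      (∀ᶠ z in 𝓝 z₀, reDiv v z = f z + imDiv v z * B (f z)) ∧
      ∀ᶠ z in 𝓝 z₀, imDiv v z ≤ 0 → sweepFoot v A B z = f z := by
  obtain ⟨f, hf, h1, h2⟩ := footParam_extension hB.neg hn hBn.neg
    (p₀ := (reDiv v z₀, -imDiv v z₀)) (by simpa using hz₀)
  have hc : ContDiff ℝ n fun z => (reDiv v z, -imDiv v z) := by fun_prop
  have ht := hc.continuous.tendsto z₀
  refine ⟨fun z => f (reDiv v z, -imDiv v z), hf.comp z₀ hc.contDiffAt, ?_, ?_⟩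
  · filter_upwards [ht.eventually h1] with z hz
    linarith
  · filter_upwards [ht.eventually h2] with z hz hz0
    rw [sweepFoot_of_nonpos hA hAc hB hBn.continuous hz0]
    exact hz (by simpa using hz0)

theorem hasFDerivAt_sweepFoot_upper (hA : Monotone A) (hA1 : ContDiff ℝ 1 A) {z : ℂ}
    (hz : 0 < imDiv v z) : ∃ c : ℝ, 0 < c ∧ HasFDerivAt (sweepFoot v A B)
      (c • (reDiv v - A (sweepFoot v A B z) • imDiv v)) z := by
  obtain ⟨c, hc, h⟩ := hasFDerivAt_footParam hA hA1 (p := (reDiv v z, imDiv v z)) hz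
  refine ⟨c, hc, ?_⟩
  have h1 := h.comp z ((reDiv v).hasFDerivAt.prodMk (imDiv v).hasFDerivAt)
  have h2 := h1.congr_of_eventuallyEq (f₁ := sweepFoot v A B) (by
    filter_upwards [(imDiv v).continuous.tendsto z |>.eventually (lt_mem_nhds hz)] with w hw
    rw [sweepFoot, if_pos hw.le]
    rfl)
  have h3 : sweepFoot v A B z = footParam A (reDiv v z, imDiv v z) := if_pos hz.le
  refine h2.congr_fderiv ?_
  rw [h3]
  ext w
  simp

theorem hasFDerivAt_sweepFoot_lower (hB : Antitone B) (hB1 : ContDiff ℝ 1 B) {z : ℂ}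
    (hz : imDiv v z < 0) : ∃ c : ℝ, 0 < c ∧ HasFDerivAt (sweepFoot v A B)
      (c • (reDiv v - B (sweepFoot v A B z) • imDiv v)) z := by
  obtain ⟨c, hc, h⟩ := hasFDerivAt_footParam hB.neg hB1.neg (p := (reDiv v z, -imDiv v z))
    (by simpa using hz)
  refine ⟨c, hc, ?_⟩
  have h1 := h.comp z ((reDiv v).hasFDerivAt.prodMk (imDiv v).hasFDerivAt.neg)
  have h2 := h1.congr_of_eventuallyEq (f₁ := sweepFoot v A B) (by
    filter_upwards [(imDiv v).continuous.tendsto z |>.eventually (gt_mem_nhds hz)] with w hw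
    rw [sweepFoot, if_neg (not_le.2 hw)]
    rfl)
  have h3 : sweepFoot v A B z = footParam (fun l => -B l) (reDiv v z, -imDiv v z) :=
    if_neg (not_le.2 hz)
  refine h2.congr_fderiv ?_
  rw [h3]
  ext w
  simp

end

/-! ### Gluing two functions along a hyperplane. -/

section Gluing

theorem continuousAt_of_glue {E F : Type*} [TopologicalSpace E] [PseudoMetricSpace F]
    {y : E → ℝ} {u f g : E → F} {z₀ : E} (hf : ContinuousAt f z₀) (hg : ContinuousAt g z₀)
    (hu : ∀ᶠ z in 𝓝 z₀, 0 ≤ y z → u z = f z) (hl : ∀ᶠ z in 𝓝 z₀, y z ≤ 0 → u z = g z)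
    (h0 : f z₀ = g z₀) : ContinuousAt u z₀ := by
  have h1 : u z₀ = f z₀ := by
    rcases le_total 0 (y z₀) with h | h
    · exact hu.self_of_nhds h
    · exact (hl.self_of_nhds h).trans h0.symm
  have h2 : ∀ᶠ z in 𝓝 z₀, u z = f z ∨ u z = g z := by
    filter_upwards [hu, hl] with z h1 h2
    exact (le_total 0 (y z)).imp h1 h2
  rw [ContinuousAt, Metric.tendsto_nhds]
  intro ε hε
  filter_upwards [h2, Metric.tendsto_nhds.1 hf ε hε, Metric.tendsto_nhds.1 hg ε hε] with z h h' h''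
  rcases h with h | h
  · rwa [h, h1]
  · rwa [h, h1, h0]

variable {E F : Type*} [NormedAddCommGroup E] [NormedSpace ℝ E] [NormedAddCommGroup F]
  [NormedSpace ℝ F]

theorem hasFDerivAt_of_glue {y : E →L[ℝ] ℝ} {u f g : E → F} {z₀ : E}
    (hf : ContDiffAt ℝ 1 f z₀) (hg : ContDiffAt ℝ 1 g z₀)
    (hu : ∀ᶠ z in 𝓝 z₀, 0 ≤ y z → u z = f z) (hl : ∀ᶠ z in 𝓝 z₀, y z ≤ 0 → u z = g z)
    (h0 : ∀ᶠ z in 𝓝 z₀, y z = 0 → fderiv ℝ f z = fderiv ℝ g z) :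
    ∀ᶠ z in 𝓝 z₀, (0 ≤ y z → HasFDerivAt u (fderiv ℝ f z) z) ∧
      (y z ≤ 0 → HasFDerivAt u (fderiv ℝ g z) z) := by
  filter_upwards [eventually_eventually_nhds.2 hu, eventually_eventually_nhds.2 hl, h0,
    hf.eventually (by simp), hg.eventually (by simp)] with z hu hl h0 hf hg
  have hf' := (hf.differentiableAt one_ne_zero).hasFDerivAt
  have hg' := (hg.differentiableAt one_ne_zero).hasFDerivAt
  rcases lt_trichotomy 0 (y z) with h | h | h
  · refine ⟨fun _ => hf'.congr_of_eventuallyEq ?_, fun h' => absurd h (not_lt.2 h')⟩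
    filter_upwards [hu, (y.continuous.tendsto z).eventually (lt_mem_nhds h)] with w hw hw'
    exact hw hw'.le
  -- On the hyperplane the derivatives within the two closed half-spaces agree, and these
  -- half-spaces cover the space.
  · have h1 : HasFDerivWithinAt u (fderiv ℝ f z) {w | 0 ≤ y w} z :=
      hf'.hasFDerivWithinAt.congr_of_eventuallyEq
        (Filter.Eventually.filter_mono nhdsWithin_le_nhds hu |>.mp (by
          filter_upwards [self_mem_nhdsWithin] with w hw hw'
          exact hw' hw)) (hu.self_of_nhds h.le)
    have h2 : HasFDerivWithinAt u (fderiv ℝ g z) {w | y w ≤ 0} z :=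
      hg'.hasFDerivWithinAt.congr_of_eventuallyEq
        (Filter.Eventually.filter_mono nhdsWithin_le_nhds hl |>.mp (by
          filter_upwards [self_mem_nhdsWithin] with w hw hw'
          exact hw' hw)) (hl.self_of_nhds h.ge)
    rw [← h0 h.symm] at h2 ⊢
    have h3 := h1.union h2
    have h4 : {w | 0 ≤ y w} ∪ {w | y w ≤ 0} = univ :=
      eq_univ_of_forall fun w => le_total 0 (y w)
    rw [h4, hasFDerivWithinAt_univ] at h3
    exact ⟨fun _ => h3, fun _ => h3⟩
  · refine ⟨fun h' => absurd h (not_lt.2 h'), fun _ => hg'.congr_of_eventuallyEq ?_⟩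
    filter_upwards [hl, (y.continuous.tendsto z).eventually (gt_mem_nhds h)] with w hw hw'
    exact hw hw'.le

theorem continuousAt_fderiv_of_glue {y : E →L[ℝ] ℝ} {u f g : E → F} {z₀ : E}
    (hf : ContDiffAt ℝ 1 f z₀) (hg : ContDiffAt ℝ 1 g z₀)
    (hu : ∀ᶠ z in 𝓝 z₀, 0 ≤ y z → u z = f z) (hl : ∀ᶠ z in 𝓝 z₀, y z ≤ 0 → u z = g z)
    (h0 : ∀ᶠ z in 𝓝 z₀, y z = 0 → fderiv ℝ f z = fderiv ℝ g z)
    (h00 : fderiv ℝ f z₀ = fderiv ℝ g z₀) :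
    ContinuousAt (fderiv ℝ u) z₀ := by
  have h := hasFDerivAt_of_glue hf hg hu hl h0
  exact continuousAt_of_glue (y := y) (hf.fderiv_right (m := 0) (by simp)).continuousAt
    (hg.fderiv_right (m := 0) (by simp)).continuousAt
    (h.mono fun z hz hz0 => (hz.1 hz0).fderiv) (h.mono fun z hz hz0 => (hz.2 hz0).fderiv) h00

/-- Points on opposite sides are compared through the point where their segment meets the
hyperplane; the two distances add up, so the constant is the larger of the two one-sided constants.
-/
theorem exists_lipschitzOnWith_fderiv_of_glue {y : E →L[ℝ] ℝ} {u f g : E → F} {z₀ : E}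
    (hf : ContDiffAt ℝ 2 f z₀) (hg : ContDiffAt ℝ 2 g z₀)
    (hu : ∀ᶠ z in 𝓝 z₀, 0 ≤ y z → u z = f z) (hl : ∀ᶠ z in 𝓝 z₀, y z ≤ 0 → u z = g z)
    (h0 : ∀ᶠ z in 𝓝 z₀, y z = 0 → fderiv ℝ f z = fderiv ℝ g z) :
    ∃ N ∈ 𝓝 z₀, ∃ C : NNReal, LipschitzOnWith C (fderiv ℝ u) N := by
  have h := hasFDerivAt_of_glue (hf.of_le (by norm_num)) (hg.of_le (by norm_num)) hu hl h0
  obtain ⟨C₁, N₁, hN₁, hC₁⟩ :=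
    (hf.fderiv_right (m := 1) (by norm_num)).exists_lipschitzOnWith
  obtain ⟨C₂, N₂, hN₂, hC₂⟩ :=
    (hg.fderiv_right (m := 1) (by norm_num)).exists_lipschitzOnWith
  obtain ⟨r, hr, hball⟩ := Metric.mem_nhds_iff.1 (Filter.inter_mem (Filter.inter_mem hN₁ hN₂) h)
  refine ⟨Metric.ball z₀ r, Metric.ball_mem_nhds z₀ hr, max C₁ C₂, ?_⟩
  have hup : ∀ z ∈ Metric.ball z₀ r, ∀ w ∈ Metric.ball z₀ r, 0 ≤ y z → 0 ≤ y w →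
      dist (fderiv ℝ u z) (fderiv ℝ u w) ≤ (max C₁ C₂ : NNReal) * dist z w := by
    intro z hz w hw hz0 hw0
    rw [((hball hz).2.1 hz0).fderiv, ((hball hw).2.1 hw0).fderiv]
    refine (hC₁.dist_le_mul z (hball hz).1.1 w (hball hw).1.1).trans ?_
    gcongr
    exact le_max_left _ _
  have hlo : ∀ z ∈ Metric.ball z₀ r, ∀ w ∈ Metric.ball z₀ r, y z ≤ 0 → y w ≤ 0 →
      dist (fderiv ℝ u z) (fderiv ℝ u w) ≤ (max C₁ C₂ : NNReal) * dist z w := by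
    intro z hz w hw hz0 hw0
    rw [((hball hz).2.2 hz0).fderiv, ((hball hw).2.2 hw0).fderiv]
    refine (hC₂.dist_le_mul z (hball hz).1.2 w (hball hw).1.2).trans ?_
    gcongr
    exact le_max_right _ _
  have hcross : ∀ z ∈ Metric.ball z₀ r, ∀ w ∈ Metric.ball z₀ r, y z < 0 → 0 < y w →
      dist (fderiv ℝ u z) (fderiv ℝ u w) ≤ (max C₁ C₂ : NNReal) * dist z w := by
    intro z hz w hw hz0 hw0
    set t := -y z / (y w - y z) with ht
    have hd : 0 < y w - y z := by linarith
    have ht0 : 0 ≤ t := div_nonneg (by linarith) hd.le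
    have ht1 : t ≤ 1 := (div_le_one hd).2 (by linarith)
    set q := AffineMap.lineMap z w t with hq
    have hqb : q ∈ Metric.ball z₀ r := (convex_ball z₀ r).lineMap_mem hz hw ⟨ht0, ht1⟩
    have hyq : y q = 0 := by
      rw [hq, AffineMap.lineMap_apply_module', map_add, map_smul, map_sub, smul_eq_mul, ht]
      field_simp
      ring
    have h1 := hlo z hz q hqb hz0.le hyq.le
    have h2 := hup q hqb w hw hyq.ge hw0.le
    have h3 : dist z q + dist q w = dist z w := by
      rw [hq, dist_left_lineMap, dist_lineMap_right, Real.norm_of_nonneg ht0,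
        Real.norm_of_nonneg (by linarith)]
      ring
    calc dist (fderiv ℝ u z) (fderiv ℝ u w)
        ≤ dist (fderiv ℝ u z) (fderiv ℝ u q) + dist (fderiv ℝ u q) (fderiv ℝ u w) :=
          dist_triangle _ _ _
      _ ≤ (max C₁ C₂ : NNReal) * (dist z q + dist q w) := by
          rw [mul_add]
          exact add_le_add h1 h2
      _ = (max C₁ C₂ : NNReal) * dist z w := by rw [h3]
  refine LipschitzOnWith.of_dist_le_mul fun z hz w hw => ?_
  rcases le_or_gt 0 (y z) with h1 | h1 <;> rcases le_or_gt 0 (y w) with h2 | h2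
  · exact hup z hz w hw h1 h2
  · rcases h1.lt_or_eq with h1 | h1
    · rw [dist_comm, dist_comm z w]
      exact hcross w hw z hz h2 h1
    · exact hlo z hz w hw h1.ge h2.le
  · rcases h2.lt_or_eq with h2 | h2
    · exact hcross z hz w hw h1 h2
    · exact hlo z hz w hw h1.le h2.ge
  · exact hlo z hz w hw h1.le h2.le

end Gluing

/-! ### Regularity of the ruled surface. -/

section

variable {v : ℂ} {A B : ℝ → ℝ}

/-- On the line the two extensions are glued; off the line one of them serves for both, the
condition on the other side being vacuous nearby. -/
theorem sweepFoot_local (hA : Monotone A) (hB : Antitone B) {n : WithTop ℕ∞} (hn : n ≠ 0)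
    (hAn : ContDiff ℝ n A) (hBn : ContDiff ℝ n B) (z₀ : ℂ) :
    ∃ f g : ℂ → ℝ, ContDiffAt ℝ n f z₀ ∧ ContDiffAt ℝ n g z₀ ∧
      (∀ᶠ z in 𝓝 z₀, 0 ≤ imDiv v z → sweepFoot v A B z = f z) ∧
      (∀ᶠ z in 𝓝 z₀, imDiv v z ≤ 0 → sweepFoot v A B z = g z) ∧
      f z₀ = g z₀ ∧ (imDiv v z₀ ≠ 0 → f = g) := by
  have hAc := hAn.continuous
  rcases lt_trichotomy (imDiv v z₀) 0 with h | h | h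
  · obtain ⟨g, hg, -, h2⟩ := sweepFoot_extension_lower (v := v) hA hAc hB hn hBn h.le
    refine ⟨g, g, hg, hg, ?_, h2, rfl, fun _ => rfl⟩
    filter_upwards [((imDiv v).continuous.tendsto z₀).eventually (gt_mem_nhds h)] with w hw hw'
    exact absurd hw (not_lt.2 hw')
  · obtain ⟨f, hf, -, h1⟩ := sweepFoot_extension_upper (v := v) (B := B) hA hn hAn h.ge
    obtain ⟨g, hg, -, h2⟩ := sweepFoot_extension_lower (v := v) hA hAc hB hn hBn h.le
    exact ⟨f, g, hf, hg, h1, h2, (h1.self_of_nhds h.ge).symm.trans (h2.self_of_nhds h.le),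
      fun h' => absurd h h'⟩
  · obtain ⟨f, hf, -, h1⟩ := sweepFoot_extension_upper (v := v) (B := B) hA hn hAn h.le
    refine ⟨f, f, hf, hf, h1, ?_, rfl, fun _ => rfl⟩
    filter_upwards [((imDiv v).continuous.tendsto z₀).eventually (lt_mem_nhds h)] with w hw hw'
    exact absurd hw (not_lt.2 hw')

theorem continuous_sweepFoot (hA : Monotone A) (hB : Antitone B) (hA1 : ContDiff ℝ 1 A)
    (hB1 : ContDiff ℝ 1 B) : Continuous (sweepFoot v A B) := by
  rw [continuous_iff_continuousAt]
  intro z₀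
  obtain ⟨f, g, hf, hg, hu, hl, h0, -⟩ := sweepFoot_local (v := v) hA hB one_ne_zero hA1 hB1 z₀
  exact continuousAt_of_glue hf.continuousAt hg.continuousAt hu hl h0

/-- The factor `y` in the height kills the differential of the foot at `y = 0`; only the value of
the foot survives there, and both extensions take the value `x`. -/
theorem sweepHeight_local (hA : Monotone A) (hB : Antitone B) {n : WithTop ℕ∞} (hn : n ≠ 0)
    (hAn : ContDiff ℝ n A) (hBn : ContDiff ℝ n B) (z₀ : ℂ) :
    ∃ f g : ℂ → ℝ, ContDiffAt ℝ n f z₀ ∧ ContDiffAt ℝ n g z₀ ∧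
      (∀ᶠ z in 𝓝 z₀, 0 ≤ imDiv v z → sweepHeight v A B z = f z) ∧
      (∀ᶠ z in 𝓝 z₀, imDiv v z ≤ 0 → sweepHeight v A B z = g z) ∧
      (∀ᶠ z in 𝓝 z₀, imDiv v z = 0 → fderiv ℝ f z = fderiv ℝ g z) ∧
      (imDiv v z₀ = 0 → fderiv ℝ f z₀ = -(‖v‖ ^ 2 * reDiv v z₀) • imDiv v) ∧
      fderiv ℝ f z₀ = fderiv ℝ g z₀ := by
  obtain ⟨f, g, hf, hg, hu, hl, h0, hne⟩ := sweepFoot_local (v := v) hA hB hn hAn hBn z₀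
  have hAc := hAn.continuous
  have hC : ∀ h : ℂ → ℝ, ContDiffAt ℝ n h z₀ →
      ContDiffAt ℝ n (fun z => -(‖v‖ ^ 2 * (imDiv v z * h z))) z₀ := fun h hh =>
    (contDiffAt_const.mul ((imDiv v).contDiff.contDiffAt.mul hh)).neg
  have hD : ∀ (h : ℂ → ℝ) (z : ℂ), DifferentiableAt ℝ h z → imDiv v z = 0 →
      sweepFoot v A B z = h z → fderiv ℝ (fun z => -(‖v‖ ^ 2 * (imDiv v z * h z))) z =
        -(‖v‖ ^ 2 * reDiv v z) • imDiv v := by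
    intro h z hh hz hfoot
    have h1 := (((imDiv v).hasFDerivAt (x := z)).mul
      hh.hasFDerivAt).const_mul (‖v‖ ^ 2) |>.neg
    refine h1.fderiv.trans ?_
    rw [sweepFoot_of_im_eq_zero hA hAc hz] at hfoot
    rw [hz, ← hfoot]
    ext w
    simp [mul_assoc]
  have hfd : ∀ᶠ z in 𝓝 z₀, DifferentiableAt ℝ f z :=
    ((hf.of_le (ENat.one_le_iff_ne_zero_withTop.2 hn)).eventually (by simp)).mono
      fun z hz => hz.differentiableAt one_ne_zero
  have hgd : ∀ᶠ z in 𝓝 z₀, DifferentiableAt ℝ g z :=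
    ((hg.of_le (ENat.one_le_iff_ne_zero_withTop.2 hn)).eventually (by simp)).mono
      fun z hz => hz.differentiableAt one_ne_zero
  refine ⟨_, _, hC f hf, hC g hg, ?_, ?_, ?_,
    fun hz => hD f z₀ hfd.self_of_nhds hz (hu.self_of_nhds hz.ge), ?_⟩
  · filter_upwards [hu] with z hz h
    rw [sweepHeight, hz h]
  · filter_upwards [hl] with z hz h
    rw [sweepHeight, hz h]
  · filter_upwards [hfd, hgd, hu, hl] with z hf hg hu hl h
    rw [hD f z hf h (hu h.ge), hD g z hg h (hl h.le)]
  · rcases eq_or_ne (imDiv v z₀) 0 with h | h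
    · rw [hD f z₀ hfd.self_of_nhds h (hu.self_of_nhds h.ge),
        hD g z₀ hgd.self_of_nhds h (hl.self_of_nhds h.le)]
    · rw [hne h]

theorem contDiff_sweepHeight (hA : Monotone A) (hB : Antitone B) (hA1 : ContDiff ℝ 1 A)
    (hB1 : ContDiff ℝ 1 B) : ContDiff ℝ 1 (sweepHeight v A B) := by
  rw [contDiff_one_iff_fderiv]
  constructor
  · intro z
    obtain ⟨f, g, hf, hg, hu, hl, h0, -, -⟩ :=
      sweepHeight_local (v := v) hA hB one_ne_zero hA1 hB1 z
    have h := (hasFDerivAt_of_glue hf hg hu hl h0).self_of_nhds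
    rcases le_total 0 (imDiv v z) with h' | h'
    · exact (h.1 h').differentiableAt
    · exact (h.2 h').differentiableAt
  · rw [continuous_iff_continuousAt]
    intro z
    obtain ⟨f, g, hf, hg, hu, hl, h0, -, h00⟩ :=
      sweepHeight_local (v := v) hA hB one_ne_zero hA1 hB1 z
    exact continuousAt_fderiv_of_glue hf hg hu hl h0 h00

theorem fderiv_sweepHeight_of_im_eq_zero (hA : Monotone A) (hB : Antitone B)
    (hA1 : ContDiff ℝ 1 A) (hB1 : ContDiff ℝ 1 B) {z : ℂ} (hz : imDiv v z = 0) :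
    fderiv ℝ (sweepHeight v A B) z = -(‖v‖ ^ 2 * reDiv v z) • imDiv v := by
  obtain ⟨f, g, hf, hg, hu, hl, h0, h1, -⟩ :=
    sweepHeight_local (v := v) hA hB one_ne_zero hA1 hB1 z
  rw [← h1 hz]
  exact ((hasFDerivAt_of_glue hf hg hu hl h0).self_of_nhds.1 hz.ge).fderiv

theorem exists_lipschitzOnWith_fderiv_sweepHeight (hA : Monotone A) (hB : Antitone B)
    (hA2 : ContDiff ℝ 2 A) (hB2 : ContDiff ℝ 2 B) (z : ℂ) :
    ∃ N ∈ 𝓝 z, ∃ C : NNReal, LipschitzOnWith C (fderiv ℝ (sweepHeight v A B)) N := by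
  obtain ⟨f, g, hf, hg, hu, hl, h0, -, -⟩ :=
    sweepHeight_local (v := v) hA hB two_ne_zero hA2 hB2 z
  exact exists_lipschitzOnWith_fderiv_of_glue hf hg hu hl h0

theorem contDiffAt_sweepHeight_upper (hA : Monotone A) {n : WithTop ℕ∞} (hn : n ≠ 0)
    (hAn : ContDiff ℝ n A) {z : ℂ} (hz : 0 < imDiv v z) :
    ContDiffAt ℝ n (sweepHeight v A B) z := by
  obtain ⟨f, hf, -, h⟩ := sweepFoot_extension_upper (v := v) (B := B) hA hn hAn hz.le
  have h1 : ContDiffAt ℝ n (sweepFoot v A B) z := by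
    refine hf.congr_of_eventuallyEq ?_
    filter_upwards [h, ((imDiv v).continuous.tendsto z).eventually (lt_mem_nhds hz)] with w h1 h2
    exact h1 h2.le
  exact (contDiffAt_const.mul ((imDiv v).contDiff.contDiffAt.mul h1)).neg

theorem contDiffAt_sweepHeight_lower (hA : Monotone A) (hAc : Continuous A) (hB : Antitone B)
    {n : WithTop ℕ∞} (hn : n ≠ 0) (hBn : ContDiff ℝ n B) {z : ℂ} (hz : imDiv v z < 0) :
    ContDiffAt ℝ n (sweepHeight v A B) z := by
  obtain ⟨f, hf, -, h⟩ := sweepFoot_extension_lower (v := v) hA hAc hB hn hBn hz.le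
  have h1 : ContDiffAt ℝ n (sweepFoot v A B) z := by
    refine hf.congr_of_eventuallyEq ?_
    filter_upwards [h, ((imDiv v).continuous.tendsto z).eventually (gt_mem_nhds hz)] with w h1 h2
    exact h1 h2.le
  exact (contDiffAt_const.mul ((imDiv v).contDiff.contDiffAt.mul h1)).neg

/-- The second order expansion of a function of class `C^2` on the line. -/
theorem tendsto_second_difference {f : ℝ → ℝ} (hf : ContDiffAt ℝ 2 f 0) :
    Filter.Tendsto (fun s => (f s - f 0 - s * deriv f 0) / s ^ 2) (𝓝[≠] 0)
      (𝓝 (deriv (deriv f) 0 / 2)) := by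
  have hd : ∀ᶠ s in 𝓝 (0 : ℝ), HasDerivAt f (deriv f s) s :=
    (hf.eventually (by simp)).mono fun s hs => (hs.differentiableAt two_ne_zero).hasDerivAt
  have hf' : ContDiffAt ℝ 1 (deriv f) 0 := by
    have h1 : ContDiffAt ℝ 1 (fun s => fderiv ℝ f s 1) 0 :=
      (hf.fderiv_right (m := 1) (by norm_num)).clm_apply contDiffAt_const
    simpa only [fderiv_apply_one_eq_deriv] using h1
  -- One application of l'Hôpital leaves half of the difference quotient of `deriv f` at `0`.
  refine HasDerivAt.lhopital_zero_nhdsNE (f' := fun s => deriv f s - deriv f 0)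
    (g' := fun s => 2 * s) ?_ ?_ ?_ ?_ ?_ ?_
  · filter_upwards [hd.filter_mono nhdsWithin_le_nhds] with s hs
    have h1 := (hs.sub_const (f 0)).sub ((hasDerivAt_id s).mul_const (deriv f 0))
    rw [one_mul] at h1
    exact h1
  · refine Filter.Eventually.of_forall fun s => ?_
    simpa using hasDerivAt_pow 2 s
  · filter_upwards [self_mem_nhdsWithin] with s hs
    exact mul_ne_zero two_ne_zero hs
  · have : ContinuousAt (fun s => f s - f 0 - s * deriv f 0) 0 := by
      have := hf.continuousAt
      fun_prop
    simpa using this.tendsto.mono_left nhdsWithin_le_nhds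
  · have : Continuous fun s : ℝ => s ^ 2 := by fun_prop
    simpa using (this.tendsto 0).mono_left nhdsWithin_le_nhds
  · have h1 := (hf'.differentiableAt one_ne_zero).hasDerivAt.tendsto_slope
    refine (h1.div_const 2).congr fun s => ?_
    rw [slope_def_field, sub_zero, div_div, mul_comm s]

/-- On the transversal `s ↦ (l + is) v` the second-order quotient is `‖v‖² (l - foot) / s`, that is
`‖v‖² A(foot)` for `s > 0` and `‖v‖² B(foot)` for `s < 0`. If the height is `C^2`, both one-sided
limits are the same. -/
theorem eq_of_contDiffAt_two_sweepHeight (hv : v ≠ 0) (hA : Monotone A) (hB : Antitone B)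
    (hA1 : ContDiff ℝ 1 A) (hB1 : ContDiff ℝ 1 B) {l : ℝ}
    (h : ContDiffAt ℝ 2 (sweepHeight v A B) (l * v)) : A l = B l := by
  set u := sweepHeight v A B with hu
  set γ : ℝ → ℂ := fun s => l * v + s * (Complex.I * v) with hγ
  have hγC : ContDiff ℝ 2 γ := by
    have : ContDiff ℝ 2 fun s : ℝ => (s : ℂ) := Complex.ofRealCLM.contDiff
    rw [hγ]
    fun_prop
  have hγ0 : γ 0 = l * v := by simp [hγ]
  have hre : ∀ s, reDiv v (γ s) = l := fun s => by
    rw [reDiv_apply, hγ]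
    simp only [add_div, mul_div_assoc, div_self hv]
    simp
  have him : ∀ s, imDiv v (γ s) = s := fun s => by
    rw [imDiv_apply, hγ]
    simp only [add_div, mul_div_assoc, div_self hv]
    simp
  have hf : ContDiffAt ℝ 2 (u ∘ γ) 0 := by
    refine ContDiffAt.comp 0 ?_ hγC.contDiffAt
    rwa [hγ0]
  have hγd : HasDerivAt γ (Complex.I * v) 0 := by
    have := ((Complex.ofRealCLM.hasDerivAt (x := (0 : ℝ))).mul_const (Complex.I * v)).const_add
      ((l : ℂ) * v)
    rw [Complex.ofRealCLM_apply, Complex.ofReal_one, one_mul] at this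
    exact this
  have hud : HasFDerivAt u (-(‖v‖ ^ 2 * l) • imDiv v) (γ 0) := by
    have h1 := fderiv_sweepHeight_of_im_eq_zero (v := v) hA hB hA1 hB1 (him 0)
    rw [hre] at h1
    rw [← h1]
    exact ((contDiff_sweepHeight hA hB hA1 hB1).differentiable one_ne_zero _).hasFDerivAt
  have hd0 : deriv (u ∘ γ) 0 = -(‖v‖ ^ 2 * l) := by
    rw [(hud.comp_hasDerivAt 0 hγd).deriv]
    simp [imDiv_apply, mul_div_assoc, div_self hv]
  have hlim := tendsto_second_difference hf
  have hfoot : Filter.Tendsto (fun s => sweepFoot v A B (γ s)) (𝓝 0) (𝓝 l) := by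
    have h1 : Continuous fun s => sweepFoot v A B (γ s) :=
      (continuous_sweepFoot hA hB hA1 hB1).comp hγC.continuous
    have h2 := h1.tendsto 0
    rwa [sweepFoot_of_im_eq_zero hA hA1.continuous (him 0), hre] at h2
  have h00 : (u ∘ γ) 0 = 0 := by simp [hu, sweepHeight, him]
  have hexp : ∀ s, s ≠ 0 → ((u ∘ γ) s - (u ∘ γ) 0 - s * deriv (u ∘ γ) 0) / s ^ 2 =
      ‖v‖ ^ 2 * ((l - sweepFoot v A B (γ s)) / s) := by
    intro s hs
    rw [h00, hd0]
    simp only [hu, Function.comp, sweepHeight, him]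
    field_simp
    ring
  have key : ∀ (C : ℝ → ℝ) (S : Set ℝ), Continuous C → S ⊆ {0}ᶜ → (𝓝[S] (0 : ℝ)).NeBot →
      (∀ s ∈ S, l = sweepFoot v A B (γ s) + s * C (sweepFoot v A B (γ s))) →
      deriv (deriv (u ∘ γ)) 0 / 2 = ‖v‖ ^ 2 * C l := by
    intro C S hC hS hne hspec
    have h1 := hlim.mono_left (nhdsWithin_mono 0 hS)
    have h2 : Filter.Tendsto (fun s => ‖v‖ ^ 2 * C (sweepFoot v A B (γ s))) (𝓝[S] 0)
        (𝓝 (‖v‖ ^ 2 * C l)) :=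
      (((hC.tendsto l).comp hfoot).const_mul _).mono_left nhdsWithin_le_nhds
    refine tendsto_nhds_unique (h1.congr' ?_) h2
    filter_upwards [self_mem_nhdsWithin] with s hs
    have hs0 : s ≠ 0 := hS hs
    rw [hexp s hs0]
    congr 1
    rw [div_eq_iff hs0]
    linarith [hspec s hs]
  have e1 := key A (Ioi 0) hA1.continuous (fun s hs => ne_of_gt hs) inferInstance fun s hs => by
    have h1 := sweepFoot_spec_upper (v := v) (B := B) hA hA1.continuous (z := γ s)
      (by rw [him]; exact le_of_lt hs)
    rwa [hre, him] at h1
  have e2 := key B (Iio 0) hB1.continuous (fun s hs => ne_of_lt hs) inferInstance fun s hs => by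
    have h1 := sweepFoot_spec_lower (v := v) hA hA1.continuous hB hB1.continuous (z := γ s)
      (by rw [him]; exact le_of_lt hs)
    rwa [hre, him] at h1
  have hpos : 0 < ‖v‖ ^ 2 := by positivity
  exact mul_left_cancel₀ hpos.ne' (e1.symm.trans e2)

/-- Where `A = B` this function is both monotone and antitone, hence locally constant: the nearby
lines are parallel, the foot is affine and the height is a quadratic polynomial. -/
theorem contDiffAt_sweepHeight_of_eqOn (hA : Monotone A) (hB : Antitone B)
    (hA1 : ContDiff ℝ 1 A) (hB1 : ContDiff ℝ 1 B) {I : Set ℝ} (hI : IsOpen I)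
    (hAB : ∀ l ∈ I, A l = B l) {z : ℂ} (hz : sweepFoot v A B z ∈ I) {n : WithTop ℕ∞} :
    ContDiffAt ℝ n (sweepHeight v A B) z := by
  set l₀ := sweepFoot v A B z with hl₀
  obtain ⟨ε, hε, hball⟩ := Metric.isOpen_iff.1 hI l₀ hz
  have hconst : ∀ l ∈ Metric.ball l₀ ε, A l = A l₀ := by
    intro l hl
    rcases le_total l l₀ with h | h
    · refine le_antisymm (hA h) ?_
      rw [hAB l (hball hl), hAB l₀ hz]
      exact hB h
    · refine le_antisymm ?_ (hA h)
      rw [hAB l (hball hl), hAB l₀ hz]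
      exact hB h
  have h1 : ContDiffAt ℝ n
      (fun z => -(‖v‖ ^ 2 * (imDiv v z * (reDiv v z - imDiv v z * A l₀)))) z := by
    apply ContDiff.contDiffAt
    fun_prop
  refine h1.congr_of_eventuallyEq ?_
  filter_upwards [(continuous_sweepFoot hA hB hA1 hB1).tendsto z |>.eventually
    (Metric.ball_mem_nhds l₀ hε)] with w hw
  have hspec : reDiv v w = sweepFoot v A B w + imDiv v w * A l₀ := by
    rw [← hconst _ hw]
    rcases le_total 0 (imDiv v w) with h | h
    · exact sweepFoot_spec_upper hA hA1.continuous h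
    · rw [hAB _ (hball hw)]
      exact sweepFoot_spec_lower hA hA1.continuous hB hB1.continuous h
  rw [sweepHeight, show sweepFoot v A B w = reDiv v w - imDiv v w * A l₀ by linarith]

end

/-! ### Divergence-free fields constant along the half-lines. -/

theorem continuousOn_footParam {A : ℝ → ℝ} (hA : Monotone A) (hA1 : ContDiff ℝ 1 A) :
    ContinuousOn (footParam A) {p | 0 ≤ p.2} := by
  intro p hp
  obtain ⟨f, hf, -, h⟩ := footParam_extension hA one_ne_zero hA1 hp
  refine hf.continuousAt.continuousWithinAt.congr_of_eventuallyEq ?_ (h.self_of_nhds hp)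
  filter_upwards [h.filter_mono nhdsWithin_le_nhds, self_mem_nhdsWithin] with q hq hq'
  exact hq hq'

theorem footParam_zero {A : ℝ → ℝ} (hA : Monotone A) (hc : Continuous A) (x : ℝ) :
    footParam A (x, 0) = x :=
  eq_footParam hA hc (p := (x, 0)) le_rfl (by simp)

/-- Gauss-Green formula on a half-plane for a divergence free field which is constant along the
lines `x = l + y * A l`. -/
theorem integral_halfPlane_fderiv {A P Q : ℝ → ℝ} (hA : Monotone A) (hA1 : ContDiff ℝ 1 A)
    (hP : ContDiff ℝ 1 P) (hQ : ContDiff ℝ 1 Q) (hPQ : ∀ l, deriv P l = A l * deriv Q l)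
    {ψ : ℝ × ℝ → ℝ} (hψ : ContDiff ℝ 1 ψ) (hψc : HasCompactSupport ψ) :
    IntegrableOn (fun p => fderiv ℝ ψ p (P (footParam A p), Q (footParam A p)))
      {p | 0 ≤ p.2} ∧
    ∫ p in {p : ℝ × ℝ | 0 ≤ p.2}, fderiv ℝ ψ p (P (footParam A p), Q (footParam A p)) =
      -∫ x, ψ (x, 0) * Q x := by
  set Λ := footParam A with hΛ
  set h : ℝ × ℝ → ℝ := fun p => fderiv ℝ ψ p (P (Λ p), Q (Λ p)) with hh
  have hΛc := continuousOn_footParam hA hA1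
  obtain ⟨M₀, hM₀⟩ := hψc.isCompact.isBounded.exists_norm_le
  set M := |M₀| + 1 with hM
  have hM1 : M₀ < M := by linarith [le_abs_self M₀]
  have hM0 : 0 < M := by positivity
  have hout : ∀ p : ℝ × ℝ, M ≤ |p.1| ∨ M ≤ |p.2| → p ∉ tsupport ψ := by
    intro p hp hmem
    have h1 := hM₀ p hmem
    rw [Prod.norm_def, max_le_iff] at h1
    simp only [Real.norm_eq_abs] at h1
    rcases hp with hp | hp <;> linarith [h1.1, h1.2]
  have hψ0 : ∀ p : ℝ × ℝ, M ≤ |p.1| ∨ M ≤ |p.2| → ψ p = 0 := fun p hp =>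
    image_eq_zero_of_notMem_tsupport (hout p hp)
  -- A box whose top and lateral sides lie outside the support of `ψ`; only the bottom side
  -- contributes.
  set a : ℝ × ℝ := (-M, 0) with ha
  set b : ℝ × ℝ := (M, M) with hb
  have hab : a ≤ b := ⟨by simp only [ha, hb]; linarith, hM0.le⟩
  have hsub : Icc a b ⊆ {p : ℝ × ℝ | 0 ≤ p.2} := fun p hp => hp.1.2
  have hh0 : ∀ p ∈ {p : ℝ × ℝ | 0 ≤ p.2} \ Icc a b, h p = 0 := by
    rintro p ⟨hp0, hp⟩
    have : M ≤ |p.1| ∨ M ≤ |p.2| := by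
      by_contra hcon
      push Not at hcon
      have h1 := abs_lt.1 hcon.1
      have h2 := abs_lt.1 hcon.2
      exact hp ⟨⟨h1.1.le, hp0⟩, ⟨h1.2.le, h2.2.le⟩⟩
    have h3 : fderiv ℝ ψ p = 0 := by
      by_contra h
      exact hout p this (support_fderiv_subset ℝ h)
    simp [hh, h3]
  have hhc : ContinuousOn h {p | 0 ≤ p.2} := by
    refine ContinuousOn.clm_apply (hψ.continuous_fderiv one_ne_zero).continuousOn ?_
    exact (hP.continuous.comp_continuousOn hΛc).prodMk (hQ.continuous.comp_continuousOn hΛc)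
  have hhi : IntegrableOn h (Icc a b) := (hhc.mono hsub).integrableOn_compact isCompact_Icc
  have hmeas : MeasurableSet {p : ℝ × ℝ | 0 ≤ p.2} :=
    (isClosed_le continuous_const continuous_snd).measurableSet
  refine ⟨hhi.of_forall_sdiff_eq_zero hmeas hh0, ?_⟩
  rw [setIntegral_eq_of_subset_of_forall_sdiff_eq_zero hmeas hsub hh0]
  have hΛd : ∀ p : ℝ × ℝ, 0 < p.2 → DifferentiableAt ℝ Λ p := fun p hp => by
    obtain ⟨c, -, h⟩ := hasFDerivAt_footParam hA hA1 hp
    exact h.differentiableAt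
  have hψd := hψ.differentiable one_ne_zero
  -- The value `0` for `p.2 ≤ 0` makes the identity `hpt` below hold at every point; the divergence
  -- theorem uses the derivatives only in the open box.
  have hderiv : ∀ S : ℝ → ℝ, ContDiff ℝ 1 S → ∀ p : ℝ × ℝ, 0 < p.2 →
      HasFDerivAt (fun p => ψ p * S (Λ p)) (S (Λ p) • fderiv ℝ ψ p +
        ψ p • (if 0 < p.2 then deriv S (Λ p) • fderiv ℝ Λ p else 0)) p := by
    intro S hS p hp
    have h1 := (hS.differentiable one_ne_zero (Λ p)).hasDerivAt.comp_hasFDerivAt p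
      (hΛd p hp).hasFDerivAt
    rw [if_pos hp, add_comm]
    exact (hψd p).hasFDerivAt.mul h1
  -- The terms in `ψ p` cancel: `dΛ` is proportional to `dx - A dy` and `P' = A Q'`.
  have hpt : ∀ p : ℝ × ℝ, h p =
      (P (Λ p) • fderiv ℝ ψ p +
        ψ p • (if 0 < p.2 then deriv P (Λ p) • fderiv ℝ Λ p else 0)) (1, 0) +
      (Q (Λ p) • fderiv ℝ ψ p +
        ψ p • (if 0 < p.2 then deriv Q (Λ p) • fderiv ℝ Λ p else 0)) (0, 1) := by
    intro p
    have h1 : ((P (Λ p), Q (Λ p)) : ℝ × ℝ) = P (Λ p) • (1, 0) + Q (Λ p) • (0, 1) := by simp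
    simp only [hh]
    rw [h1, map_add, map_smul, map_smul]
    split_ifs with hp
    · obtain ⟨c, -, hc⟩ := hasFDerivAt_footParam hA hA1 hp
      rw [hc.fderiv, hPQ]
      simp [← hΛ]
      ring
    · simp
  have hdiv := integral_divergence_prod_Icc_of_hasFDerivAt_of_le
    (fun p => ψ p * P (Λ p)) (fun p => ψ p * Q (Λ p)) _ _ a b hab
    (hψ.continuous.continuousOn.mul (hP.continuous.comp_continuousOn (hΛc.mono hsub)))
    (hψ.continuous.continuousOn.mul (hQ.continuous.comp_continuousOn (hΛc.mono hsub)))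
    (fun p hp => hderiv P hP p hp.2.1) (fun p hp => hderiv Q hQ p hp.2.1)
    (by simpa only [← hpt] using hhi)
  simp only [← hpt] at hdiv
  rw [hdiv]
  have z1 : ∀ x, ψ (x, M) = 0 := fun x => hψ0 _ (Or.inr (le_abs_self M))
  have z2 : ∀ y, ψ (M, y) = 0 := fun y => hψ0 _ (Or.inl (le_abs_self M))
  have z3 : ∀ y, ψ (-M, y) = 0 := fun y => hψ0 _ (Or.inl (by simp [abs_of_pos hM0]))
  have z4 : ∀ x, Λ (x, 0) = x := footParam_zero hA hA1.continuous
  simp only [ha, hb, z1, z2, z3, z4, zero_mul, intervalIntegral.integral_zero, zero_sub, add_zero,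
    sub_zero]
  rw [intervalIntegral.integral_of_le (by linarith),
    setIntegral_eq_integral_of_forall_compl_eq_zero]
  intro x hx
  rw [hψ0, zero_mul]
  left
  by_contra hcon
  push Not at hcon
  have h1 := abs_lt.1 hcon
  exact hx ⟨h1.1, h1.2.le⟩

/-- The linear coordinates `(x, y) ↦ (x + i y) v`. -/
def planeCoord (v : ℂ) (hv : v ≠ 0) : (ℝ × ℝ) ≃L[ℝ] ℂ :=
  ContinuousLinearEquiv.equivOfInverse
    ((ContinuousLinearMap.fst ℝ ℝ ℝ).smulRight v +
      (ContinuousLinearMap.snd ℝ ℝ ℝ).smulRight (Complex.I * v))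
    ((reDiv v).prod (imDiv v))
    (fun p => by
      have h1 : reDiv v v = 1 := by simp [reDiv_apply, div_self hv]
      have h2 : imDiv v v = 0 := by simp [imDiv_apply, div_self hv]
      have h3 : reDiv v (Complex.I * v) = 0 := by simp [reDiv_apply, mul_div_assoc, div_self hv]
      have h4 : imDiv v (Complex.I * v) = 1 := by simp [imDiv_apply, mul_div_assoc, div_self hv]
      ext <;> simp [h1, h2, h3, h4, -Complex.real_smul])
    (fun z => by
      simp only [ContinuousLinearMap.prod_apply, reDiv_apply, imDiv_apply]
      exact (eq_smul_add_smul_I_mul hv z).symm)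

theorem planeCoord_symm_apply {v : ℂ} (hv : v ≠ 0) (z : ℂ) :
    (planeCoord v hv).symm z = (reDiv v z, imDiv v z) := rfl

theorem reDiv_planeCoord {v : ℂ} (hv : v ≠ 0) (p : ℝ × ℝ) : reDiv v (planeCoord v hv p) = p.1 :=
  congrArg Prod.fst ((planeCoord v hv).symm_apply_apply p)

theorem imDiv_planeCoord {v : ℂ} (hv : v ≠ 0) (p : ℝ × ℝ) : imDiv v (planeCoord v hv p) = p.2 :=
  congrArg Prod.snd ((planeCoord v hv).symm_apply_apply p)

/-- By uniqueness of Haar measure the Jacobian is a constant, which is irrelevant for the vanishing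
of an integral. -/
theorem integral_eq_zero_of_comp_planeCoord {v : ℂ} (hv : v ≠ 0) {F : ℂ → ℝ}
    (hF : ∫ p, F (planeCoord v hv p) = 0) : ∫ z, F z = 0 := by
  set e := planeCoord v hv with he
  have hH : (Measure.map e (volume : Measure (ℝ × ℝ))).IsAddHaarMeasure :=
    e.isAddHaarMeasure_map _
  have h2 := Measure.isAddLeftInvariant_eq_smul (volume : Measure ℂ)
    (Measure.map e (volume : Measure (ℝ × ℝ)))
  have h3 : ∫ z, F z ∂Measure.map e (volume : Measure (ℝ × ℝ)) = ∫ p, F (e p) :=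
    e.toHomeomorph.measurableEmbedding.integral_map F
  rw [h2, integral_smul_nnreal_measure, h3, hF, smul_zero]

/-- Each half-plane leaves a boundary integral of `ψ(x, 0) Q(x)`. The normal component `Q` is the
same function on both sides and the outer normals are opposite, so the two cancel, whatever the jump
of the tangential component. -/
theorem isWeaklyDivFree_sweep {v : ℂ} (hv : v ≠ 0) {A B P Q R : ℝ → ℝ} (hA : Monotone A)
    (hB : Antitone B) (hA1 : ContDiff ℝ 1 A) (hB1 : ContDiff ℝ 1 B) (hP : ContDiff ℝ 1 P)
    (hQ : ContDiff ℝ 1 Q) (hR : ContDiff ℝ 1 R) (hPQ : ∀ l, deriv P l = A l * deriv Q l)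
    (hRQ : ∀ l, deriv R l = B l * deriv Q l) {U : ℂ → ℂ}
    (hU : ∀ z, U z = planeCoord v hv
      (if 0 ≤ imDiv v z then P (sweepFoot v A B z) else R (sweepFoot v A B z),
        Q (sweepFoot v A B z))) :
    IsWeaklyDivFree U := by
  intro φ hφ hφc
  set e := planeCoord v hv with he
  apply integral_eq_zero_of_comp_planeCoord hv
  set ψ : ℝ × ℝ → ℝ := fun p => φ (e p) with hψdef
  have hψ : ContDiff ℝ 1 ψ := hφ.comp e.contDiff
  have hψc : HasCompactSupport ψ := hφc.comp_homeomorph e.toHomeomorph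
  have hD : ∀ p w, fderiv ℝ φ (e p) (e w) = fderiv ℝ ψ p w := by
    intro p w
    have h1 := (hφ.differentiable one_ne_zero (e p)).hasFDerivAt.comp p e.hasFDerivAt
    rw [show ψ = φ ∘ e from rfl, h1.fderiv]
    rfl
  simp only [hU, ← he, hD]
  -- The lower half-plane is reflected to the upper one, which changes `B` and `Q` to `-B` and `-Q`.
  set ψ' : ℝ × ℝ → ℝ := fun p => ψ (p.1, -p.2) with hψ'def
  set ρ : (ℝ × ℝ) ≃L[ℝ] (ℝ × ℝ) :=
    (ContinuousLinearEquiv.refl ℝ ℝ).prodCongr (ContinuousLinearEquiv.neg ℝ) with hρ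
  have hψ' : ContDiff ℝ 1 ψ' := hψ.comp ρ.contDiff
  have hψ'c : HasCompactSupport ψ' := hψc.comp_homeomorph ρ.toHomeomorph
  have hD' : ∀ (p : ℝ × ℝ) (x y : ℝ),
      fderiv ℝ ψ (p.1, -p.2) (x, y) = fderiv ℝ ψ' p (x, -y) := by
    intro p x y
    have h1 := (hψ.differentiable one_ne_zero (ρ p)).hasFDerivAt.comp p ρ.hasFDerivAt
    rw [show ψ' = ψ ∘ ρ from rfl, h1.fderiv]
    simp [hρ]
  obtain ⟨i1, e1⟩ := integral_halfPlane_fderiv hA hA1 hP hQ hPQ hψ hψc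
  obtain ⟨i2, e2⟩ := integral_halfPlane_fderiv hB.neg hB1.neg hR hQ.neg
    (fun l => by
      rw [hRQ, show deriv (fun x => -Q x) l = - deriv Q l from deriv.fun_neg]
      ring) hψ' hψ'c
  have hs : MeasurableSet {p : ℝ × ℝ | 0 ≤ p.2} :=
    (isClosed_le continuous_const continuous_snd).measurableSet
  set H : ℝ × ℝ → ℝ := fun p => fderiv ℝ ψ p
    (if 0 ≤ imDiv v (e p) then P (sweepFoot v A B (e p)) else R (sweepFoot v A B (e p)),
        Q (sweepFoot v A B (e p))) with hH
  have hup : EqOn H (fun p => fderiv ℝ ψ p (P (footParam A p), Q (footParam A p)))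
      {p | 0 ≤ p.2} := by
    intro p hp
    have h1 : 0 ≤ imDiv v (e p) := by
      rw [imDiv_planeCoord]
      exact hp
    simp only [hH, if_pos h1, sweepFoot]
    simp only [he, imDiv_planeCoord, reDiv_planeCoord]
  have hlo : ∀ p : ℝ × ℝ, 0 < p.2 → H (ρ p) = fderiv ℝ ψ' p
      (R (footParam (fun l => -B l) p), -Q (footParam (fun l => -B l) p)) := by
    intro p hp
    have h3 : imDiv v (e (p.1, -p.2)) = -p.2 := imDiv_planeCoord hv _
    have h4 : reDiv v (e (p.1, -p.2)) = p.1 := reDiv_planeCoord hv _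
    have h5 : ¬ 0 ≤ imDiv v (e (p.1, -p.2)) := by
      rw [h3]
      linarith
    have h2 : sweepFoot v A B (e (p.1, -p.2)) = footParam (fun l => -B l) p := by
      rw [sweepFoot, if_neg h5, h3, h4, neg_neg]
    change H (p.1, -p.2) = _
    simp only [hH, if_neg h5, h2, hD']
  have hline : volume {p : ℝ × ℝ | p.2 = 0} = 0 := by
    have : {p : ℝ × ℝ | p.2 = 0} = univ ×ˢ {0} := by
      ext p
      simp
    rw [this, Measure.volume_eq_prod, Measure.prod_prod]
    simp
  have hae : ({p : ℝ × ℝ | 0 < p.2} : Set (ℝ × ℝ)) =ᵐ[volume] {p : ℝ × ℝ | 0 ≤ p.2} := by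
    have h1 : ∀ᵐ p : ℝ × ℝ, p.2 ≠ 0 := by
      rw [ae_iff]
      simpa using hline
    filter_upwards [h1] with p hp
    exact propext ⟨fun h => le_of_lt h, fun h => lt_of_le_of_ne h (Ne.symm hp)⟩
  have hs' : MeasurableSet {p : ℝ × ℝ | 0 < p.2} :=
    (isOpen_lt continuous_const continuous_snd).measurableSet
  have hρmp : MeasurePreserving ρ :=
    (MeasurePreserving.id (volume : Measure ℝ)).prod (Measure.measurePreserving_neg volume)
  have hρemb : MeasurableEmbedding ρ := ρ.toHomeomorph.measurableEmbedding
  have hpre : ρ ⁻¹' {p : ℝ × ℝ | 0 ≤ p.2}ᶜ = {p | 0 < p.2} := by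
    ext p
    simp [hρ]
  have j1 : IntegrableOn H {p | 0 ≤ p.2} := i1.congr_fun hup.symm hs
  have j2 : IntegrableOn H {p | 0 ≤ p.2}ᶜ := by
    rw [← hρmp.integrableOn_comp_preimage hρemb, hpre]
    exact (i2.congr_set_ae hae).congr_fun (fun p hp => (hlo p hp).symm) hs'
  have k1 : ∫ p in {p | 0 ≤ p.2}, H p = -∫ x, ψ (x, 0) * Q x := by
    rw [setIntegral_congr_fun hs hup, e1]
  have k2 : ∫ p in {p | 0 ≤ p.2}ᶜ, H p = ∫ x, ψ (x, 0) * Q x := by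
    rw [← hρmp.setIntegral_preimage_emb hρemb, hpre, setIntegral_congr_fun hs' hlo,
      setIntegral_congr_set hae]
    refine e2.trans ?_
    simp [hψ'def, integral_neg]
  have k3 := setIntegral_union disjoint_compl_right hs.compl j1 j2
  rw [union_compl_self, setIntegral_univ, k1, k2, neg_add_cancel] at k3
  exact k3

/-! ### Rays and their horizontal lifts in the coordinates of `v`. -/

theorem reDiv_self {v : ℂ} (hv : v ≠ 0) : reDiv v v = 1 := by simp [reDiv_apply, div_self hv]

theorem imDiv_self {v : ℂ} (hv : v ≠ 0) : imDiv v v = 0 := by simp [imDiv_apply, div_self hv]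

theorem reDiv_ofReal_mul (v : ℂ) (s : ℝ) (z : ℂ) : reDiv v (s * z) = s * reDiv v z := by
  rw [← Complex.real_smul, map_smul, smul_eq_mul]

theorem imDiv_ofReal_mul (v : ℂ) (s : ℝ) (z : ℂ) : imDiv v (s * z) = s * imDiv v z := by
  rw [← Complex.real_smul, map_smul, smul_eq_mul]

theorem eq_iff_reDiv_imDiv {v : ℂ} (hv : v ≠ 0) {z w : ℂ} :
    z = w ↔ reDiv v z = reDiv v w ∧ imDiv v z = imDiv v w := by
  rw [← (planeCoord v hv).symm.injective.eq_iff, planeCoord_symm_apply, planeCoord_symm_apply,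
    Prod.mk_inj]

/-- The symplectic form of the plane in the coordinates of `v`. -/
theorem re_mul_im_sub {v : ℂ} (hv : v ≠ 0) (z w : ℂ) :
    z.re * w.im - z.im * w.re =
      ‖v‖ ^ 2 * (reDiv v z * imDiv v w - imDiv v z * reDiv v w) := by
  have hz := eq_smul_add_smul_I_mul hv z
  have hw := eq_smul_add_smul_I_mul hv w
  rw [← reDiv_apply, ← imDiv_apply] at hz hw
  conv_lhs => rw [hz, hw]
  rw [← Complex.normSq_eq_norm_sq, Complex.normSq_apply]
  simp
  ring

theorem mem_lineThrough_iff {v : ℂ} (hv : v ≠ 0) (z : ℂ) :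
    z ∈ lineThrough v ↔ imDiv v z = 0 := by
  constructor
  · rintro ⟨l, rfl⟩
    rw [imDiv_ofReal_mul, imDiv_self hv, mul_zero]
  · intro h
    refine ⟨reDiv v z, (eq_iff_reDiv_imDiv hv).2 ?_⟩
    rw [reDiv_ofReal_mul, imDiv_ofReal_mul, imDiv_self hv, reDiv_self hv, h, mul_one, mul_zero]
    exact ⟨rfl, rfl⟩

theorem star_mul_im_pos_iff {v : ℂ} (hv : v ≠ 0) (z : ℂ) :
    0 < (star v * z).im ↔ 0 < imDiv v z := by
  have h1 : (star v * z).im = ‖v‖ ^ 2 * imDiv v z := by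
    have := re_mul_im_sub hv v z
    rw [reDiv_self hv, imDiv_self hv] at this
    simp
    linarith
  have : 0 < ‖v‖ ^ 2 := by positivity
  rw [h1, mul_pos_iff_of_pos_left this]

theorem mem_planarRay_iff {v : ℂ} (hv : v ≠ 0) {θ : ℝ} (hθ : sin θ ≠ 0) (l : ℝ) (z : ℂ) :
    z ∈ planarRay v l θ ↔
      0 ≤ imDiv v z / sin θ ∧ reDiv v z = l + imDiv v z * (cos θ / sin θ) := by
  have hr : reDiv v (rotVec v θ) = cos θ := by rw [reDiv_apply, rotVec_div_re hv]
  have hi : imDiv v (rotVec v θ) = sin θ := by rw [imDiv_apply, rotVec_div_im hv]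
  constructor
  · rintro ⟨s, hs, rfl⟩
    change 0 ≤ imDiv v (l * v + s * rotVec v θ) / _ ∧ reDiv v (l * v + s * rotVec v θ) =
      l + imDiv v (l * v + s * rotVec v θ) * _
    simp only [map_add, reDiv_ofReal_mul, imDiv_ofReal_mul, reDiv_self hv, imDiv_self hv, hr, hi]
    constructor
    · rwa [mul_zero, zero_add, mul_div_cancel_right₀ _ hθ]
    · field_simp
      ring
  · rintro ⟨h1, h2⟩
    refine ⟨imDiv v z / sin θ, h1, ?_⟩
    change z = l * v + ((imDiv v z / sin θ : ℝ) : ℂ) * rotVec v θ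
    rw [eq_iff_reDiv_imDiv hv]
    simp only [map_add, reDiv_ofReal_mul, imDiv_ofReal_mul, reDiv_self hv, imDiv_self hv, hr, hi]
    constructor
    · rw [h2]
      field_simp
    · field_simp
      ring

/-- The third coordinate of the product is minus the symplectic form of the foot `l v` and the
displacement, in which only the component transversal to `v` counts. -/
theorem mem_horizontalRay_iff {v : ℂ} (hv : v ≠ 0) {θ : ℝ} (l : ℝ) (p : ℂ × ℝ) :
    p ∈ horizontalRay v l θ ↔
      p.1 ∈ planarRay v l θ ∧ p.2 = -(‖v‖ ^ 2 * (imDiv v p.1 * l)) := by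
  have hi : ∀ s : ℝ, imDiv v ((l : ℂ) * v + s * rotVec v θ) = s * sin θ := fun s => by
    rw [map_add, imDiv_ofReal_mul, imDiv_ofReal_mul, imDiv_self hv, imDiv_apply,
      rotVec_div_im hv, mul_zero, zero_add]
  have hmul : ∀ s : ℝ, heisMul ((l : ℂ) * v, 0) ((s : ℂ) * (v * Complex.exp (θ * Complex.I)), 0) =
      ((l : ℂ) * v + s * rotVec v θ, -(‖v‖ ^ 2 * (s * sin θ * l))) := by
    intro s
    refine Prod.ext rfl ?_
    have h := re_mul_im_sub hv ((l : ℂ) * v) (s * rotVec v θ)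
    rw [reDiv_ofReal_mul, imDiv_ofReal_mul, imDiv_ofReal_mul, reDiv_self hv, imDiv_self hv,
      imDiv_apply, rotVec_div_im hv] at h
    change 0 + 0 + ((s : ℂ) * rotVec v θ).re * ((l : ℂ) * v).im -
      ((l : ℂ) * v).re * ((s : ℂ) * rotVec v θ).im = _
    linarith
  constructor
  · rintro ⟨s, hs, rfl⟩
    rw [hmul]
    exact ⟨⟨s, hs, rfl⟩, by simp only [hi]⟩
  · rintro ⟨⟨s, hs, h1⟩, h2⟩
    refine ⟨s, hs, ?_⟩
    rw [hmul]
    refine Prod.ext h1 ?_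
    rw [h2, h1]
    exact congrArg (fun t => -(‖v‖ ^ 2 * (t * l))) (hi s)

section

variable {v : ℂ} {α β : ℝ → ℝ}

/-- The signs of `sin α` and `sin β` place the two rays in opposite closed half-planes, where the
foot equation has a unique solution. -/
theorem mem_planarRay_iff_sweepFoot (hv : v ≠ 0) (hα : ∀ l, 0 < sin (α l))
    (hβ : ∀ l, sin (β l) < 0) (hA : Monotone fun l => cos (α l) / sin (α l))
    (hAc : Continuous fun l => cos (α l) / sin (α l))
    (hB : Antitone fun l => cos (β l) / sin (β l))
    (hBc : Continuous fun l => cos (β l) / sin (β l)) (l : ℝ) (z : ℂ) :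
    z ∈ planarRay v l (α l) ∪ planarRay v l (β l) ↔
      sweepFoot v (fun l => cos (α l) / sin (α l)) (fun l => cos (β l) / sin (β l)) z = l := by
  rw [mem_union, mem_planarRay_iff hv (hα l).ne', mem_planarRay_iff hv (hβ l).ne]
  constructor
  · rintro (⟨h1, h2⟩ | ⟨h1, h2⟩)
    · refine eq_sweepFoot_upper hA hAc ?_ h2
      by_contra hcon
      push Not at hcon
      exact absurd (div_neg_of_neg_of_pos hcon (hα l)) (not_lt.2 h1)
    · refine eq_sweepFoot_lower hA hAc hB hBc ?_ h2
      by_contra hcon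
      push Not at hcon
      exact absurd (div_neg_of_pos_of_neg hcon (hβ l)) (not_lt.2 h1)
  · rintro rfl
    rcases le_total 0 (imDiv v z) with h | h
    · exact Or.inl ⟨div_nonneg h (hα _).le, sweepFoot_spec_upper hA hAc h⟩
    · exact Or.inr ⟨div_nonneg_of_nonpos h (hβ _).le, sweepFoot_spec_lower hA hAc hB hBc h⟩

/-- The difference of cotangents is `sin (b - a) / (sin a * sin b)`. -/
theorem cos_div_sin_le {a b : ℝ} (h : 0 < sin a * sin b) (hab : a ≤ b) (hba : b ≤ a + π) :
    cos b / sin b ≤ cos a / sin a := by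
  have ha : sin a ≠ 0 := left_ne_zero_of_mul h.ne'
  have hb : sin b ≠ 0 := right_ne_zero_of_mul h.ne'
  have h1 : cos a / sin a - cos b / sin b = sin (b - a) / (sin a * sin b) := by
    rw [sin_sub]
    field_simp
  have h2 : 0 ≤ sin (b - a) := sin_nonneg_of_nonneg_of_le_pi (by linarith) (by linarith)
  have h3 := div_nonneg h2 h.le
  linarith

/-! ### Normal, tangent planes and singular points. -/

/-- The normal to the ruled surface along the half-line of angle `θ`. -/
theorem inner_graphNormal_sweepHeight {A B : ℝ → ℝ} (hv : v ≠ 0) {z : ℂ} {θ c : ℝ}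
    (hθ : sin θ ≠ 0)
    (hfoot : HasFDerivAt (sweepFoot v A B) (c • (reDiv v - (cos θ / sin θ) • imDiv v)) z)
    (hz : reDiv v z = sweepFoot v A B z + imDiv v z * (cos θ / sin θ)) (w : ℂ) :
    inner ℝ w (graphNormal (sweepHeight v A B) z) =
      imDiv v z * (1 + c) / sin θ * (inner ℝ (Complex.I * rotVec v θ) w : ℝ) := by
  have h1 := (((imDiv v).hasFDerivAt (x := z)).mul hfoot).const_mul (‖v‖ ^ 2) |>.neg
  have h2 : (inner ℝ (Complex.I * rotVec v θ) w : ℝ) =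
      ‖v‖ ^ 2 * (cos θ * imDiv v w - sin θ * reDiv v w) := by
    have h := re_mul_im_sub hv (rotVec v θ) w
    rw [imDiv_apply v (rotVec v θ), reDiv_apply v (rotVec v θ), rotVec_div_im hv,
      rotVec_div_re hv] at h
    rw [← h]
    simp [Complex.inner]
    ring
  have h3 : fderiv ℝ (sweepHeight v A B) z w = -(‖v‖ ^ 2 * (imDiv v z *
      (c * (reDiv v w - cos θ / sin θ * imDiv v w)) + sweepFoot v A B z * imDiv v w)) := by
    rw [show fderiv ℝ (sweepHeight v A B) z = _ from h1.fderiv]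
    simp
    ring
  rw [inner_graphNormal, re_mul_im_sub hv, h2, hz, h3]
  field_simp
  ring

theorem mem_horizontalPlane_iff (p x : ℂ × ℝ) :
    x ∈ horizontalPlane p ↔ x.2 = p.1.im * x.1.re - p.1.re * x.1.im := by
  rw [horizontalPlane, Submodule.mem_span_pair, heisX, heisY]
  constructor
  · rintro ⟨a, b, rfl⟩
    simp
    ring
  · intro h
    refine ⟨x.1.re, x.1.im, Prod.ext ?_ ?_⟩
    · apply Complex.ext <;> simp
    · simp [h]
      ring

theorem mem_graphTangentPlane_iff (u : ℂ → ℝ) (z : ℂ) (x : ℂ × ℝ) :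
    x ∈ graphTangentPlane u z ↔ x.2 = fderiv ℝ u z x.1 := by
  rw [graphTangentPlane, LinearMap.mem_range]
  constructor
  · rintro ⟨y, rfl⟩
    rfl
  · intro h
    exact ⟨x.1, Prod.ext rfl h.symm⟩

theorem graphTangentPlane_eq_horizontalPlane_iff (u : ℂ → ℝ) (z : ℂ) (t : ℝ) :
    graphTangentPlane u z = horizontalPlane (z, t) ↔
      ∀ w : ℂ, (inner ℝ w (graphNormal u z) : ℝ) = 0 := by
  have h1 : ∀ w : ℂ, (inner ℝ w (graphNormal u z) : ℝ) = 0 ↔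
      fderiv ℝ u z w = z.im * w.re - z.re * w.im := fun w => by
    rw [inner_graphNormal]
    constructor <;> intro h <;> linarith
  simp only [h1]
  constructor
  · intro h w
    have h2 : (w, fderiv ℝ u z w) ∈ graphTangentPlane u z :=
      (mem_graphTangentPlane_iff _ _ _).2 rfl
    rw [h, mem_horizontalPlane_iff] at h2
    exact h2
  · intro h
    ext x
    rw [mem_graphTangentPlane_iff, mem_horizontalPlane_iff, h]

theorem volume_im_eq_zero (hv : v ≠ 0) : ∀ᵐ z : ℂ, imDiv v z ≠ 0 := by
  rw [ae_iff]
  have h1 : LinearMap.ker (imDiv v : ℂ →ₗ[ℝ] ℝ) ≠ ⊤ := by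
    intro h
    have h2 : Complex.I * v ∈ LinearMap.ker (imDiv v : ℂ →ₗ[ℝ] ℝ) := by
      rw [h]
      trivial
    have h3 : imDiv v (Complex.I * v) = 0 := h2
    rw [imDiv_apply, mul_div_assoc, div_self hv] at h3
    simp at h3
  have h4 := Measure.addHaar_submodule (volume : Measure ℂ) _ h1
  convert h4 using 2
  ext z
  simp

/-- The Gauss curve moves parallel to `rotVec v θ`, whose components have ratio `cot θ`. This is the
relation that makes the calibrating field divergence free. -/
theorem deriv_reDiv_gaussCurve {K : Set ℂ} (hK : IsConvexBodyCPlus 2 K) (hv : v ≠ 0) {θ : ℝ → ℝ}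
    {l : ℝ} (hθ : DifferentiableAt ℝ θ l) (hs : sin (θ l) ≠ 0) :
    deriv (fun l => reDiv v (gaussCurve K v (θ l))) l =
      cos (θ l) / sin (θ l) * deriv (fun l => gaussHeight K v (θ l)) l := by
  obtain ⟨r, -, hr⟩ := hasDerivAt_gaussCurve hK hv (θ l)
  have h1 := hr.scomp l hθ.hasDerivAt
  have h2 := (reDiv v).hasFDerivAt.comp_hasDerivAt l h1
  have h3 := (imDiv v).hasFDerivAt.comp_hasDerivAt l h1
  have e1 : (fun l => reDiv v (gaussCurve K v (θ l))) = reDiv v ∘ gaussCurve K v ∘ θ := rfl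
  have e2 : (fun l => gaussHeight K v (θ l)) = imDiv v ∘ gaussCurve K v ∘ θ := by
    rw [gaussHeight_eq]
    rfl
  rw [e1, e2, h2.deriv, h3.deriv]
  simp only [map_smul, reDiv_apply, imDiv_apply, rotVec_div_im hv, rotVec_div_re hv, smul_eq_mul]
  field_simp

end

/-! ### Calibration and singular set of the ruled surface. -/

theorem isPerimeterMinimizing_sweepHeight {K : Set ℂ} (hK : IsConvexBodyCPlus 2 K)
    (hK0 : (0 : ℂ) ∈ interior K) {v : ℂ} (hv : v ≠ 0) {α β : ℝ → ℝ} (hα : ContDiff ℝ 1 α)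
    (hβ : ContDiff ℝ 1 β) (hsα : ∀ l, 0 < sin (α l)) (hsβ : ∀ l, sin (β l) < 0)
    (hA : Monotone fun l => cos (α l) / sin (α l))
    (hB : Antitone fun l => cos (β l) / sin (β l))
    (hheight : ∀ l, gaussHeight K v (β l) = gaussHeight K v (α l)) :
    IsPerimeterMinimizing K {p : ℂ × ℝ | sweepHeight v (fun l => cos (α l) / sin (α l))
      (fun l => cos (β l) / sin (β l)) p.1 < p.2} := by
  set A : ℝ → ℝ := fun l => cos (α l) / sin (α l) with hAdef
  set B : ℝ → ℝ := fun l => cos (β l) / sin (β l) with hBdef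
  have hA1 : ContDiff ℝ 1 A :=
    (contDiff_cos.comp hα).div (contDiff_sin.comp hα) fun l => (hsα l).ne'
  have hB1 : ContDiff ℝ 1 B :=
    (contDiff_cos.comp hβ).div (contDiff_sin.comp hβ) fun l => (hsβ l).ne
  have hne := hK.interior_nonempty.mono interior_subset
  have hg : ContDiff ℝ 1 (gaussCurve K v) := contDiff_gaussCurve (m := 1) le_rfl hK hv
  have hgK : ∀ θ, gaussCurve K v θ ∈ K := fun θ =>
    gaussInv_mem hK.isCompact hne (I_mul_rotVec_ne_zero hv θ)
  have hfoot := continuous_sweepFoot (v := v) hA hB hA1 hB1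
  set U : ℂ → ℂ := fun z => if 0 ≤ imDiv v z then gaussCurve K v (α (sweepFoot v A B z))
    else gaussCurve K v (β (sweepFoot v A B z)) with hU
  -- The normal is `y (1 + c) / sin θ`, a nonnegative factor, times `J` of the ray direction, and
  -- the Gauss curve maximises the pairing with the latter over `K`.
  have hcal : ∀ (z : ℂ) (θ c : ℝ), sin θ ≠ 0 → 0 ≤ imDiv v z / sin θ → 0 < c →
      HasFDerivAt (sweepFoot v A B) (c • (reDiv v - (cos θ / sin θ) • imDiv v)) z →
      reDiv v z = sweepFoot v A B z + imDiv v z * (cos θ / sin θ) → ∀ w ∈ K,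
      (inner ℝ w (graphNormal (sweepHeight v A B) z) : ℝ) ≤
        inner ℝ (gaussCurve K v θ) (graphNormal (sweepHeight v A B) z) := by
    intro z θ c hθ hz hc h1 h2 w hw
    rw [inner_graphNormal_sweepHeight hv hθ h1 h2, inner_graphNormal_sweepHeight hv hθ h1 h2]
    refine mul_le_mul_of_nonneg_left ((isOuterNormalAt_gaussCurve hK hv θ).2 w hw) ?_
    rw [mul_div_right_comm]
    positivity
  refine isPerimeterMinimizing_epigraph hK.isCompact hK.convex hK0
    (contDiff_sweepHeight hA hB hA1 hB1) (U := U) ?_ ?_ ?_ ?_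
  · refine isWeaklyDivFree_sweep hv hA hB hA1 hB1
      (P := fun l => reDiv v (gaussCurve K v (α l))) (Q := fun l => gaussHeight K v (α l))
      (R := fun l => reDiv v (gaussCurve K v (β l))) ?_ ?_ ?_ ?_ ?_ ?_
    · exact (reDiv v).contDiff.comp (hg.comp hα)
    · exact (contDiff_gaussHeight (m := 1) le_rfl hK hv).comp hα
    · exact (reDiv v).contDiff.comp (hg.comp hβ)
    · exact fun l => deriv_reDiv_gaussCurve hK hv (hα.differentiable one_ne_zero l) (hsα l).ne'
    · intro l
      rw [deriv_reDiv_gaussCurve hK hv (hβ.differentiable one_ne_zero l) (hsβ l).ne]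
      -- The equality of heights at `α` and `β` lets a single `Q` serve on both sides of the line.
      simp only [hheight, hBdef]
    · intro z
      rw [← (planeCoord v hv).symm_apply_eq, planeCoord_symm_apply, hU]
      by_cases h : 0 ≤ imDiv v z
      · simp only [if_pos h]
        rw [gaussHeight, imDiv_apply]
      · simp only [if_neg h]
        rw [← hheight, gaussHeight, imDiv_apply]
  · refine Measurable.ite (isClosed_le continuous_const (imDiv v).continuous).measurableSet ?_ ?_
    · exact (hg.continuous.comp (hα.continuous.comp hfoot)).measurable
    · exact (hg.continuous.comp (hβ.continuous.comp hfoot)).measurable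
  · intro z
    simp only [hU]
    split_ifs
    · exact hgK _
    · exact hgK _
  · filter_upwards [volume_im_eq_zero hv] with z hz
    rcases hz.lt_or_gt with h | h
    · obtain ⟨c, hc, hd⟩ := hasFDerivAt_sweepFoot_lower (A := A) hB hB1 h
      have h1 : U z = gaussCurve K v (β (sweepFoot v A B z)) := if_neg (not_le.2 h)
      rw [h1]
      exact hcal z _ c (hsβ _).ne (div_nonneg_of_nonpos h.le (hsβ _).le) hc hd
        (sweepFoot_spec_lower hA hA1.continuous hB hB1.continuous h.le)
    · obtain ⟨c, hc, hd⟩ := hasFDerivAt_sweepFoot_upper (B := B) hA hA1 h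
      have h1 : U z = gaussCurve K v (α (sweepFoot v A B z)) := if_pos h.le
      rw [h1]
      exact hcal z _ c (hsα _).ne' (div_nonneg h.le (hsα _).le) hc hd
        (sweepFoot_spec_upper hA hA1.continuous h.le)

/-- Off the line the normal is a nonzero multiple of `J` of the ray direction, with factor `y (1 +
c) / sin θ`. On the line the differential `-‖v‖² x dy` exactly cancels the symplectic term. -/
theorem fst_image_graphSingularSet_sweepHeight {v : ℂ} (hv : v ≠ 0) {α β : ℝ → ℝ}
    (hα : ContDiff ℝ 1 α) (hβ : ContDiff ℝ 1 β) (hsα : ∀ l, 0 < sin (α l))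
    (hsβ : ∀ l, sin (β l) < 0) (hA : Monotone fun l => cos (α l) / sin (α l))
    (hB : Antitone fun l => cos (β l) / sin (β l)) :
    Prod.fst '' graphSingularSet (sweepHeight v (fun l => cos (α l) / sin (α l))
      (fun l => cos (β l) / sin (β l))) = lineThrough v := by
  set A : ℝ → ℝ := fun l => cos (α l) / sin (α l) with hAdef
  set B : ℝ → ℝ := fun l => cos (β l) / sin (β l) with hBdef
  have hA1 : ContDiff ℝ 1 A :=
    (contDiff_cos.comp hα).div (contDiff_sin.comp hα) fun l => (hsα l).ne'
  have hB1 : ContDiff ℝ 1 B :=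
    (contDiff_cos.comp hβ).div (contDiff_sin.comp hβ) fun l => (hsβ l).ne
  have hreg : ∀ (z : ℂ) (θ c : ℝ), sin θ ≠ 0 → imDiv v z ≠ 0 → 0 < c →
      HasFDerivAt (sweepFoot v A B) (c • (reDiv v - (cos θ / sin θ) • imDiv v)) z →
      reDiv v z = sweepFoot v A B z + imDiv v z * (cos θ / sin θ) →
      ¬ ∀ w : ℂ, (inner ℝ w (graphNormal (sweepHeight v A B) z) : ℝ) = 0 := by
    intro z θ c hθ hz hc h1 h2 h
    have h3 := h (Complex.I * rotVec v θ)
    rw [inner_graphNormal_sweepHeight hv hθ h1 h2, real_inner_self_eq_norm_sq] at h3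
    have h4 := I_mul_rotVec_ne_zero hv θ
    have h5 : 1 + c ≠ 0 := by linarith
    exact (mul_ne_zero (div_ne_zero (mul_ne_zero hz h5) hθ)
      (pow_ne_zero 2 (norm_ne_zero_iff.2 h4))) h3
  ext z
  rw [mem_lineThrough_iff hv]
  constructor
  · rintro ⟨⟨z, t⟩, ⟨-, -, h3⟩, rfl⟩
    rw [graphTangentPlane_eq_horizontalPlane_iff] at h3
    by_contra hz
    rcases lt_or_gt_of_ne hz with h | h
    · obtain ⟨c, hc, hd⟩ := hasFDerivAt_sweepFoot_lower (A := A) hB hB1 h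
      exact hreg z _ c (hsβ _).ne hz hc hd
        (sweepFoot_spec_lower hA hA1.continuous hB hB1.continuous (le_of_lt h)) h3
    · obtain ⟨c, hc, hd⟩ := hasFDerivAt_sweepFoot_upper (B := B) hA hA1 h
      exact hreg z _ c (hsα _).ne' hz hc hd
        (sweepFoot_spec_upper hA hA1.continuous (le_of_lt h)) h3
  · intro hz
    refine ⟨(z, sweepHeight v A B z), ⟨rfl,
      (contDiff_sweepHeight hA hB hA1 hB1).differentiable one_ne_zero z, ?_⟩, rfl⟩
    rw [graphTangentPlane_eq_horizontalPlane_iff]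
    intro w
    rw [inner_graphNormal, fderiv_sweepHeight_of_im_eq_zero hA hB hA1 hB1 hz, re_mul_im_sub hv, hz]
    simp
    ring

end

/-! ### The proposition. -/

theorem proposition4p1
    (K : Set ℂ) (hK : IsConvexBodyCPlus 2 K) (hK0 : (0 : ℂ) ∈ interior K)
    (v : ℂ) (hv : v ≠ 0)
    (k : ℕ) (hk : 2 ≤ k)
    (α β : ℝ → ℝ) (hα : ContDiff ℝ k α) (hmono : Antitone α) (hrange : ∀ l, α l ∈ Ioo 0 π)
    (hβ : ∀ l, β l = conjAngle K v (α l)) :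
    -- `β` is of class `C^m` if the boundary of `K` is of class `C^{m+1}`, `1 ≤ m ≤ k`
    (∀ m : ℕ, 1 ≤ m → m ≤ k → IsConvexBodyCPlus (m + 1) K → ContDiff ℝ m β) ∧
    -- the surface is the graph of a continuous function `u`
    ∃ u : ℂ → ℝ, (∀ p : ℂ × ℝ, p ∈ herringbone v α β ↔ p.2 = u p.1) ∧ Continuous u ∧
      -- regularity off `L_v`
      ContDiffOn ℝ k u {z | 0 < (star v * z).im} ∧
      (∀ m : ℕ, m ≤ k → ContDiff ℝ m β → ContDiffOn ℝ m u (lineThrough v)ᶜ) ∧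
      -- exactly `C^{1,1}` near `L_v` where `β ≠ α + π`
      ContDiff ℝ 1 u ∧
      (ContDiff ℝ 2 β → ∀ z ∈ lineThrough v, ∃ N ∈ 𝓝 z, ∃ C : NNReal,
        LipschitzOnWith C (fderiv ℝ u) N) ∧
      (∀ l : ℝ, β l ≠ α l + π → ¬ ContDiffAt ℝ 2 u ((l : ℂ) * v)) ∧
      -- smoothness where `β = α + π`
      (∀ A : Set ℝ, IsOpen A → (∀ l ∈ A, β l = α l + π) →
        IsOpen (planarSweep v α β A) ∧ ContDiffOn ℝ ((⊤ : ℕ∞) : WithTop ℕ∞) u (planarSweep v α β A)) ∧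
      -- minimality; the region above the surface has `J(Z)` as outer horizontal normal
      IsPerimeterMinimizing K {p : ℂ × ℝ | u p.1 < p.2} ∧
      ((∀ x ∈ K, -x ∈ K) → IsPerimeterMinimizing K {p : ℂ × ℝ | p.2 < u p.1}) ∧
      -- the singular set
      Prod.fst '' graphSingularSet u = lineThrough v := by
  have hβ' : β = fun l => conjAngle K v (α l) := funext hβ
  have hspec : ∀ l, β l ∈ Ioo π (2 * π) ∧ gaussHeight K v (β l) = gaussHeight K v (α l) :=
    fun l => by
      rw [hβ]
      exact conjAngle_spec hK hv (hrange l)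
  have hβmono : Monotone β := by
    rw [hβ']
    exact monotone_conjAngle_comp hK hv hmono hrange
  have hreg : ∀ m : ℕ, 1 ≤ m → m ≤ k → IsConvexBodyCPlus (m + 1) K → ContDiff ℝ m β := by
    intro m hm hmk hKm
    rw [hβ']
    exact contDiff_conjAngle_comp hK hv hm hKm (hα.of_le (by exact_mod_cast hmk)) hrange
  have hα1 : ContDiff ℝ 1 α := hα.of_le (by norm_cast; omega)
  have hα2 : ContDiff ℝ 2 α := hα.of_le (by exact_mod_cast hk)
  have hβ1 : ContDiff ℝ 1 β := by simpa using hreg 1 le_rfl (by omega) hK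
  have hsα : ∀ l, 0 < sin (α l) := fun l => sin_pos_of_mem_Ioo (hrange l)
  have hsβ : ∀ l, sin (β l) < 0 := fun l => sin_neg_of_mem (hspec l).1
  set A : ℝ → ℝ := fun l => cos (α l) / sin (α l) with hAdef
  set B : ℝ → ℝ := fun l => cos (β l) / sin (β l) with hBdef
  have hAn : ∀ {n : WithTop ℕ∞}, ContDiff ℝ n α → ContDiff ℝ n A := fun h =>
    (contDiff_cos.comp h).div (contDiff_sin.comp h) fun l => (hsα l).ne'
  have hBn : ∀ {n : WithTop ℕ∞}, ContDiff ℝ n β → ContDiff ℝ n B := fun h =>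
    (contDiff_cos.comp h).div (contDiff_sin.comp h) fun l => (hsβ l).ne
  have hA : Monotone A := fun l l' hl => cos_div_sin_le (mul_pos (hsα _) (hsα _)) (hmono hl)
    (by linarith [(hrange l).2, (hrange l').1])
  have hB : Antitone B := fun l l' hl => cos_div_sin_le (mul_pos_of_neg_of_neg (hsβ _) (hsβ _))
    (hβmono hl) (by linarith [(hspec l).1.1, (hspec l').1.2])
  have hA1 := hAn hα1
  have hB1 := hBn hβ1
  have hu1 : ContDiff ℝ 1 (sweepHeight v A B) := contDiff_sweepHeight hA hB hA1 hB1
  have hray := mem_planarRay_iff_sweepFoot hv hsα hsβ hA hA1.continuous hB hB1.continuous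
  have hmin := isPerimeterMinimizing_sweepHeight hK hK0 hv hα1 hβ1 hsα hsβ hA hB
    fun l => (hspec l).2
  refine ⟨hreg, sweepHeight v A B, fun p => ?_, hu1.continuous, fun z hz => ?_,
    fun m hmk hβm z hz => ?_, hu1, fun hβ2 z _ => ?_, fun l hne h => ?_, fun I hI hIβ => ?_,
    hmin, fun hsymm => hmin.hypograph hsymm hK.isCompact.isClosed hK.convex hK0 hu1.continuous,
    fst_image_graphSingularSet_sweepHeight hv hα1 hβ1 hsα hsβ hA hB⟩
  · simp only [herringbone, mem_iUnion, mem_union, mem_horizontalRay_iff hv]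
    constructor
    · rintro ⟨l, h | h⟩
      · rw [sweepHeight, (hray l p.1).1 (Or.inl h.1)]
        exact h.2
      · rw [sweepHeight, (hray l p.1).1 (Or.inr h.1)]
        exact h.2
    · intro h
      refine ⟨sweepFoot v A B p.1, ?_⟩
      rcases (hray _ p.1).2 rfl with h' | h'
      · exact Or.inl ⟨h', h⟩
      · exact Or.inr ⟨h', h⟩
  · exact (contDiffAt_sweepHeight_upper hA (by norm_cast; omega) (hAn hα)
      ((star_mul_im_pos_iff hv z).1 hz)).contDiffWithinAt
  -- The implicit function theorem needs at least one derivative, so `m = 0` is treated by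
  -- continuity.
  · rcases Nat.eq_zero_or_pos m with rfl | hm
    · exact (contDiff_zero.2 hu1.continuous).contDiffWithinAt
    · have hm0 : (m : WithTop ℕ∞) ≠ 0 := by
        norm_cast
        omega
      have hz' : imDiv v z ≠ 0 := fun h => hz ((mem_lineThrough_iff hv z).2 h)
      refine ContDiffAt.contDiffWithinAt ?_
      rcases hz'.lt_or_gt with h | h
      · exact contDiffAt_sweepHeight_lower hA hA1.continuous hB hm0 (hBn hβm) h
      · exact contDiffAt_sweepHeight_upper hA hm0 (hAn (hα.of_le (by exact_mod_cast hmk))) h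
  · exact exists_lipschitzOnWith_fderiv_sweepHeight hA hB (hAn hα2) (hBn hβ2) z
  · have h1 : cos (α l) / sin (α l) = cos (β l) / sin (β l) :=
      eq_of_contDiffAt_two_sweepHeight hv hA hB hA1 hB1 h
    rw [div_eq_div_iff (hsα l).ne' (hsβ l).ne] at h1
    -- Equal cotangents give a zero of the sine; since `β - α - π` lies in `(-π, π)`, it must be
    -- `0`.
    have h2 : sin (β l - α l - π) = 0 := by
      rw [sin_sub_pi, sin_sub]
      linarith
    have h3 := (hrange l)
    have h4 := (hspec l).1
    have h5 := (sin_eq_zero_iff_of_lt_of_lt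
      (by linarith [h3.2, h4.1]) (by linarith [h3.1, h4.2])).1 h2
    exact hne (by linarith)
  · have hsweep : planarSweep v α β I = sweepFoot v A B ⁻¹' I := by
      ext z
      simp only [planarSweep, mem_iUnion, mem_preimage, exists_prop]
      constructor
      · rintro ⟨l, hl, h⟩
        rwa [(hray l z).1 h]
      · intro h
        exact ⟨_, h, (hray _ z).2 rfl⟩
    have hAB : ∀ l ∈ I, A l = B l := by
      intro l hl
      simp only [hAdef, hBdef, hIβ l hl, cos_add_pi, sin_add_pi, neg_div_neg_eq]
    rw [hsweep]
    exact ⟨hI.preimage (continuous_sweepFoot hA hB hA1 hB1), fun z hz =>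
      (contDiffAt_sweepHeight_of_eqOn hA hB hA1 hB1 hI hAB hz).contDiffWithinAt⟩
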